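/- Let $H$ be a real separable Hilbert space and let $A$ be a densely defined, nonnegative, self-adjoint operator on $H$ with compact inverse; its powers $A^r$, $r\in\mathbb R$, are defined by the spectral decomposition of $A$. Let $0\neq b\in L^1_{loc}([0,\infty))$ be real-valued and $3$-monotone, that is, $b$ is differentiable on $(0,\infty)$ and both $b$ and $-\dot b$ are nonnegative, nonincreasing and convex on $(0,\infty)$, with $\lim_{t\to\infty}b(t)=0$. With $\widehat b(z)=\int_0^\infty b(t)e^{-zt}\,dt$ for $\mathrm{Re}\,z>0$, assume moreover that $$\rho:=1+\frac2\pi\sup\{|\arg\widehat b(z)| : \mathrm{Re}\,z>0\}\in(1,2).$$ Let $\{S(t)\}_{t\ge0}\subset\mathcal B(H)$ be the resolvent family of the Volterra equation $$\dot u(t)+\int_0^t b(t-s)\,A u(s)\,ds=0,\quad t>0,\qquad u(0)=x,$$ that is, $S$ is strongly continuous on $[0,\infty)$, $S(0)=I$, $S(t)$ maps $D(A)$ into $D(A)$ and commutes with $A$ there, and $u(t)=S(t)x$ solves this equation for every $x\in D(A)$. Then $S$ is strongly differentiable on $(0,\infty)$ with derivatives $\dot S(t)\in\mathcal B(H)$,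 and there exist constants $C_0,C_1>0$, independent of $t$, $s$ and $s'$, such that for all $t>0$, $0\le s\le 2/\rho$ and $0\le s'\le 2$, the operators $A^{s/2}S(t)$ and $A^{-s'/2}\dot S(t)$ are everywhere defined and bounded on $H$ and $$\|A^{s/2}S(t)\|_{\mathcal B(H)}\le C_0\,t^{-s\rho/2},\qquad \|A^{-s'/2}\dot S(t)\|_{\mathcal B(H)}\le C_1\,\|b\|_{L^1(0,t)}^{s'/2}\,t^{s'/2-1}.$$ -/

import Mathlib

open MeasureTheory Set Filter Topology

namespace VolterraResolvent

section Kernel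

/-- The Laplace transform `∫₀^∞ b(t) e^{-zt} dt` of a real kernel (used for `Re z > 0`). -/
noncomputable def laplaceTransform (b : ℝ → ℝ) (z : ℂ) : ℂ :=
  ∫ t in Ioi (0 : ℝ), (b t : ℂ) * Complex.exp (-z * t)

/-- `ρ = 1 + (2/π) sup {|arg b̂(z)| : Re z > 0}`. The set is nonempty and bounded by `π`. -/
noncomputable def rho (b : ℝ → ℝ) : ℝ :=
  1 + 2 / Real.pi * sSup ((fun z : ℂ => |(laplaceTransform b z).arg|) '' {z : ℂ | 0 < z.re})

/-- The kernel `b ≠ 0` is locally integrable on `[0, ∞)`, is 3-monotone on `(0, ∞)`, tends to `0`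
at infinity, and `ρ ∈ (1, 2)`. The values of `b` on `(-∞, 0]` play no role. -/
structure IsAdmissibleKernel (b : ℝ → ℝ) : Prop where
  locallyIntegrable : LocallyIntegrableOn b (Ici 0)
  ne_zero : ∃ t, 0 < t ∧ b t ≠ 0
  differentiable : DifferentiableOn ℝ b (Ioi 0)
  nonneg : ∀ t, 0 < t → 0 ≤ b t
  antitone : AntitoneOn b (Ioi 0)
  convex : ConvexOn ℝ (Ioi 0) b
  neg_deriv_nonneg : ∀ t, 0 < t → 0 ≤ -deriv b t
  neg_deriv_antitone : AntitoneOn (fun t => -deriv b t) (Ioi 0)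
  neg_deriv_convex : ConvexOn ℝ (Ioi 0) (fun t => -deriv b t)
  tendsto_zero : Tendsto b atTop (𝓝 0)
  one_lt_rho : 1 < rho b
  rho_lt_two : rho b < 2

end Kernel

section Operator

variable {H : Type*} [NormedAddCommGroup H] [InnerProductSpace ℝ H] [CompleteSpace H]

/-- A densely defined, nonnegative, self-adjoint operator `A : D(A) ⊆ H → H` that has a
compact inverse. -/
structure IsAdmissibleOperator (A : H →ₗ.[ℝ] H) : Prop where
  dense_domain : Dense (A.domain : Set H)
  selfAdjoint : IsSelfAdjoint A
  nonneg : ∀ x : A.domain, 0 ≤ inner ℝ (A x) (x : H)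
  compact_inverse : ∃ K : H →L[ℝ] H, IsCompactOperator K ∧
    (∀ y : H, ∃ h : K y ∈ A.domain, A ⟨K y, h⟩ = y) ∧ ∀ x : A.domain, K (A x) = x

/-- The eigenspace `{x ∈ D(A) : A x = μ x}`, that is, the set of all `x` for which `(x, μ x)`
lies in the graph of `A`. -/
def eigenspace (A : H →ₗ.[ℝ] H) (μ : ℝ) : Submodule ℝ H :=
  A.graph.comap (LinearMap.id.prod (μ • LinearMap.id))

/-- The orthogonal projection of `H` onto the eigenspace for `μ`; it vanishes when `μ` is not an
eigenvalue. (The eigenspace of a closed operator is closed, so the closure changes nothing.) -/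
noncomputable def eigenProj (A : H →ₗ.[ℝ] H) (μ : ℝ) : H →L[ℝ] H :=
  (eigenspace A μ).topologicalClosure.starProjection

/-- The power `A ^ r` by means of the spectral decomposition: `A ^ r x = ∑ μ ^ r P_μ x`, the sum
being over the eigenvalues `μ` of `A`, with domain the set of all `x` for which this orthogonal
series converges in `H` (that is, `∑ μ ^ (2 r) ‖P_μ x‖² < ∞`). Only finitely or countably many
terms are nonzero, and for a positive operator only terms with `μ > 0`. -/
noncomputable def fracPow (A : H →ₗ.[ℝ] H) (r : ℝ) : H →ₗ.[ℝ] H where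
  domain :=
    { carrier := {x | Summable fun μ : ℝ => μ ^ r • eigenProj A μ x}
      zero_mem' := by simp [summable_zero]
      add_mem' := fun {x y} hx hy => by
        simpa only [mem_ofPred_eq, map_add, smul_add] using Summable.add hx hy
      smul_mem' := fun c x hx => by
        simpa only [mem_ofPred_eq, map_smul, smul_comm _ c] using Summable.const_smul c hx }
  toFun :=
    { toFun := fun x => ∑' μ : ℝ, μ ^ r • eigenProj A μ (x : H)
      map_add' := fun x y => by
        simpa only [Submodule.coe_add, map_add, smul_add] using Summable.tsum_add x.2 y.2
      map_smul' := fun c x => by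
        simpa only [Submodule.coe_smul, map_smul, smul_comm _ c, RingHom.id_apply] using
          Summable.tsum_const_smul c x.2 }

/-- `S` is the resolvent family of `u'(t) + ∫₀ᵗ b(t - s) A u(s) ds = 0`, `u(0) = x`: the operators
`S(t)`, `t ≥ 0`, are bounded, strongly continuous, commute with `A`, and `u(t) = S(t) x` solves
the equation for all `x ∈ D(A)` (where `A u(s) = S(s) A x`). -/
structure IsResolventFamily (A : H →ₗ.[ℝ] H) (b : ℝ → ℝ) (S : ℝ → H →L[ℝ] H) : Prop where
  zero : S 0 = ContinuousLinearMap.id ℝ H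
  continuous : ∀ x : H, ContinuousOn (fun t => S t x) (Ici 0)
  commute : ∀ t, 0 ≤ t → ∀ x : A.domain, ∃ h : S t x ∈ A.domain, A ⟨S t x, h⟩ = S t (A x)
  equation : ∀ x : A.domain, ∀ t, 0 < t →
    HasDerivAt (fun τ => S τ x) (-∫ s in (0 : ℝ)..t, b (t - s) • S s (A x)) t

/-- `T L` is an everywhere defined bounded operator with `‖T L‖ ≤ M`: `L` maps `H` into
`D(T)`, and `‖T L x‖ ≤ M ‖x‖` for all `x`. -/
def CompNormLE (T : H →ₗ.[ℝ] H) (L : H →L[ℝ] H) (M : ℝ) : Prop :=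
  ∀ x : H, ∃ h : L x ∈ T.domain, ‖T ⟨L x, h⟩‖ ≤ M * ‖x‖

end Operator

end VolterraResolvent

/-! The compact inverse splits `H` into eigenspaces of `A`, and `S t` preserves each of them, so
every bound need only be proved on eigenvectors, uniformly in the eigenvalue `μ`
(`compNormLE_fracPow`). There, pairing with a fixed vector leaves the scalar equation `φ' + μ (b *
φ) = 0`, whose solution has transform `φ(0) / (z + μ b̂(z))`.

The scalar equation has a single time scale `r₀`, given by `μ r₀ ∫₀^{r₀} b = 1/2`. Up to `r₀` a
maximum argument bounds `φ`. Beyond `r₀` Laplace inversion is applied to `t φ(t)` and `t φ'(t)` on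
the line `Re z = 1/t`: the factor `t` differentiates the transform, which then decays like `|Im
z|⁻²` and is absolutely integrable, with norm `O(r₀)` and `O(1)` respectively. The outcome is
`exists_scalar_bound`: up to constants and the factor `|φ(0)|`, `|φ|` is bounded by `1` and by `r₀ /
t`, and `|φ'|` by `1 / t` and by `μ ∫₀ᵗ b`.

Three facts carry the line integrals. Since `ρ < 2`, the values of `b̂` lie in a sector strictly
inside the right half-plane, so `z` and `μ b̂(z)` cannot cancel (`exists_le_norm_symbol`). By
3-monotonicity `|b̂(z)|` is comparable to the mass of `b(t) e^{-t Re z}` on `(0, 1/|Im z|)`, and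
`|b̂'(z)|` is at most a multiple of the first moment there. Finally, the quotient moment / mass² has
an integral in frequency that is controlled by an explicit primitive
(`integral_moment_div_mass_sq_le`).

The exponent `ρ` enters through the Schwarz lemma: `b̂ ^ (1 / (ρ - 1))` maps the right half-plane
into its closure, so `x ^ (ρ - 1) b̂(x)` is nondecreasing for `x > 0`. Hence `∫₀ʳ b ≥ c r ^ (ρ - 1)`
for bounded `r`, and `μ r₀ ^ ρ` is bounded over the spectrum. Interpolating between the two bounds
for `φ`, and between those for `φ'`, gives the whole ranges of `s` and `s'`. -/

namespace VolterraResolvent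

/-! ### Sign of sine and cosine integrals -/

section Oscillatory

open Real intervalIntegral

/-- The points `v` and `w` are convex combinations of `u` and `x` with exchanged weights, so the two
convexity inequalities add up. This is how convexity becomes monotonicity of increments throughout.
-/
theorem _root_.ConvexOn.map_add_map_le_of_mem_Icc {s : Set ℝ} {f : ℝ → ℝ} (hf : ConvexOn ℝ s f)
    {u x v w : ℝ} (hu : u ∈ s) (hx : x ∈ s) (huv : u ≤ v) (hvx : v ≤ x) (hw : v + w = u + x) :
    f v + f w ≤ f u + f x := by
  rcases huv.eq_or_lt with rfl | huv'
  · have : w = x := by linarith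
    rw [this]
  have hux : 0 < x - u := by linarith
  have p1 : 0 ≤ (x - v) / (x - u) := by apply div_nonneg <;> linarith
  have p2 : 0 ≤ (v - u) / (x - u) := by apply div_nonneg <;> linarith
  have key := hf.2 hu hx
  have h1 := key p1 p2 (by field_simp; ring)
  have h2 := key p2 p1 (by field_simp; ring)
  have e1 : ((x - v) / (x - u)) • u + ((v - u) / (x - u)) • x = v := by
    simp only [smul_eq_mul]; field_simp; ring
  have e2 : ((v - u) / (x - u)) • u + ((x - v) / (x - u)) • x = w := by
    have : w = u + x - v := by linarith
    rw [this]; simp only [smul_eq_mul]; field_simp; ring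
  rw [e1] at h1
  rw [e2] at h2
  have e3 : (x - v) / (x - u) = 1 - (v - u) / (x - u) := by field_simp; ring
  simp only [smul_eq_mul] at h1 h2
  rw [e3] at h1 h2
  nlinarith

theorem setIntegral_Ioi_nonneg_of_periods {f : ℝ → ℝ} (hf : IntegrableOn f (Ioi 0)) {T : ℝ}
    (hT : 0 < T) (h : ∀ n : ℕ, 0 ≤ ∫ t in (n * T)..((n + 1 : ℕ) * T), f t) :
    0 ≤ ∫ t in Ioi 0, f t := by
  have hlim : Tendsto (fun n : ℕ => ∫ t in (0 : ℝ)..(n * T), f t) atTop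
      (𝓝 (∫ t in Ioi 0, f t)) :=
    intervalIntegral_tendsto_integral_Ioi 0 hf
      (tendsto_natCast_atTop_atTop.atTop_mul_const hT)
  refine ge_of_tendsto' hlim fun n => ?_
  have hint : ∀ a b : ℝ, 0 ≤ a → a ≤ b → IntervalIntegrable f volume a b := fun a b ha hab =>
    (intervalIntegrable_iff_integrableOn_Ioc_of_le hab).2
      (hf.mono_set fun x hx => lt_of_le_of_lt ha hx.1)
  have := sum_integral_adjacent_intervals (f := f) (μ := volume) (a := fun k : ℕ => (k : ℝ) * T)
    (n := n) fun k _ => hint _ _ (by positivity) (by push_cast; nlinarith)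
  simp only [Nat.cast_zero, zero_mul] at this
  rw [← this]
  exact Finset.sum_nonneg fun k _ => h k

theorem integrableOn_mul_of_abs_le_one {f : ℝ → ℝ} {s : Set ℝ} (hf : IntegrableOn f s) {c : ℝ → ℝ}
    (hc : Continuous c) (hc1 : ∀ t, |c t| ≤ 1) : IntegrableOn (fun t => f t * c t) s :=
  hf.mul_bdd (c := 1) hc.aestronglyMeasurable.restrict (ae_of_all _ fun t => by simpa using hc1 t)

/-- On each period the value of `h` at the midpoint can be subtracted, because the sine has mean
zero. The difference and the sine then change sign at the same point. -/
theorem setIntegral_mul_sin_nonneg {h : ℝ → ℝ} (h0 : AntitoneOn h (Ioi 0))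
    (hi : IntegrableOn h (Ioi 0)) : 0 ≤ ∫ t in Ioi 0, h t * sin t := by
  have hfi := integrableOn_mul_of_abs_le_one hi continuous_sin abs_sin_le_one
  refine setIntegral_Ioi_nonneg_of_periods hfi (T := 2 * π) (by positivity) fun n => ?_
  have hle : (n : ℝ) * (2 * π) ≤ ((n + 1 : ℕ) : ℝ) * (2 * π) := by
    push_cast; nlinarith [pi_pos]
  have hint : IntervalIntegrable (fun t => h t * sin t) volume (n * (2 * π))
      ((n + 1 : ℕ) * (2 * π)) :=
    (intervalIntegrable_iff_integrableOn_Ioc_of_le hle).2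
      (hfi.mono_set fun x hx => lt_of_le_of_lt (by positivity) hx.1)
  have hz : ∫ t in (n * (2 * π))..((n + 1 : ℕ) * (2 * π)), h (n * (2 * π) + π) * sin t = 0 := by
    rw [intervalIntegral.integral_const_mul, integral_sin, cos_nat_mul_two_pi, cos_nat_mul_two_pi]
    simp
  have hint' : IntervalIntegrable (fun t => h (n * (2 * π) + π) * sin t) volume (n * (2 * π))
      ((n + 1 : ℕ) * (2 * π)) := Continuous.intervalIntegrable (by fun_prop) _ _
  have key := integral_sub hint hint'
  rw [hz, sub_zero] at key
  rw [← key, intervalIntegral.integral_of_le hle, integral_Ioc_eq_integral_Ioo]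
  refine setIntegral_nonneg measurableSet_Ioo fun t ht => ?_
  have hs : sin t = sin (t - n * (2 * π)) := by rw [sin_sub_nat_mul_two_pi]
  have hn0 : (0 : ℝ) ≤ n * (2 * π) := by positivity
  have ht0 : t ∈ Ioi (0 : ℝ) := lt_of_le_of_lt hn0 ht.1
  have hm0 : (n : ℝ) * (2 * π) + π ∈ Ioi (0 : ℝ) := by have := pi_pos; simp only [mem_Ioi]; linarith
  have ht2 := ht.2
  push_cast at ht2
  rw [← sub_mul, hs]
  rcases le_total t (n * (2 * π) + π) with hc | hc
  · exact mul_nonneg (sub_nonneg.2 (h0 ht0 hm0 hc))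
      (sin_nonneg_of_nonneg_of_le_pi (by linarith [ht.1]) (by linarith))
  · refine mul_nonneg_of_nonpos_of_nonpos (sub_nonpos.2 (h0 hm0 ht0 hc)) ?_
    rw [← sin_sub_two_pi]
    exact sin_nonpos_of_nonpos_of_neg_pi_le (by linarith) (by linarith)

/-- Reflecting each period about its midpoint replaces `h` by the symmetric sum `K`, which by
convexity decreases towards the midpoint. Subtracting the constant `K (π / 2)`, which the cosine
annihilates, leaves a product of two factors with the same sign. -/
theorem setIntegral_mul_cos_nonneg {h : ℝ → ℝ} (h0 : ConvexOn ℝ (Ioi 0) h)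
    (hi : IntegrableOn h (Ioi 0)) : 0 ≤ ∫ t in Ioi 0, h t * cos t := by
  have hfi := integrableOn_mul_of_abs_le_one hi continuous_cos abs_cos_le_one
  refine setIntegral_Ioi_nonneg_of_periods hfi (T := 2 * π) (by positivity) fun n => ?_
  have hpi := pi_pos
  set a : ℝ := n * (2 * π) with ha
  have hn0 : 0 ≤ a := by positivity
  have hb : ((n + 1 : ℕ) : ℝ) * (2 * π) = a + 2 * π := by rw [ha]; push_cast; ring
  rw [hb]
  have hle : a ≤ a + 2 * π := by linarith
  have hca : ∀ t, cos (a + t) = cos t := fun t => by rw [add_comm, ha, cos_add_nat_mul_two_pi]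
  have hint : IntervalIntegrable (fun t => h t * cos t) volume a (a + 2 * π) :=
    (intervalIntegrable_iff_integrableOn_Ioc_of_le hle).2
      (hfi.mono_set fun x hx => lt_of_le_of_lt hn0 hx.1)
  have hi1 : IntervalIntegrable (fun t => h (a + t) * cos t) volume 0 (2 * π) := by
    have := hint.comp_add_left a
    simpa [hca] using this
  have hi2 : IntervalIntegrable (fun t => h (a + (2 * π - t)) * cos t) volume 0 (2 * π) := by
    have := hi1.comp_sub_left (2 * π)
    simpa [cos_two_pi_sub] using this.symm
  have e1 : ∫ t in a..(a + 2 * π), h t * cos t = ∫ t in (0 : ℝ)..(2 * π), h (a + t) * cos t := by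
    have := intervalIntegral.integral_comp_add_left (a := 0) (b := 2 * π)
      (fun t => h t * cos t) a
    simp only [hca, add_zero] at this
    exact this.symm
  have e2 : ∫ t in (0 : ℝ)..(2 * π), h (a + t) * cos t =
      ∫ t in (0 : ℝ)..(2 * π), h (a + (2 * π - t)) * cos t := by
    have := intervalIntegral.integral_comp_sub_left (a := 0) (b := 2 * π)
      (fun t => h (a + t) * cos t) (2 * π)
    simpa [cos_two_pi_sub] using this.symm
  set K : ℝ → ℝ := fun t => h (a + t) + h (a + (2 * π - t)) with hK
  have hiK : IntervalIntegrable (fun t => K t * cos t) volume 0 (2 * π) := by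
    simpa [hK, add_mul] using hi1.add hi2
  have e3 : 2 * ∫ t in a..(a + 2 * π), h t * cos t = ∫ t in (0 : ℝ)..(2 * π), K t * cos t := by
    rw [two_mul]
    nth_rewrite 2 [e1]
    rw [e2, e1, ← integral_add hi1 hi2]
    simp [hK, add_mul]
  have hz : ∫ t in (0 : ℝ)..(2 * π), K (π / 2) * cos t = 0 := by
    rw [intervalIntegral.integral_const_mul, integral_cos]; simp
  suffices 0 ≤ ∫ t in (0 : ℝ)..(2 * π), K t * cos t by linarith
  have hint' : IntervalIntegrable (fun t => K (π / 2) * cos t) volume 0 (2 * π) :=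
    Continuous.intervalIntegrable (by fun_prop) _ _
  have key := integral_sub hiK hint'
  rw [hz, sub_zero] at key
  rw [← key, intervalIntegral.integral_of_le (by positivity), integral_Ioc_eq_integral_Ioo]
  refine setIntegral_nonneg measurableSet_Ioo fun t ht => ?_
  obtain ⟨ht1, ht2⟩ := ht
  have hmem : ∀ {x : ℝ}, 0 < x → a + x ∈ Ioi (0 : ℝ) := fun hx => by
    simp only [mem_Ioi]; linarith
  rw [← sub_mul]
  rcases le_total t (π / 2) with h1 | h1
  · refine mul_nonneg (sub_nonneg.2 ?_) (cos_nonneg_of_neg_pi_div_two_le_of_le (by linarith) h1)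
    exact h0.map_add_map_le_of_mem_Icc (hmem ht1) (hmem (by linarith)) (by linarith) (by linarith)
      (by ring)
  rcases le_total t (3 * π / 2) with h2 | h2
  · refine mul_nonneg_of_nonpos_of_nonpos (sub_nonpos.2 ?_)
      (cos_nonpos_of_pi_div_two_le_of_le h1 (by linarith))
    exact h0.map_add_map_le_of_mem_Icc (hmem (by linarith)) (hmem (by linarith)) (by linarith)
      (by linarith) (by ring)
  · have hcos : 0 ≤ cos t := by
      rw [← cos_two_pi_sub]
      exact cos_nonneg_of_neg_pi_div_two_le_of_le (by linarith) (by linarith)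
    refine mul_nonneg (sub_nonneg.2 ?_) hcos
    have := h0.map_add_map_le_of_mem_Icc (hmem (x := 2 * π - t) (by linarith)) (hmem ht1)
      (v := a + π / 2) (w := a + (2 * π - π / 2)) (by linarith) (by linarith) (by ring)
    simp only [hK]; linarith

end Oscillatory

end VolterraResolvent

namespace VolterraResolvent

/-! ### Transform estimates at frequency one -/

section UnitFrequency

open Real

/-- A nonnegative, nonincreasing, convex kernel whose backward differences are convex too. -/
structure IsConvexKernel (g : ℝ → ℝ) : Prop where
  nonneg : ∀ t, 0 < t → 0 ≤ g t
  antitone : AntitoneOn g (Ioi 0)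
  convex : ConvexOn ℝ (Ioi 0) g
  convex_sub : ∀ a, 0 < a → ConvexOn ℝ (Ioi 0) fun t => g t - g (t + a)

variable {f : ℝ → ℝ}

theorem norm_exp_neg_I_mul (t : ℝ) : ‖Complex.exp (-Complex.I * t)‖ = 1 := by
  rw [Complex.norm_exp]; simp

theorem integrableOn_mul_exp_neg_I {s : Set ℝ} (hf : IntegrableOn f s) :
    IntegrableOn (fun t => (f t : ℂ) * Complex.exp (-Complex.I * t)) s :=
  (Integrable.ofReal (𝕜 := ℂ) hf).mul_bdd (c := 1)
    (Continuous.aestronglyMeasurable (by fun_prop)) (ae_of_all _ fun t => (norm_exp_neg_I_mul t).le)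

theorem norm_setIntegral_mul_exp_neg_I_le {s : Set ℝ} :
    ‖∫ t in s, (f t : ℂ) * Complex.exp (-Complex.I * t)‖ ≤ ∫ t in s, |f t| := by
  refine (norm_integral_le_integral_norm _).trans_eq ?_
  simp only [norm_mul, norm_exp_neg_I_mul, mul_one, Complex.norm_real, norm_eq_abs]

theorem integrableOn_comp_add {T : ℝ} (hT : 0 ≤ T) (hf : IntegrableOn f (Ioi 0)) :
    IntegrableOn (fun t => f (t + T)) (Ioi 0) := by
  have h := (measurePreserving_add_right volume T).integrableOn_comp_preimage (f := f)
    (s := Ioi T) (measurableEmbedding_addRight T)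
  have e : (fun t => t + T) ⁻¹' Ioi T = Ioi 0 := by ext; simp
  rw [e] at h
  exact h.2 (hf.mono_set (Ioi_subset_Ioi hT))

theorem setIntegral_Ioi_zero_eq_add {E : Type*} [NormedAddCommGroup E] [NormedSpace ℝ E]
    {f : ℝ → E} (hf : IntegrableOn f (Ioi 0)) {T : ℝ} (hT : 0 ≤ T) :
    ∫ t in Ioi 0, f t = (∫ t in Ioc 0 T, f t) + ∫ t in Ioi T, f t := by
  rw [← Ioc_union_Ioi_eq_Ioi hT, setIntegral_union (Ioc_disjoint_Ioi le_rfl) measurableSet_Ioi]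
  · exact hf.mono_set fun x hx => hx.1
  · exact hf.mono_set fun x hx => lt_of_le_of_lt hT hx

theorem setIntegral_Ioi_comp_add {E : Type*} [NormedAddCommGroup E] [NormedSpace ℝ E]
    (f : ℝ → E) (T : ℝ) : ∫ t in Ioi 0, f (t + T) = ∫ t in Ioi T, f t := by
  have h := (measurePreserving_add_right volume T).setIntegral_preimage_emb
    (measurableEmbedding_addRight T) f (Ioi T)
  have e : (fun t => t + T) ⁻¹' Ioi T = Ioi 0 := by ext; simp
  rwa [e] at h

/-- Shifting by half a period. -/
theorem two_mul_laplaceTransform_I (hf : IntegrableOn f (Ioi 0)) :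
    2 * laplaceTransform f Complex.I = (∫ t in Ioc 0 π, (f t : ℂ) * Complex.exp (-Complex.I * t)) +
      laplaceTransform (fun t => f t - f (t + π)) Complex.I := by
  have h1 := integrableOn_mul_exp_neg_I hf
  have h2 := integrableOn_mul_exp_neg_I (integrableOn_comp_add pi_pos.le hf)
  have e1 : ∫ t in Ioi 0, (f (t + π) : ℂ) * Complex.exp (-Complex.I * t) =
      -∫ t in Ioi π, (f t : ℂ) * Complex.exp (-Complex.I * t) := by
    rw [← setIntegral_Ioi_comp_add (fun t => (f t : ℂ) * Complex.exp (-Complex.I * t)), ← integral_neg]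
    congr 1 with t
    have : Complex.exp (-Complex.I * ((t + π : ℝ) : ℂ)) = -Complex.exp (-Complex.I * t) := by
      rw [show -Complex.I * ((t + π : ℝ) : ℂ) = -Complex.I * t - π * Complex.I by push_cast; ring,
        Complex.exp_sub, Complex.exp_pi_mul_I, div_neg, div_one]
    rw [this]; ring
  have e2 : laplaceTransform (fun t => f t - f (t + π)) Complex.I =
      laplaceTransform f Complex.I + ∫ t in Ioi π, (f t : ℂ) * Complex.exp (-Complex.I * t) := by
    rw [laplaceTransform, laplaceTransform, ← neg_neg (∫ t in Ioi π, _), ← e1, ← sub_eq_add_neg,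
      ← integral_sub h1 h2]
    congr 1 with t
    push_cast; ring
  have e3 := setIntegral_Ioi_zero_eq_add h1 pi_pos.le
  rw [e2]
  rw [laplaceTransform] at *
  linear_combination e3

theorem norm_laplaceTransform_I_le : ‖laplaceTransform f Complex.I‖ ≤ ∫ t in Ioi 0, |f t| :=
  norm_setIntegral_mul_exp_neg_I_le

theorem setIntegral_sub_comp_add (hf : IntegrableOn f (Ioi 0)) {T : ℝ} (hT : 0 ≤ T) :
    ∫ t in Ioi 0, (f t - f (t + T)) = ∫ t in Ioc 0 T, f t := by
  rw [integral_sub hf (integrableOn_comp_add hT hf), setIntegral_Ioi_comp_add f T,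
    setIntegral_Ioi_zero_eq_add hf hT]
  ring

/-- After the half-period shift, both terms are at most `∫₀^π f`: the first trivially, the second
because the nonnegative difference `f - f(· + π)` has exactly this integral by telescoping. -/
theorem norm_laplaceTransform_I_le_of_antitone (h0 : ∀ t, 0 < t → 0 ≤ f t)
    (h1 : AntitoneOn f (Ioi 0)) (hf : IntegrableOn f (Ioi 0)) :
    ‖laplaceTransform f Complex.I‖ ≤ ∫ t in Ioc 0 π, f t := by
  have e := two_mul_laplaceTransform_I hf
  have b1 : ‖∫ t in Ioc 0 π, (f t : ℂ) * Complex.exp (-Complex.I * t)‖ ≤ ∫ t in Ioc 0 π, f t := by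
    refine norm_setIntegral_mul_exp_neg_I_le.trans_eq
      (setIntegral_congr_fun measurableSet_Ioc fun t ht => abs_of_nonneg (h0 t ht.1))
  have b2 : ‖laplaceTransform (fun t => f t - f (t + π)) Complex.I‖ ≤ ∫ t in Ioc 0 π, f t := by
    refine norm_laplaceTransform_I_le.trans_eq ?_
    rw [← setIntegral_sub_comp_add hf pi_pos.le]
    refine setIntegral_congr_fun measurableSet_Ioi fun t ht => abs_of_nonneg (sub_nonneg.2 ?_)
    have ht : 0 < t := ht
    exact h1 ht (by have := pi_pos; simp only [mem_Ioi]; linarith) (by linarith [pi_pos])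
  have := norm_add_le (∫ t in Ioc 0 π, (f t : ℂ) * Complex.exp (-Complex.I * t))
    (laplaceTransform (fun t => f t - f (t + π)) Complex.I)
  rw [← e, norm_mul] at this
  simp only [Complex.norm_ofNat] at this
  linarith

/-- Since `t f(t)` need not be monotone, its first difference has no sign and the half-period shift
is applied twice. The second difference is `t` times that of `f`, nonnegative by convexity, minus `2
π` times a shifted first difference of `f`; both integrals telescope. -/
theorem norm_laplaceTransform_id_mul_I_le (h0 : ∀ t, 0 < t → 0 ≤ f t)
    (h1 : AntitoneOn f (Ioi 0)) (h2 : ConvexOn ℝ (Ioi 0) f) (hf : IntegrableOn f (Ioi 0))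
    (hf1 : IntegrableOn (fun t => t * f t) (Ioi 0)) :
    ‖laplaceTransform (fun t => t * f t) Complex.I‖ ≤ ∫ t in Ioc 0 (2 * π), t * f t := by
  have hpi := pi_pos
  set g : ℝ → ℝ := fun t => t * f t with hg
  set h : ℝ → ℝ := fun t => f t - f (t + π) with hh
  set k : ℝ → ℝ := fun t => g t - g (t + π) with hk
  have hh0 : ∀ t, 0 < t → 0 ≤ h t := fun t ht => sub_nonneg.2
    (h1 ht (show 0 < t + π by linarith) (by linarith))
  have hh1 : ∀ t, 0 < t → 0 ≤ h t - h (t + π) := fun t ht => by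
    have := h2.map_add_map_le_of_mem_Icc (u := t) (x := t + π + π) (v := t + π) (w := t + π)
      ht (show 0 < t + π + π by linarith) (by linarith) (by linarith) (by ring)
    simp only [hh]; linarith
  have hhle : ∀ t, 0 < t → h t ≤ f t := fun t ht => by
    have := h0 (t + π) (by linarith)
    simp only [hh]; linarith
  have hgi := hf1
  have hgi' := integrableOn_comp_add hpi.le hf1
  have hki : IntegrableOn k (Ioi 0) := hgi.sub hgi'
  have hhi : IntegrableOn h (Ioi 0) := hf.sub (integrableOn_comp_add hpi.le hf)
  have hhi' := integrableOn_comp_add hpi.le hhi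
  have htT : IntegrableOn (fun t => t * f (t + π)) (Ioi 0) := by
    refine (hgi'.sub ((integrableOn_comp_add hpi.le hf).const_mul π)).congr
      (ae_of_all _ fun t => ?_)
    simp only [hg, Pi.sub_apply]; ring
  have hthi : IntegrableOn (fun t => t * h t) (Ioi 0) := by
    refine (hgi.sub htT).congr (ae_of_all _ fun t => ?_)
    simp only [hg, hh, Pi.sub_apply]; ring
  have hthi' := integrableOn_comp_add hpi.le hthi
  have hsub : Ioc 0 π ⊆ Ioi (0 : ℝ) := fun x hx => hx.1
  have e1 := two_mul_laplaceTransform_I hgi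
  have e2 := two_mul_laplaceTransform_I hki
  set P1 := ∫ t in Ioc 0 π, (g t : ℂ) * Complex.exp (-Complex.I * t)
  set P2 := ∫ t in Ioc 0 π, (k t : ℂ) * Complex.exp (-Complex.I * t)
  set L2 := laplaceTransform (fun t => k t - k (t + π)) Complex.I
  set G1 := ∫ t in Ioc 0 π, g t with hG1
  set G2 := ∫ t in Ioc π (2 * π), g t with hG2
  have hG : ∫ t in Ioc 0 (2 * π), g t = G1 + G2 := by
    rw [← Ioc_union_Ioc_eq_Ioc hpi.le (by linarith : π ≤ 2 * π),
      setIntegral_union (Ioc_disjoint_Ioc_of_le le_rfl) measurableSet_Ioc]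
    · exact hgi.mono_set hsub
    · exact hgi.mono_set fun x hx => lt_trans hpi hx.1
  have hG1' : ∫ t in Ioc 0 π, g (t + π) = G2 := by
    rw [hG2, ← intervalIntegral.integral_of_le hpi.le, intervalIntegral.integral_comp_add_right,
      zero_add, ← two_mul, intervalIntegral.integral_of_le (by linarith)]
  have b1 : ‖P1‖ ≤ G1 := norm_setIntegral_mul_exp_neg_I_le.trans_eq
    (setIntegral_congr_fun measurableSet_Ioc fun t ht =>
      abs_of_nonneg (mul_nonneg ht.1.le (h0 t ht.1)))
  have b2 : ‖P2‖ ≤ G1 + G2 := by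
    refine norm_setIntegral_mul_exp_neg_I_le.trans ?_
    rw [← hG1', hG1, ← integral_add (hgi.mono_set hsub) (hgi'.mono_set hsub)]
    refine setIntegral_mono_on (hki.mono_set hsub).abs
      ((hgi.mono_set hsub).add (hgi'.mono_set hsub)) measurableSet_Ioc fun t ht => ?_
    have p1 : 0 ≤ g t := mul_nonneg ht.1.le (h0 t ht.1)
    have p2 : 0 ≤ g (t + π) := mul_nonneg (by linarith [ht.1]) (h0 _ (by linarith [ht.1]))
    rw [abs_le]; constructor <;> simp only [hk] <;> linarith
  have c1 : ∫ t in Ioi 0, h (t + π) = ∫ t in Ioc π (2 * π), f t := by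
    have : ∀ t, h (t + π) = (fun t => f (t + π)) t - (fun t => f (t + π)) (t + π) := fun t => rfl
    simp_rw [this]
    rw [setIntegral_sub_comp_add (integrableOn_comp_add hpi.le hf) hpi.le,
      ← intervalIntegral.integral_of_le hpi.le, intervalIntegral.integral_comp_add_right,
      zero_add, ← two_mul, intervalIntegral.integral_of_le (by linarith)]
  have c2 : ∫ t in Ioi 0, t * (h t - h (t + π)) = (∫ t in Ioc 0 π, t * h t) +
      π * ∫ t in Ioc π (2 * π), f t := by
    have key : ∫ t in Ioi 0, (t * h t - (t + π) * h (t + π) + π * h (t + π)) = _ :=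
      integral_add (hthi.sub hthi') (hhi'.const_mul π)
    rw [← setIntegral_sub_comp_add hthi hpi.le, ← c1, ← MeasureTheory.integral_const_mul, ← key]
    congr 1 with t; ring
  have c3 : ∫ t in Ioc 0 π, t * h t ≤ G1 := by
    refine setIntegral_mono_on (hthi.mono_set hsub) (hgi.mono_set hsub) measurableSet_Ioc
      fun t ht => ?_
    exact mul_le_mul_of_nonneg_left (hhle t ht.1) ht.1.le
  have c4 : π * ∫ t in Ioc π (2 * π), f t ≤ G2 := by
    rw [← MeasureTheory.integral_const_mul]
    have hs : Ioc π (2 * π) ⊆ Ioi (0 : ℝ) := fun x hx => lt_trans hpi hx.1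
    refine setIntegral_mono_on ((hf.mono_set hs).const_mul π) (hgi.mono_set hs) measurableSet_Ioc
      fun t ht => ?_
    exact mul_le_mul_of_nonneg_right ht.1.le (h0 t (hs ht))
  have hwi : IntegrableOn (fun t => t * (h t - h (t + π))) (Ioi 0) := by
    refine ((hthi.sub hthi').add (hhi'.const_mul π)).congr (ae_of_all _ fun t => ?_)
    simp only [Pi.add_apply, Pi.sub_apply]; ring
  -- With this, `2 ‖k̂‖ ≤ (G1 + G2) + (G1 + 3 G2)` and `2 ‖ĝ‖ ≤ G1 + ‖k̂‖`, hence `‖ĝ‖ ≤ G1 + G2`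
  -- with no loss.
  have b3 : ‖L2‖ ≤ G1 + 3 * G2 := by
    refine norm_laplaceTransform_I_le.trans ?_
    have : ∫ t in Ioi 0, |k t - k (t + π)| ≤
        ∫ t in Ioi 0, (t * (h t - h (t + π)) + 2 * π * h (t + π)) := by
      refine setIntegral_mono_on (hki.sub (integrableOn_comp_add hpi.le hki)).abs
        (hwi.add (hhi'.const_mul (2 * π))) measurableSet_Ioi fun t ht => ?_
      have ht : 0 < t := ht
      have q1 := mul_nonneg ht.le (hh1 t ht)
      have q2 : 0 ≤ 2 * π * h (t + π) := mul_nonneg (by positivity) (hh0 _ (by linarith))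
      have : k t - k (t + π) = t * (h t - h (t + π)) - 2 * π * h (t + π) := by
        simp only [hk, hg, hh]; ring
      rw [this, abs_le]; constructor <;> linarith
    refine this.trans ?_
    rw [integral_add hwi (hhi'.const_mul (2 * π)), MeasureTheory.integral_const_mul, c1, c2]
    linarith
  rw [hG]
  have n1 := norm_add_le P1 (laplaceTransform k Complex.I)
  have n2 := norm_add_le P2 L2
  rw [← e1, norm_mul] at n1
  rw [← e2, norm_mul] at n2
  simp only [Complex.norm_ofNat] at n1 n2
  linarith

theorem laplaceTransform_I_re (hf : IntegrableOn f (Ioi 0)) :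
    (laplaceTransform f Complex.I).re = ∫ t in Ioi 0, f t * cos t := by
  have := integral_re (𝕜 := ℂ) (integrableOn_mul_exp_neg_I hf)
  rw [laplaceTransform, ← RCLike.re_eq_complex_re, ← this]
  congr 1 with t
  simp [Complex.exp_re, Complex.exp_im]

theorem laplaceTransform_I_im (hf : IntegrableOn f (Ioi 0)) :
    (laplaceTransform f Complex.I).im = -∫ t in Ioi 0, f t * sin t := by
  have := integral_im (𝕜 := ℂ) (integrableOn_mul_exp_neg_I hf)
  rw [laplaceTransform, ← RCLike.im_eq_complex_im, ← this, ← integral_neg]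
  congr 1 with t
  simp [Complex.exp_re, Complex.exp_im]

/-- Real part minus imaginary part of the half-period identity. The difference `f - f(· + π)` is
antitone and convex, so its cosine and sine integrals are nonnegative and can be dropped. What
remains is `∫₀^π f (cos + sin)`, where `cos + sin ≥ 1` on the first half. -/
theorem setIntegral_Ioc_le_norm_laplaceTransform_I (hf : IsConvexKernel f)
    (hi : IntegrableOn f (Ioi 0)) :
    ∫ t in Ioc 0 (π / 2), f t ≤ 4 * ‖laplaceTransform f Complex.I‖ := by
  have hpi := pi_pos
  set h : ℝ → ℝ := fun t => f t - f (t + π) with hh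
  have hhi : IntegrableOn h (Ioi 0) := hi.sub (integrableOn_comp_add hpi.le hi)
  have hanti : AntitoneOn h (Ioi 0) := by
    intro u hu v hv huv
    have hu' : 0 < u := hu
    have := hf.convex.map_add_map_le_of_mem_Icc (u := u) (x := v + π) (v := v) (w := u + π)
      hu (show 0 < v + π by linarith) huv (by linarith) (by ring)
    simp only [hh]; linarith
  have e := two_mul_laplaceTransform_I hi
  have hP := integrableOn_mul_exp_neg_I (hi.mono_set (fun x hx => hx.1 : Ioc 0 π ⊆ Ioi (0 : ℝ)))
  have s1 := setIntegral_mul_cos_nonneg (hf.convex_sub π hpi) hhi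
  have s2 := setIntegral_mul_sin_nonneg hanti hhi
  rw [← laplaceTransform_I_re hhi] at s1
  have s2' := laplaceTransform_I_im hhi
  have p1 : (∫ t in Ioc 0 π, (f t : ℂ) * Complex.exp (-Complex.I * t)).re =
      ∫ t in Ioc 0 π, f t * cos t := by
    have := integral_re (𝕜 := ℂ) hP
    rw [← RCLike.re_eq_complex_re, ← this]
    congr 1 with t
    simp [Complex.exp_re, Complex.exp_im]
  have p2 : (∫ t in Ioc 0 π, (f t : ℂ) * Complex.exp (-Complex.I * t)).im =
      -∫ t in Ioc 0 π, f t * sin t := by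
    have := integral_im (𝕜 := ℂ) hP
    rw [← RCLike.im_eq_complex_im, ← this, ← integral_neg]
    congr 1 with t
    simp [Complex.exp_re, Complex.exp_im]
  have hre := congrArg Complex.re e
  have him := congrArg Complex.im e
  simp only [Complex.mul_re, Complex.mul_im, Complex.add_re, Complex.add_im, p1, p2,
    Complex.re_ofNat, Complex.im_ofNat, zero_mul, sub_zero, add_zero] at hre him
  have r1 := (Complex.re_le_norm (laplaceTransform f Complex.I))
  have r2 := (neg_le_abs _).trans (Complex.abs_im_le_norm (laplaceTransform f Complex.I))
  have hc := integrableOn_mul_of_abs_le_one hi continuous_cos abs_cos_le_one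
  have hs := integrableOn_mul_of_abs_le_one hi continuous_sin abs_sin_le_one
  have hcs : IntegrableOn (fun t => f t * (cos t + sin t)) (Ioi 0) := by
    refine (hc.add hs).congr (ae_of_all _ fun t => ?_)
    simp only [Pi.add_apply]; ring
  have hsub1 : Ioc 0 (π / 2) ⊆ Ioi (0 : ℝ) := fun x hx => hx.1
  have hsub2 : Ioc (π / 2) π ⊆ Ioi (0 : ℝ) := fun x hx => lt_trans (by positivity) hx.1
  have hsplit : (∫ t in Ioc 0 π, f t * cos t) + ∫ t in Ioc 0 π, f t * sin t =
      (∫ t in Ioc 0 (π / 2), f t * (cos t + sin t)) +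
        ∫ t in Ioc (π / 2) π, f t * (cos t + sin t) := by
    rw [← integral_add (hc.mono_set fun x hx => hx.1) (hs.mono_set fun x hx => hx.1),
      ← setIntegral_union (Ioc_disjoint_Ioc_of_le le_rfl) measurableSet_Ioc
        (hcs.mono_set hsub1) (hcs.mono_set hsub2),
      Ioc_union_Ioc_eq_Ioc (by positivity) (by linarith)]
    congr 1 with t; ring
  have k1 : ∫ t in Ioc 0 (π / 2), f t ≤ ∫ t in Ioc 0 (π / 2), f t * (cos t + sin t) := by
    refine setIntegral_mono_on (hi.mono_set hsub1) (hcs.mono_set hsub1) measurableSet_Ioc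
      fun t ht => ?_
    · have c0 : 0 ≤ cos t := cos_nonneg_of_neg_pi_div_two_le_of_le (by linarith [ht.1]) ht.2
      have c1 : 0 ≤ sin t := sin_nonneg_of_nonneg_of_le_pi ht.1.le (by linarith [ht.2])
      have := hf.nonneg t ht.1
      nlinarith [sin_sq_add_cos_sq t, mul_nonneg c0 c1]
  -- On this interval `cos + sin` has mean zero and changes sign once, at `3π/4`, so monotonicity of
  -- `f` decides the sign.
  have k2 : 0 ≤ ∫ t in Ioc (π / 2) π, f t * (cos t + sin t) := by
    have hz : ∫ t in Ioc (π / 2) π, f (3 * π / 4) * (cos t + sin t) = 0 := by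
      rw [← intervalIntegral.integral_of_le (by linarith), intervalIntegral.integral_const_mul,
        intervalIntegral.integral_add (continuous_cos.intervalIntegrable _ _)
          (continuous_sin.intervalIntegrable _ _), integral_cos, integral_sin]
      simp
    replace hcs := hcs.mono_set hsub2
    have hconst : IntegrableOn (fun t => f (3 * π / 4) * (cos t + sin t)) (Ioc (π / 2) π) :=
      (Continuous.integrableOn_Icc (by fun_prop)).mono_set Ioc_subset_Icc_self
    have key := integral_sub hcs hconst
    rw [hz, sub_zero] at key
    rw [← key]
    refine setIntegral_nonneg measurableSet_Ioc fun t ht => ?_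
    have ht0 : t ∈ Ioi (0 : ℝ) := hsub2 ht
    have hm : 3 * π / 4 ∈ Ioi (0 : ℝ) := by simp only [mem_Ioi]; positivity
    have hsum : cos t + sin t = √2 * cos (t - π / 4) := by
      rw [cos_sub, cos_pi_div_four, sin_pi_div_four]
      have := Real.mul_self_sqrt (show (0 : ℝ) ≤ 2 by norm_num)
      linear_combination -(cos t + sin t) / 2 * this
    rw [← sub_mul, hsum]
    rcases le_total t (3 * π / 4) with hle | hle
    · exact mul_nonneg (sub_nonneg.2 (hf.antitone ht0 hm hle)) (mul_nonneg (sqrt_nonneg _)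
        (cos_nonneg_of_neg_pi_div_two_le_of_le (by linarith [ht.1]) (by linarith)))
    · exact mul_nonneg_of_nonpos_of_nonpos (sub_nonpos.2 (hf.antitone hm ht0 hle))
        (mul_nonpos_of_nonneg_of_nonpos (sqrt_nonneg _)
        (cos_nonpos_of_pi_div_two_le_of_le (by linarith) (by linarith [ht.2])))
  linarith

end UnitFrequency

end VolterraResolvent

namespace VolterraResolvent

/-! ### Exponential weights and transfer to all frequencies -/

section Weights

open Real

variable {b : ℝ → ℝ} {σ : ℝ}

/-- The kernel `b(t) e^{-σ t}`. -/
noncomputable def expWeight (b : ℝ → ℝ) (σ t : ℝ) : ℝ := b t * exp (-σ * t)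

/-- `∫₀ʳ g`. -/
noncomputable def mass (g : ℝ → ℝ) (r : ℝ) : ℝ := ∫ t in Ioc 0 r, g t

/-- `∫₀ʳ t g(t) dt`. -/
noncomputable def moment (g : ℝ → ℝ) (r : ℝ) : ℝ := ∫ t in Ioc 0 r, t * g t

/-- The only new property is convexity of `b - b(· + a)`. Its derivative is an increment of `b'`,
monotone because `-b'` is convex. -/
theorem IsAdmissibleKernel.isConvexKernel (hb : IsAdmissibleKernel b) : IsConvexKernel b where
  nonneg := hb.nonneg
  antitone := hb.antitone
  convex := hb.convex
  convex_sub a ha := by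
    have hd : ∀ t ∈ Ioi (0 : ℝ), HasDerivAt b (deriv b t) t := fun t ht =>
      ((hb.differentiable t ht).differentiableAt (Ioi_mem_nhds ht)).hasDerivAt
    have hd' : ∀ t ∈ Ioi (0 : ℝ), HasDerivAt (fun t => b t - b (t + a))
        (deriv b t - deriv b (t + a)) t := fun t ht => by
      have ht' : t + a ∈ Ioi (0 : ℝ) := by have : 0 < t := ht; simp only [mem_Ioi]; linarith
      exact (hd t ht).sub ((hd _ ht').comp_add_const t a)
    refine MonotoneOn.convexOn_of_deriv (convex_Ioi 0)
      (fun t ht => (hd' t ht).continuousAt.continuousWithinAt)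
      (fun t ht => ?_) fun u hu v hv huv => ?_
    · rw [interior_Ioi] at ht
      exact (hd' t ht).differentiableAt.differentiableWithinAt
    · rw [interior_Ioi] at hu hv
      rw [(hd' u hu).deriv, (hd' v hv).deriv]
      have hu' : 0 < u := hu
      have := hb.neg_deriv_convex.map_add_map_le_of_mem_Icc (u := u) (x := v + a) (v := v)
        (w := u + a) hu (show 0 < v + a by linarith [show 0 < v from hv]) huv (by linarith)
        (by ring)
      linarith

theorem convexOn_exp_neg (σ : ℝ) : ConvexOn ℝ (Ioi 0) fun t => exp (-σ * t) := by
  have := (convexOn_exp.comp_linearMap (LinearMap.lsmul ℝ ℝ (-σ))).subset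
    (subset_univ (Ioi (0 : ℝ))) (convex_Ioi 0)
  exact this

theorem antitoneOn_exp_neg (hσ : 0 ≤ σ) : AntitoneOn (fun t => exp (-σ * t)) (Ioi 0) :=
  fun _ _ _ _ huv => exp_le_exp.2 (by nlinarith)

theorem AntitoneOn.expWeight (h0 : ∀ t, 0 < t → 0 ≤ b t) (h : AntitoneOn b (Ioi 0))
    (hσ : 0 ≤ σ) : AntitoneOn (expWeight b σ) (Ioi 0) := fun u hu _ hv huv =>
  mul_le_mul (h hu hv huv) (antitoneOn_exp_neg hσ hu hv huv) (exp_pos _).le (h0 u hu)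

theorem ConvexOn.expWeight (h0 : ∀ t, 0 < t → 0 ≤ b t) (h : AntitoneOn b (Ioi 0))
    (hc : ConvexOn ℝ (Ioi 0) b) (hσ : 0 ≤ σ) : ConvexOn ℝ (Ioi 0) (expWeight b σ) :=
  hc.mul (convexOn_exp_neg σ) (fun t ht => h0 t ht) (fun _ _ => (exp_pos _).le)
    (h.monovaryOn (antitoneOn_exp_neg hσ))

theorem IsConvexKernel.antitone_sub (hb : IsConvexKernel b) {a : ℝ} (ha : 0 < a) :
    AntitoneOn (fun t => b t - b (t + a)) (Ioi 0) := fun u hu v hv huv => by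
  have := hb.convex.map_add_map_le_of_mem_Icc (u := u) (x := v + a) (v := v) (w := u + a)
    hu (show 0 < v + a by linarith [show 0 < v from hv]) huv (by linarith) (by ring)
  simp only; linarith

theorem IsConvexKernel.sub_nonneg (hb : IsConvexKernel b) {a t : ℝ} (ha : 0 < a) (ht : 0 < t) :
    0 ≤ b t - b (t + a) :=
  _root_.sub_nonneg.2 (hb.antitone ht (show 0 < t + a by linarith) (by linarith))

/-- The difference of the weighted kernel is `(b(t) - b(t + a)) e^{-σt} + (1 - e^{-σa}) b(t + a)
e^{-σt}`. Each summand is a nonnegative multiple of a product of nonnegative, decreasing, convex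
functions, and such products are convex. -/
theorem IsConvexKernel.expWeight (hb : IsConvexKernel b) (hσ : 0 ≤ σ) :
    IsConvexKernel (expWeight b σ) where
  nonneg t ht := mul_nonneg (hb.nonneg t ht) (exp_pos _).le
  antitone := AntitoneOn.expWeight hb.nonneg hb.antitone hσ
  convex := ConvexOn.expWeight hb.nonneg hb.antitone hb.convex hσ
  convex_sub a ha := by
    have h1 := ConvexOn.expWeight (fun t ht => hb.sub_nonneg ha ht) (hb.antitone_sub ha)
      (hb.convex_sub a ha) hσ
    have hpos : ∀ t, 0 < t → 0 < t + a := fun t ht => by linarith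
    have hanti : AntitoneOn (fun t => b (t + a)) (Ioi 0) := fun u hu v hv huv =>
      hb.antitone (hpos u hu) (hpos v hv) (by linarith)
    have hconv : ConvexOn ℝ (Ioi 0) fun t => b (t + a) := by
      refine ⟨convex_Ioi 0, fun u hu v hv p q hp hq hpq => ?_⟩
      have := hb.convex.2 (hpos u hu) (hpos v hv) hp hq hpq
      convert this using 2
      simp only [smul_eq_mul]; linear_combination -a * hpq
    have h2 := ConvexOn.expWeight (fun t ht => hb.nonneg _ (hpos t ht)) hanti hconv hσ
    have h3 := h1.add (h2.smul (c := 1 - exp (-σ * a))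
      (_root_.sub_nonneg.2 (exp_le_one_iff.2 (by nlinarith))))
    refine h3.congr fun t _ => ?_
    simp only [VolterraResolvent.expWeight, Pi.add_apply, smul_eq_mul]
    rw [show -σ * (t + a) = -σ * t + -σ * a by ring, exp_add]
    ring

theorem IsConvexKernel.comp_mul_right (hb : IsConvexKernel b) {c : ℝ} (hc : 0 < c) :
    IsConvexKernel fun t => b (t * c) := by
  have hpos : ∀ t, 0 < t → 0 < t * c := fun t ht => mul_pos ht hc
  have key : ∀ f : ℝ → ℝ, ConvexOn ℝ (Ioi 0) f → ConvexOn ℝ (Ioi 0) fun t => f (t * c) :=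
    fun f hf => by
      refine ⟨convex_Ioi 0, fun u hu v hv p q hp hq hpq => ?_⟩
      have := hf.2 (hpos u hu) (hpos v hv) hp hq hpq
      convert this using 2
      simp only [smul_eq_mul]; ring
  refine ⟨fun t ht => hb.nonneg _ (hpos t ht), fun u hu v hv huv =>
    hb.antitone (hpos u hu) (hpos v hv) (by nlinarith), key _ hb.convex, fun a ha => ?_⟩
  simpa only [add_mul] using key _ (hb.convex_sub (a * c) (by positivity))

theorem integrableOn_pow_mul_exp_neg (n : ℕ) (hσ : 0 < σ) :
    IntegrableOn (fun t : ℝ => t ^ n * exp (-σ * t)) (Ioi 0) := by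
  have := integrableOn_rpow_mul_exp_neg_mul_rpow (p := 1) (s := n) (b := σ)
    (by have : (0 : ℝ) ≤ n := by positivity
        linarith) one_pos hσ
  refine this.congr_fun (fun t _ => ?_) measurableSet_Ioi
  simp

theorem integrableOn_Ioc_of_locallyIntegrableOn (hl : LocallyIntegrableOn b (Ici 0)) (r : ℝ) :
    IntegrableOn b (Ioc 0 r) :=
  (hl.integrableOn_compact_subset (fun _ hx => hx.1) (isCompact_Icc (a := 0) (b := r))).mono_set
    Ioc_subset_Icc_self

theorem integrableOn_pow_mul_expWeight (hb : IsConvexKernel b)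
    (hl : LocallyIntegrableOn b (Ici 0)) (hσ : 0 < σ) (n : ℕ) :
    IntegrableOn (fun t => t ^ n * expWeight b σ t) (Ioi 0) := by
  rw [← Ioc_union_Ioi_eq_Ioi (zero_le_one (α := ℝ)), integrableOn_union]
  have hm : AEStronglyMeasurable b (volume.restrict (Ioi 0)) :=
    (hl.aestronglyMeasurable).mono_set Ioi_subset_Ici_self
  constructor
  · have h1 := integrableOn_Ioc_of_locallyIntegrableOn hl 1
    have : IntegrableOn (fun t => b t * (t ^ n * exp (-σ * t))) (Ioc 0 1) := by
      refine h1.mul_bdd (c := 1) (Continuous.aestronglyMeasurable (by fun_prop)) ?_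
      refine (ae_restrict_iff' measurableSet_Ioc).2 (ae_of_all _ fun t ht => ?_)
      rw [norm_mul, norm_pow, norm_of_nonneg ht.1.le, norm_of_nonneg (exp_pos _).le]
      exact mul_le_one₀ (pow_le_one₀ ht.1.le ht.2) (exp_pos _).le
        (exp_le_one_iff.2 (by nlinarith [ht.1]))
    refine this.congr (ae_of_all _ fun t => ?_)
    simp only [expWeight]; ring
  · have hsub : Ioi (1 : ℝ) ⊆ Ioi 0 := Ioi_subset_Ioi zero_le_one
    have h1 := ((integrableOn_pow_mul_exp_neg n hσ).mono_set hsub).const_mul (b 1)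
    refine h1.mono' ?_ ?_
    · have hm' := hm.mono_set hsub
      exact (Continuous.aestronglyMeasurable (by fun_prop)).mul
        (hm'.mul (Continuous.aestronglyMeasurable (by fun_prop)))
    · refine (ae_restrict_iff' measurableSet_Ioi).2 (ae_of_all _ fun t ht => ?_)
      have ht0 : 0 < t := hsub ht
      have := hb.antitone (mem_Ioi.2 (one_pos (α := ℝ))) ht0 ht.le
      have hbt := hb.nonneg t ht0
      rw [expWeight, norm_of_nonneg (by positivity)]
      have h2 : 0 ≤ t ^ n * exp (-σ * t) := by positivity
      nlinarith

theorem integrableOn_expWeight (hb : IsConvexKernel b)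
    (hl : LocallyIntegrableOn b (Ici 0)) (hσ : 0 < σ) : IntegrableOn (expWeight b σ) (Ioi 0) := by
  simpa using integrableOn_pow_mul_expWeight hb hl hσ 0

theorem integrableOn_mul_expWeight (hb : IsConvexKernel b)
    (hl : LocallyIntegrableOn b (Ici 0)) (hσ : 0 < σ) :
    IntegrableOn (fun t => t * expWeight b σ t) (Ioi 0) := by
  simpa using integrableOn_pow_mul_expWeight hb hl hσ 1

/-- The change of variables `t ↦ t / ω` moves the real part of the argument into the kernel and
normalises the frequency to one. -/
theorem laplaceTransform_eq_inv_mul (f : ℝ → ℝ) (σ : ℝ) {ω : ℝ} (hω : 0 < ω) :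
    laplaceTransform f (σ + ω * Complex.I) =
      ω⁻¹ * laplaceTransform (fun t => expWeight f σ (t * ω⁻¹)) Complex.I := by
  have := integral_comp_mul_right_Ioi
    (fun t => (f t : ℂ) * Complex.exp (-(σ + ω * Complex.I) * t)) 0 (inv_pos.2 hω)
  rw [zero_mul, inv_inv, Complex.real_smul] at this
  rw [laplaceTransform, laplaceTransform]
  rw [Complex.ofReal_inv, eq_inv_mul_iff_mul_eq₀ (by exact_mod_cast hω.ne'), ← this]
  congr 1 with t
  simp only [expWeight]
  push_cast
  rw [mul_assoc, ← Complex.exp_add]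
  congr 2
  have : (ω : ℂ) ≠ 0 := by exact_mod_cast hω.ne'
  field_simp
  ring

theorem laplaceTransform_conj (f : ℝ → ℝ) (z : ℂ) :
    laplaceTransform f (starRingEnd ℂ z) = starRingEnd ℂ (laplaceTransform f z) := by
  rw [laplaceTransform, laplaceTransform, ← integral_conj]
  congr 1 with t
  rw [map_mul, ← Complex.exp_conj]
  simp

theorem setIntegral_Ioc_comp_mul (f : ℝ → ℝ) {c r : ℝ} (hc : 0 < c) (hr : 0 ≤ r) :
    ∫ t in Ioc 0 r, f (t * c) = c⁻¹ * ∫ t in Ioc 0 (r * c), f t := by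
  rw [← intervalIntegral.integral_of_le hr, ← intervalIntegral.integral_of_le (by positivity),
    intervalIntegral.integral_comp_mul_right _ hc.ne']
  simp

variable {g : ℝ → ℝ}

theorem integrableOn_Ioc_comp_mul {f : ℝ → ℝ} {c : ℝ} (hc : 0 < c) (hf : IntegrableOn f (Ioi 0))
    (r : ℝ) : IntegrableOn (fun t => f (t * c)) (Ioc 0 r) := by
  have := (integrableOn_Ioi_comp_mul_right_iff f 0 hc).2 (by simpa using hf)
  exact this.mono_set fun x hx => hx.1

theorem mass_mul_le (h1 : AntitoneOn g (Ioi 0)) (hi : IntegrableOn g (Ioi 0)) {c r : ℝ}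
    (hc : 1 ≤ c) (hr : 0 ≤ r) : mass g (r * c) ≤ c * mass g r := by
  have hc0 : 0 < c := by linarith
  have := setIntegral_Ioc_comp_mul g hc0 hr
  rw [eq_inv_mul_iff_mul_eq₀ hc0.ne'] at this
  rw [mass, mass, ← this]
  refine mul_le_mul_of_nonneg_left (setIntegral_mono_on (integrableOn_Ioc_comp_mul hc0 hi r)
    (hi.mono_set fun x hx => hx.1) measurableSet_Ioc fun t ht => ?_) hc0.le
  exact h1 ht.1 (mul_pos ht.1 hc0) (by nlinarith [ht.1])

theorem moment_mul_le (h1 : AntitoneOn g (Ioi 0)) (hi : IntegrableOn (fun t => t * g t) (Ioi 0))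
    {c r : ℝ} (hc : 1 ≤ c) (hr : 0 ≤ r) : moment g (r * c) ≤ c ^ 2 * moment g r := by
  have hc0 : 0 < c := by linarith
  have := setIntegral_Ioc_comp_mul (fun t => t * g t) hc0 hr
  rw [eq_inv_mul_iff_mul_eq₀ hc0.ne'] at this
  have e : c * ∫ t in Ioc 0 r, t * g t = ∫ t in Ioc 0 r, c * (t * g t) :=
    (integral_const_mul _ _).symm
  rw [moment, moment, ← this, pow_two, mul_assoc, e]
  refine mul_le_mul_of_nonneg_left (setIntegral_mono_on (integrableOn_Ioc_comp_mul hc0 hi r)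
    ((hi.mono_set fun x hx => hx.1).const_mul c) measurableSet_Ioc fun t ht => ?_) hc0.le
  have := h1 ht.1 (mul_pos ht.1 hc0) (by nlinarith [ht.1])
  nlinarith [mul_le_mul_of_nonneg_left this (mul_pos ht.1 hc0).le]

theorem mass_mono (h0 : ∀ t, 0 < t → 0 ≤ g t) (hi : IntegrableOn g (Ioi 0)) {r r' : ℝ}
    (h : r ≤ r') : mass g r ≤ mass g r' :=
  setIntegral_mono_set (hi.mono_set fun _ hx => hx.1)
    ((ae_restrict_iff' measurableSet_Ioc).2 (ae_of_all _ fun t ht => h0 t ht.1))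
    (Ioc_subset_Ioc_right h).eventuallyLE

theorem mass_nonneg (h0 : ∀ t, 0 < t → 0 ≤ g t) (r : ℝ) : 0 ≤ mass g r :=
  setIntegral_nonneg measurableSet_Ioc fun t ht => h0 t ht.1

theorem moment_nonneg (h0 : ∀ t, 0 < t → 0 ≤ g t) (r : ℝ) : 0 ≤ moment g r :=
  setIntegral_nonneg measurableSet_Ioc fun t ht => mul_nonneg ht.1.le (h0 t ht.1)

theorem moment_le_mul_mass (h0 : ∀ t, 0 < t → 0 ≤ g t) (hi : IntegrableOn g (Ioi 0))
    (hi1 : IntegrableOn (fun t => t * g t) (Ioi 0)) (r : ℝ) : moment g r ≤ r * mass g r := by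
  rw [moment, mass, ← integral_const_mul]
  refine setIntegral_mono_on (hi1.mono_set fun _ hx => hx.1)
    ((hi.mono_set fun _ hx => hx.1).const_mul r) measurableSet_Ioc fun t ht => ?_
  exact mul_le_mul_of_nonneg_right ht.2 (h0 t ht.1)

/-- The function `(1 - σ t) e^{-σt}` is the derivative of `t e^{-σt}`, so its integral over `(0, r)`
is nonnegative. It changes sign at `σ⁻¹`; replacing `b σ⁻¹` by the decreasing `b` only increases the
integral. -/
theorem mul_moment_expWeight_le (hb : IsConvexKernel b) (hl : LocallyIntegrableOn b (Ici 0))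
    (hσ : 0 < σ) {r : ℝ} (hr : 0 ≤ r) :
    σ * moment (expWeight b σ) r ≤ mass (expWeight b σ) r := by
  have hi := (integrableOn_expWeight hb hl hσ).mono_set (fun _ hx => hx.1 : Ioc 0 r ⊆ Ioi 0)
  have hi1 := (integrableOn_mul_expWeight hb hl hσ).mono_set (fun _ hx => hx.1 : Ioc 0 r ⊆ Ioi 0)
  rw [moment, mass, ← integral_const_mul, ← _root_.sub_nonneg, ← integral_sub hi (hi1.const_mul σ)]
  have hprim : ∫ t in Ioc 0 r, b σ⁻¹ * ((1 - σ * t) * exp (-σ * t)) =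
      b σ⁻¹ * (r * exp (-σ * r)) := by
    rw [integral_const_mul, ← intervalIntegral.integral_of_le hr,
      intervalIntegral.integral_eq_sub_of_hasDerivAt (f := fun t => t * exp (-σ * t))
        (fun t _ => ?_) (Continuous.intervalIntegrable (by fun_prop) _ _)]
    · simp
    · have h1 : HasDerivAt (fun t : ℝ => exp (-σ * t)) (exp (-σ * t) * (-σ)) t := by
        simpa using ((hasDerivAt_id t).const_mul (-σ)).exp
      exact ((hasDerivAt_id' t).mul h1).congr_deriv (by ring)
  have hbσ : 0 ≤ b σ⁻¹ := hb.nonneg _ (by positivity)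
  refine le_trans (b := b σ⁻¹ * (r * exp (-σ * r))) (by positivity) ?_
  rw [← hprim]
  refine setIntegral_mono_on ((Continuous.integrableOn_Icc (by fun_prop)).mono_set
    Ioc_subset_Icc_self) (hi.sub (hi1.const_mul σ)) measurableSet_Ioc fun t ht => ?_
  have e : expWeight b σ t - σ * (t * expWeight b σ t) = b t * (1 - σ * t) * exp (-σ * t) := by
    simp only [expWeight]; ring
  rw [e, ← mul_assoc]
  refine mul_le_mul_of_nonneg_right ?_ (exp_pos _).le
  have hs : σ⁻¹ ∈ Ioi (0 : ℝ) := inv_pos.2 hσ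
  have hσσ : σ * σ⁻¹ = 1 := mul_inv_cancel₀ hσ.ne'
  rcases le_total t σ⁻¹ with h | h
  · exact mul_le_mul_of_nonneg_right (hb.antitone ht.1 hs h) (by nlinarith)
  · exact mul_le_mul_of_nonpos_right (hb.antitone hs ht.1 h) (by nlinarith)

theorem norm_laplaceTransform_abs_im (f : ℝ → ℝ) (z : ℂ) :
    ‖laplaceTransform f z‖ = ‖laplaceTransform f (z.re + |z.im| * Complex.I)‖ := by
  rcases abs_choice z.im with h | h
  · rw [h, Complex.re_add_im]
  · rw [h, ← Complex.norm_conj, ← laplaceTransform_conj]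
    congr 2
    apply Complex.ext <;> simp

theorem integrableOn_scaled {σ ω : ℝ} (hb : IsConvexKernel b) (hl : LocallyIntegrableOn b (Ici 0))
    (hσ : 0 < σ) (hω : 0 < ω) : IntegrableOn (fun t => expWeight b σ (t * ω⁻¹)) (Ioi 0) :=
  (integrableOn_Ioi_comp_mul_right_iff _ 0 (inv_pos.2 hω)).2
    (by simpa using integrableOn_expWeight hb hl hσ)

/-- With the next two theorems, this transfers the unit-frequency estimates to the whole right
half-plane off the real axis, where conjugation allows `Im z > 0`. -/
theorem mass_le_four_mul_norm_laplaceTransform (hb : IsConvexKernel b)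
    (hl : LocallyIntegrableOn b (Ici 0)) {z : ℂ} (hz : 0 < z.re) (hz' : z.im ≠ 0) :
    mass (expWeight b z.re) |z.im|⁻¹ ≤ 4 * ‖laplaceTransform b z‖ := by
  rw [norm_laplaceTransform_abs_im]
  set σ := z.re
  set ω := |z.im|
  have hω : 0 < ω := abs_pos.2 hz'
  have hk := (hb.expWeight hz.le).comp_mul_right (inv_pos.2 hω)
  have hi := integrableOn_scaled hb hl hz hω
  rw [laplaceTransform_eq_inv_mul b σ hω, norm_mul]
  have h1 := setIntegral_Ioc_le_norm_laplaceTransform_I hk hi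
  have h2 : mass (fun t => expWeight b σ (t * ω⁻¹)) 1 ≤
      ∫ t in Ioc 0 (π / 2), expWeight b σ (t * ω⁻¹) :=
    mass_mono hk.nonneg hi (by linarith [pi_gt_three])
  rw [mass, setIntegral_Ioc_comp_mul _ (inv_pos.2 hω) zero_le_one, one_mul, inv_inv] at h2
  have h3 : ‖((ω⁻¹ : ℝ) : ℂ)‖ = ω⁻¹ := by
    rw [Complex.norm_real, norm_of_nonneg (inv_pos.2 hω).le]
  rw [h3, mass, mul_left_comm, ← div_eq_inv_mul, le_div_iff₀ hω]
  linarith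

theorem norm_laplaceTransform_le (hb : IsConvexKernel b)
    (hl : LocallyIntegrableOn b (Ici 0)) {z : ℂ} (hz : 0 < z.re) (hz' : z.im ≠ 0) :
    ‖laplaceTransform b z‖ ≤ 4 * mass (expWeight b z.re) |z.im|⁻¹ := by
  rw [norm_laplaceTransform_abs_im]
  set σ := z.re
  set ω := |z.im|
  have hω : 0 < ω := abs_pos.2 hz'
  have hk := (hb.expWeight hz.le).comp_mul_right (inv_pos.2 hω)
  have hi := integrableOn_scaled hb hl hz hω
  rw [laplaceTransform_eq_inv_mul b σ hω, norm_mul]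
  have h1 := norm_laplaceTransform_I_le_of_antitone hk.nonneg hk.antitone hi
  rw [setIntegral_Ioc_comp_mul _ (inv_pos.2 hω) pi_pos.le, inv_inv, mul_comm π] at h1
  have h2 := mass_mul_le (hb.expWeight hz.le).antitone (integrableOn_expWeight hb hl hz)
    (c := π) (r := ω⁻¹) (by linarith [pi_gt_three]) (inv_pos.2 hω).le
  have h3 : ‖((ω⁻¹ : ℝ) : ℂ)‖ = ω⁻¹ := by
    rw [Complex.norm_real, norm_of_nonneg (inv_pos.2 hω).le]
  rw [h3, ← div_eq_inv_mul, div_le_iff₀ hω]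
  have h4 := mass_nonneg (hb.expWeight hz.le).nonneg ω⁻¹
  rw [mass] at h2
  -- Shrinking the interval from `π / ω` to `1 / ω` costs the factor `π`, and `4` is a bound for it.
  have h5 := pi_lt_four
  calc _ ≤ _ := h1
    _ ≤ ω * (4 * mass (expWeight b σ) ω⁻¹) := by
      refine mul_le_mul_of_nonneg_left (h2.trans ?_) hω.le
      nlinarith
    _ = _ := by ring

theorem norm_laplaceTransform_id_mul_le (hb : IsConvexKernel b)
    (hl : LocallyIntegrableOn b (Ici 0)) {z : ℂ} (hz : 0 < z.re) (hz' : z.im ≠ 0) :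
    ‖laplaceTransform (fun t => t * b t) z‖ ≤ 64 * moment (expWeight b z.re) |z.im|⁻¹ := by
  rw [norm_laplaceTransform_abs_im]
  set σ := z.re
  set ω := |z.im|
  have hω : 0 < ω := abs_pos.2 hz'
  have hk := (hb.expWeight hz.le).comp_mul_right (inv_pos.2 hω)
  have hi := integrableOn_scaled hb hl hz hω
  have hi1 : IntegrableOn (fun t => t * expWeight b σ (t * ω⁻¹)) (Ioi 0) := by
    have := (integrableOn_Ioi_comp_mul_right_iff (fun t => t * expWeight b σ t) 0 (inv_pos.2 hω)).2
      (by simpa using integrableOn_mul_expWeight hb hl hz)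
    refine (this.const_mul ω).congr (ae_of_all _ fun t => ?_)
    simp only; field_simp
  have e0 : laplaceTransform (fun t => expWeight (fun t => t * b t) σ (t * ω⁻¹)) Complex.I =
      ω⁻¹ * laplaceTransform (fun t => t * expWeight b σ (t * ω⁻¹)) Complex.I := by
    rw [laplaceTransform, laplaceTransform, ← integral_const_mul]
    congr 1 with t
    simp only [expWeight]; push_cast; ring
  rw [laplaceTransform_eq_inv_mul _ σ hω, e0, norm_mul, norm_mul]
  have h1 := norm_laplaceTransform_id_mul_I_le hk.nonneg hk.antitone hk.convex hi hi1
  have e1 : ∫ t in Ioc 0 (2 * π), t * expWeight b σ (t * ω⁻¹) =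
      ω ^ 2 * moment (expWeight b σ) (ω⁻¹ * (2 * π)) := by
    have := setIntegral_Ioc_comp_mul (fun t => t * expWeight b σ t) (inv_pos.2 hω)
      (r := 2 * π) (by positivity)
    rw [inv_inv, mul_comm (2 * π)] at this
    rw [moment, pow_two, mul_assoc, ← this, ← integral_const_mul]
    congr 1 with t
    field_simp
  rw [e1] at h1
  have h2 := moment_mul_le (hb.expWeight hz.le).antitone (integrableOn_mul_expWeight hb hl hz)
    (c := 2 * π) (r := ω⁻¹) (by linarith [pi_gt_three]) (inv_pos.2 hω).le
  have h3 : ‖((ω⁻¹ : ℝ) : ℂ)‖ = ω⁻¹ := by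
    rw [Complex.norm_real, norm_of_nonneg (inv_pos.2 hω).le]
  rw [h3, ← div_eq_inv_mul, ← div_eq_inv_mul, div_div,
    div_le_iff₀ (by positivity)]
  have h4 := moment_nonneg (hb.expWeight hz.le).nonneg ω⁻¹
  -- First moments of decreasing functions scale at most quadratically, so shrinking from `2π / ω`
  -- to `1 / ω` costs `(2π)²`.
  have h5 : (2 * π) ^ 2 ≤ 64 := by nlinarith [pi_lt_four, pi_pos]
  calc _ ≤ _ := h1
    _ ≤ ω ^ 2 * (64 * moment (expWeight b σ) ω⁻¹) := by
      refine mul_le_mul_of_nonneg_left (h2.trans ?_) (by positivity)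
      exact mul_le_mul_of_nonneg_right h5 h4
    _ = _ := by ring

end Weights

end VolterraResolvent

namespace VolterraResolvent

/-! ### Differentiability of the Laplace transform -/

section Holomorphy

open Real

variable {f : ℝ → ℝ} {K : ℝ} {z : ℂ}

theorem norm_mul_exp_neg_mul (f : ℝ → ℝ) (z : ℂ) (t : ℝ) :
    ‖(f t : ℂ) * Complex.exp (-z * t)‖ = |expWeight f z.re t| := by
  rw [norm_mul, Complex.norm_exp, expWeight, abs_mul, abs_exp, Complex.norm_real, norm_eq_abs]
  simp

theorem aestronglyMeasurable_of_expWeight {σ : ℝ} (hf : IntegrableOn (expWeight f σ) (Ioi 0)) :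
    AEStronglyMeasurable f (volume.restrict (Ioi 0)) := by
  have h1 : AEStronglyMeasurable (fun t : ℝ => exp (σ * t)) (volume.restrict (Ioi (0 : ℝ))) :=
    Continuous.aestronglyMeasurable (by fun_prop)
  refine (hf.aestronglyMeasurable.mul h1).congr (ae_of_all _ fun t => ?_)
  simp only [expWeight, Pi.mul_apply]
  rw [mul_assoc, ← exp_add]
  simp

theorem aestronglyMeasurable_mul_exp (hf : AEStronglyMeasurable f (volume.restrict (Ioi 0)))
    (z : ℂ) : AEStronglyMeasurable (fun t : ℝ => (f t : ℂ) * Complex.exp (-z * t))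
      (volume.restrict (Ioi 0)) :=
  (Complex.continuous_ofReal.comp_aestronglyMeasurable hf).mul
    (Continuous.aestronglyMeasurable (by fun_prop))

theorem integrableOn_mul_exp_neg_mul (hf : IntegrableOn (expWeight f z.re) (Ioi 0)) :
    IntegrableOn (fun t : ℝ => (f t : ℂ) * Complex.exp (-z * t)) (Ioi 0) :=
  Integrable.mono hf (aestronglyMeasurable_mul_exp (aestronglyMeasurable_of_expWeight hf) z)
    (ae_of_all _ fun t => (norm_mul_exp_neg_mul f z t).le)

theorem mul_exp_neg_le {δ t : ℝ} (hδ : 0 < δ) : t * exp (-δ * t) ≤ δ⁻¹ := by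
  rw [neg_mul, exp_neg, ← div_eq_mul_inv, div_le_iff₀ (exp_pos _), ← div_eq_inv_mul,
    le_div_iff₀ hδ]
  linarith [add_one_le_exp (δ * t)]

theorem abs_mul_expWeight_le {σ σ' t : ℝ} (hσ : σ < σ') (ht : 0 < t) :
    |t * expWeight f σ' t| ≤ (σ' - σ)⁻¹ * |expWeight f σ t| := by
  have e : t * expWeight f σ' t = t * exp (-(σ' - σ) * t) * expWeight f σ t := by
    simp only [expWeight]
    rw [show -σ' * t = -(σ' - σ) * t + -σ * t by ring, exp_add]; ring
  rw [e, abs_mul, abs_of_nonneg (a := t * _) (by positivity)]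
  exact mul_le_mul_of_nonneg_right (mul_exp_neg_le (by linarith)) (abs_nonneg _)

theorem integrableOn_expWeight_id_mul (hf : ∀ σ, K < σ → IntegrableOn (expWeight f σ) (Ioi 0))
    {σ : ℝ} (hσ : K < σ) : IntegrableOn (expWeight (fun t => t * f t) σ) (Ioi 0) := by
  obtain ⟨σ', h1, h2⟩ := exists_between hσ
  have hm := aestronglyMeasurable_of_expWeight (hf σ' h1)
  refine Integrable.mono' ((hf σ' h1).abs.const_mul (σ - σ')⁻¹) ?_
    ((ae_restrict_iff' measurableSet_Ioi).2 (ae_of_all _ fun t ht => ?_))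
  · exact ((Continuous.aestronglyMeasurable (by fun_prop)).mul hm).mul
      (Continuous.aestronglyMeasurable (by fun_prop))
  · have := abs_mul_expWeight_le (f := f) h2 (show 0 < t from ht)
    rw [norm_eq_abs]
    simp only [expWeight] at this ⊢
    rwa [mul_assoc]

theorem hasDerivAt_laplaceTransform
    (hf : ∀ σ, K < σ → IntegrableOn (expWeight f σ) (Ioi 0)) (hz : K < z.re) :
    HasDerivAt (laplaceTransform f) (-laplaceTransform (fun t => t * f t) z) z := by
  -- Two abscissas are needed: the weight at `σ` dominates, `σ'` bounds the real parts in the ball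
  -- from below, and the gap `σ' - σ` absorbs the factor `t` that differentiation brings.
  obtain ⟨σ, h1, h2⟩ := exists_between hz
  obtain ⟨σ', h3, h4⟩ := exists_between h2
  have hm := aestronglyMeasurable_of_expWeight (hf σ h1)
  have hm' : AEStronglyMeasurable (fun t => t * f t) (volume.restrict (Ioi 0)) :=
    (Continuous.aestronglyMeasurable (by fun_prop)).mul hm
  have key := hasDerivAt_integral_of_dominated_loc_of_deriv_le (𝕜 := ℂ)
    (μ := volume.restrict (Ioi (0 : ℝ)))
    (F := fun w (t : ℝ) => (f t : ℂ) * Complex.exp (-w * t))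
    (F' := fun w (t : ℝ) => -(((t * f t : ℝ) : ℂ) * Complex.exp (-w * t)))
    (bound := fun t => (σ' - σ)⁻¹ * |expWeight f σ t|) (x₀ := z) (s := Metric.ball z (z.re - σ'))
    (Metric.ball_mem_nhds z (by linarith))
    (Eventually.of_forall fun w => aestronglyMeasurable_mul_exp hm w)
    (integrableOn_mul_exp_neg_mul (hf _ hz))
    (aestronglyMeasurable_mul_exp hm' z).neg ?_ ((hf σ h1).abs.const_mul _) ?_
  · have h := key.2
    rw [integral_neg] at h
    exact h
  · refine (ae_restrict_iff' measurableSet_Ioi).2 (ae_of_all _ fun t ht w hw => ?_)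
    have ht : 0 < t := ht
    have hw' : σ' < w.re := by
      have h5 := (Complex.abs_re_le_norm (w - z)).trans_lt (mem_ball_iff_norm.1 hw)
      rw [Complex.sub_re] at h5
      linarith [neg_abs_le (w.re - z.re)]
    rw [norm_neg, norm_mul_exp_neg_mul (fun t => t * f t) w t]
    have e : expWeight (fun t => t * f t) w.re t = t * expWeight f w.re t := by
      simp only [expWeight]; ring
    rw [e]
    refine (abs_mul_expWeight_le (f := f) (h3.trans hw') ht).trans ?_
    refine mul_le_mul_of_nonneg_right ?_ (abs_nonneg _)
    exact inv_anti₀ (by linarith) (by linarith)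
  · refine ae_of_all _ fun t w _ => ?_
    have h1 : HasDerivAt (fun w : ℂ => -w * t) (-t) w := by
      simpa using ((hasDerivAt_id w).neg.mul_const (t : ℂ))
    refine (h1.cexp.const_mul (f t : ℂ)).congr_deriv ?_
    push_cast; ring

end Holomorphy

/-! ### Half-plane geometry and the Schwarz lemma -/

section Sector

open Real

/-- If `w` is not small compared with `z`, the real part of the sum is at least `c ‖w‖`. Otherwise
`z` dominates and the triangle inequality suffices. -/
theorem mul_norm_add_norm_le_norm_add {z w : ℂ} {c : ℝ} (hc : 0 < c) (hc1 : c ≤ 1)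
    (hz : 0 ≤ z.re) (hw : c * ‖w‖ ≤ w.re) : c / 5 * (‖z‖ + ‖w‖) ≤ ‖z + w‖ := by
  have h1 := norm_sub_le_norm_add z w
  have h1' := norm_sub_le_norm_add w z
  rw [add_comm w z] at h1'
  have h2 := Complex.re_le_norm (z + w)
  rw [Complex.add_re] at h2
  have hz0 := norm_nonneg z
  have hw0 := norm_nonneg w
  rcases le_total ‖z‖ (2 * ‖w‖) with h | h
  · nlinarith
  · nlinarith

/-- A holomorphic map of the right half-plane into its closure does not contract too fast along the
positive axis. -/
theorem mul_le_mul_of_mapsTo_re_nonneg {g : ℂ → ℂ} (hg : DifferentiableOn ℂ g {z | 0 < z.re})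
    (hg' : ∀ z : ℂ, 0 < z.re → 0 ≤ (g z).re) {x y p q : ℝ} (hx : 0 < x) (hxy : x ≤ y)
    (hp : 0 < p) (hq : 0 < q) (hgx : g x = p) (hgy : g y = q) : x * p ≤ y * q := by
  -- A Cayley map from the disc to the half-plane with `0 ↦ x`. The matching map in the target,
  -- sending `p` to `0`, turns `g` into a self-map `Φ` of the closed disc fixing `0`.
  set φ : ℂ → ℂ := fun w => x * (1 + w) / (1 - w) with hφ
  have hne : ∀ w ∈ Metric.ball (0 : ℂ) 1, 1 - w ≠ 0 := by
    intro w hw h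
    rw [mem_ball_zero_iff] at hw
    have : w = 1 := (sub_eq_zero.1 h).symm
    simp [this] at hw
  have hφre : ∀ w ∈ Metric.ball (0 : ℂ) 1, 0 < (φ w).re := by
    intro w hw
    have h1 : 0 < Complex.normSq (1 - w) := Complex.normSq_pos.2 (hne w hw)
    rw [mem_ball_zero_iff] at hw
    have h2 : Complex.normSq w < 1 := by
      rw [Complex.normSq_eq_norm_sq]; nlinarith [norm_nonneg w]
    have : (φ w).re = x * (1 - Complex.normSq w) / Complex.normSq (1 - w) := by
      simp only [hφ, Complex.div_re, Complex.mul_re, Complex.mul_im, Complex.ofReal_re,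
        Complex.ofReal_im, Complex.add_re, Complex.add_im, Complex.one_re, Complex.one_im,
        Complex.sub_re, Complex.sub_im, Complex.normSq_apply w]
      field_simp; ring
    rw [this]
    have : 0 < 1 - Complex.normSq w := by linarith
    positivity
  have hden : ∀ z : ℂ, 0 < z.re → g z + p ≠ 0 := by
    intro z hz h
    have := congrArg Complex.re h
    simp only [Complex.add_re, Complex.ofReal_re, Complex.zero_re] at this
    linarith [hg' z hz]
  set Φ : ℂ → ℂ := fun w => (g (φ w) - p) / (g (φ w) + p) with hΦ
  have hφd : DifferentiableOn ℂ φ (Metric.ball 0 1) := by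
    intro w hw
    have := hne w hw
    refine DifferentiableAt.differentiableWithinAt ?_
    simp only [hφ]
    fun_prop (disch := assumption)
  have hgφ : DifferentiableOn ℂ (fun w => g (φ w)) (Metric.ball 0 1) := hg.comp hφd hφre
  have hΦd : DifferentiableOn ℂ Φ (Metric.ball 0 1) :=
    (hgφ.sub_const _).div (hgφ.add_const _) fun w hw => hden _ (hφre w hw)
  have hmaps : MapsTo Φ (Metric.ball 0 1) (Metric.closedBall 0 1) := by
    intro w hw
    have hw' := hφre w hw
    rw [mem_closedBall_zero_iff, norm_div, div_le_one (norm_pos_iff.2 (hden _ hw'))]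
    have h1 := hg' _ hw'
    rw [Complex.norm_def, Complex.norm_def]
    refine sqrt_le_sqrt ?_
    simp only [Complex.normSq_apply, Complex.sub_re, Complex.sub_im, Complex.add_re,
      Complex.add_im, Complex.ofReal_re, Complex.ofReal_im]
    nlinarith [mul_nonneg h1 hp.le]
  have hΦ0 : Φ 0 = 0 := by simp [hΦ, hφ, hgx]
  have hxy' : 0 < x + y := by linarith
  set w : ℂ := (((y - x) / (x + y) : ℝ) : ℂ) with hw
  have hwn : ‖w‖ = (y - x) / (x + y) := by
    rw [hw, Complex.norm_real, norm_of_nonneg (div_nonneg (by linarith) hxy'.le)]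
  have hw1 : ‖w‖ < 1 := by rw [hwn, div_lt_one hxy']; linarith
  have hφw : φ w = y := by
    have h3 : (x : ℂ) ≠ 0 := by exact_mod_cast hx.ne'
    have h4 : (x : ℂ) + y ≠ 0 := by exact_mod_cast hxy'.ne'
    have h5 := hne w (mem_ball_zero_iff.2 hw1)
    simp only [hφ]
    rw [div_eq_iff h5, hw]
    push_cast
    field_simp
    ring
  have key := Complex.norm_le_norm_of_mapsTo_ball hΦd hmaps hΦ0 hw1
  have e : Φ w = (((q - p) / (q + p) : ℝ) : ℂ) := by
    simp only [hΦ, hφw, hgy]; push_cast; ring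
  rw [e, Complex.norm_real, norm_eq_abs, hwn] at key
  -- The Schwarz lemma reads `|q - p| / (q + p) ≤ (y - x) / (x + y)`; the case of the sign `p - q`
  -- rearranges to the claim.
  have h6 := (neg_le_abs _).trans key
  rw [← neg_div, div_le_div_iff₀ (by positivity) hxy'] at h6
  nlinarith

end Sector

/-! ### Consequences of the sector condition -/

section Admissible

open Real

variable {b : ℝ → ℝ}

theorem IsAdmissibleKernel.integrableOn_expWeight (hb : IsAdmissibleKernel b) {σ : ℝ} (hσ : 0 < σ) :
    IntegrableOn (expWeight b σ) (Ioi 0) :=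
  VolterraResolvent.integrableOn_expWeight hb.isConvexKernel hb.locallyIntegrable hσ

theorem IsAdmissibleKernel.exists_pos (hb : IsAdmissibleKernel b) : ∃ t₀, 0 < t₀ ∧ ∀ t, 0 < t → t ≤ t₀ → 0 < b t := by
  obtain ⟨t₀, h0, h1⟩ := hb.ne_zero
  have h2 : 0 < b t₀ := lt_of_le_of_ne (hb.nonneg t₀ h0) h1.symm
  exact ⟨t₀, h0, fun t ht htt => h2.trans_le (hb.antitone ht h0 htt)⟩

theorem IsAdmissibleKernel.mass_expWeight_pos (hb : IsAdmissibleKernel b) {σ r : ℝ} (hr : 0 < r) :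
    0 < mass (expWeight b σ) r := by
  obtain ⟨t₀, h0, h1⟩ := hb.exists_pos
  have hi : IntegrableOn (expWeight b σ) (Ioc 0 r) := by
    have := (integrableOn_Ioc_of_locallyIntegrableOn hb.locallyIntegrable r).mul_continuousOn_of_subset
      (g' := fun t => exp (-σ * t)) (K := Icc 0 r) (Continuous.continuousOn (by fun_prop))
      measurableSet_Ioc isCompact_Icc Ioc_subset_Icc_self
    exact this
  refine (setIntegral_pos_iff_support_of_nonneg_ae
    ((ae_restrict_iff' measurableSet_Ioc).2 (ae_of_all _ fun t ht =>
      mul_nonneg (hb.nonneg t ht.1) (exp_pos _).le)) hi).2 ?_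
  have hsub : Ioc 0 (min t₀ r) ⊆ Function.support (expWeight b σ) ∩ Ioc 0 r := fun t ht =>
    ⟨(mul_pos (h1 t ht.1 (ht.2.trans (min_le_left _ _))) (exp_pos _)).ne',
      ht.1, ht.2.trans (min_le_right _ _)⟩
  refine lt_of_lt_of_le ?_ (measure_mono hsub)
  simp [h0, hr]

theorem laplaceTransform_ofReal (b : ℝ → ℝ) (x : ℝ) :
    laplaceTransform b x = ((∫ t in Ioi 0, expWeight b x t : ℝ) : ℂ) := by
  rw [laplaceTransform, ← integral_complex_ofReal]
  congr 1 with t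
  simp [expWeight]

theorem IsAdmissibleKernel.integral_expWeight_pos (hb : IsAdmissibleKernel b) {x : ℝ} (hx : 0 < x) :
    0 < ∫ t in Ioi 0, expWeight b x t := by
  refine (hb.mass_expWeight_pos (σ := x) one_pos).trans_le ?_
  exact setIntegral_mono_set (hb.integrableOn_expWeight hx)
    ((ae_restrict_iff' measurableSet_Ioi).2 (ae_of_all _ fun t ht =>
      mul_nonneg (hb.nonneg t ht) (exp_pos _).le)) (LE.le.eventuallyLE fun t ht => ht.1)

/-- The bound on the argument does not exclude zeros, since `arg 0 = 0`. Positivity on the real axis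
and the lower bound by the mass off it do. -/
theorem IsAdmissibleKernel.laplaceTransform_ne_zero (hb : IsAdmissibleKernel b) {z : ℂ} (hz : 0 < z.re) :
    laplaceTransform b z ≠ 0 := by
  rcases eq_or_ne z.im 0 with h | h
  · have : z = (z.re : ℂ) := by apply Complex.ext <;> simp [h]
    rw [this, laplaceTransform_ofReal]
    exact_mod_cast (hb.integral_expWeight_pos hz).ne'
  · have h1 := mass_le_four_mul_norm_laplaceTransform hb.isConvexKernel hb.locallyIntegrable hz h
    have h2 := hb.mass_expWeight_pos (σ := z.re) (inv_pos.2 (abs_pos.2 h))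
    exact norm_pos_iff.1 (by linarith)

theorem abs_arg_laplaceTransform_le {z : ℂ} (hz : 0 < z.re) :
    |(laplaceTransform b z).arg| ≤ (rho b - 1) * π / 2 := by
  have h : |(laplaceTransform b z).arg| ≤
      sSup ((fun z : ℂ => |(laplaceTransform b z).arg|) '' {z : ℂ | 0 < z.re}) := by
    refine le_csSup ⟨π, ?_⟩ ⟨z, hz, rfl⟩
    rintro _ ⟨w, _, rfl⟩
    exact Complex.abs_arg_le_pi _
  have e : (rho b - 1) * π / 2 =
      sSup ((fun z : ℂ => |(laplaceTransform b z).arg|) '' {z : ℂ | 0 < z.re}) := by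
    rw [rho]; field_simp; ring
  rwa [e]

theorem IsAdmissibleKernel.hasDerivAt_laplaceTransform (hb : IsAdmissibleKernel b) {z : ℂ} (hz : 0 < z.re) :
    HasDerivAt (laplaceTransform b) (-laplaceTransform (fun t => t * b t) z) z :=
  VolterraResolvent.hasDerivAt_laplaceTransform (fun _ h => hb.integrableOn_expWeight h) hz

/-- The half-angle of the sector is `(ρ - 1) π / 2`, less than `π / 2` as `ρ < 2`; its cosine is the
constant. -/
theorem IsAdmissibleKernel.exists_sector (hb : IsAdmissibleKernel b) : ∃ c : ℝ, 0 < c ∧ c ≤ 1 ∧ ∀ z : ℂ, 0 < z.re →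
    c * ‖laplaceTransform b z‖ ≤ (laplaceTransform b z).re := by
  have h1 := hb.one_lt_rho
  have h2 := hb.rho_lt_two
  have hpi := pi_pos
  refine ⟨cos ((rho b - 1) * π / 2), cos_pos_of_mem_Ioo ⟨by nlinarith, by nlinarith⟩,
    cos_le_one _, fun z hz => ?_⟩
  have h3 := abs_arg_laplaceTransform_le (b := b) hz
  set w := laplaceTransform b z
  rw [← Complex.norm_mul_cos_arg w, mul_comm, ← cos_abs w.arg]
  refine mul_le_mul_of_nonneg_left ?_ (norm_nonneg _)
  exact cos_le_cos_of_nonneg_of_le_pi (abs_nonneg _) (by nlinarith) h3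

/-- The power `b̂ ^ (1 / (ρ - 1))` has argument at most `π / 2`, so `mul_le_mul_of_mapsTo_re_nonneg`
applies to it. Raising the result to the power `ρ - 1` gives the monotonicity. -/
theorem IsAdmissibleKernel.rpow_mul_laplace_le (hb : IsAdmissibleKernel b) {x y : ℝ} (hx : 0 < x) (hxy : x ≤ y) :
    x ^ (rho b - 1) * (∫ t in Ioi 0, expWeight b x t) ≤
      y ^ (rho b - 1) * ∫ t in Ioi 0, expWeight b y t := by
  have h1 := hb.one_lt_rho
  have h2 := hb.rho_lt_two
  have hpi := pi_pos
  set κ := rho b - 1 with hκ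
  have hκ0 : 0 < κ := by linarith
  have hy : 0 < y := by linarith
  have hslit : ∀ z : ℂ, 0 < z.re → laplaceTransform b z ∈ Complex.slitPlane := fun z hz => by
    rw [Complex.mem_slitPlane_iff_arg]
    refine ⟨fun h => ?_, hb.laplaceTransform_ne_zero hz⟩
    have := abs_arg_laplaceTransform_le (b := b) hz
    rw [h, abs_of_pos pi_pos] at this
    nlinarith
  have hval : ∀ x : ℝ, 0 < x → Complex.exp (Complex.log (laplaceTransform b x) / κ) =
      (((∫ t in Ioi 0, expWeight b x t) ^ (1 / κ) : ℝ) : ℂ) := fun x hx => by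
    have hp := hb.integral_expWeight_pos hx
    rw [laplaceTransform_ofReal, rpow_def_of_pos hp, ← Complex.ofReal_log hp.le]
    push_cast
    rw [mul_one_div]
  have key := mul_le_mul_of_mapsTo_re_nonneg
    (g := fun z => Complex.exp (Complex.log (laplaceTransform b z) / κ)) ?_ ?_ hx hxy
    (rpow_pos_of_pos (hb.integral_expWeight_pos hx) (1 / κ))
    (rpow_pos_of_pos (hb.integral_expWeight_pos hy) (1 / κ)) (hval x hx) (hval y hy)
  · have hX := hb.integral_expWeight_pos hx
    have hY := hb.integral_expWeight_pos hy
    have := rpow_le_rpow (by positivity) key hκ0.le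
    rwa [mul_rpow hx.le (by positivity), mul_rpow hy.le (by positivity), ← rpow_mul hX.le,
      ← rpow_mul hY.le, one_div_mul_cancel hκ0.ne', rpow_one, rpow_one] at this
  · intro z hz
    exact (((hb.hasDerivAt_laplaceTransform hz).differentiableAt.clog (hslit z hz)).div_const
      _).cexp.differentiableWithinAt
  · intro z hz
    have h3 := abs_arg_laplaceTransform_le (b := b) hz
    rw [Complex.exp_re]
    refine mul_nonneg (exp_pos _).le (cos_nonneg_of_mem_Icc ?_)
    rw [Complex.div_ofReal_im, Complex.log_im, mem_Icc, ← abs_le, abs_div, abs_of_pos hκ0,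
      div_le_iff₀ hκ0]
    linarith

/-- The weight is at most one on `(0, r)`. Beyond `r` the integral is at most `b(r) r e⁻¹`, and
`b(r) r ≤ ∫₀ʳ b` by monotonicity. -/
theorem IsAdmissibleKernel.integral_expWeight_inv_le (hb : IsAdmissibleKernel b) {r : ℝ} (hr : 0 < r) :
    ∫ t in Ioi 0, expWeight b r⁻¹ t ≤ 2 * mass b r := by
  have hi := hb.integrableOn_expWeight (inv_pos.2 hr)
  have hbi := integrableOn_Ioc_of_locallyIntegrableOn hb.locallyIntegrable r
  rw [setIntegral_Ioi_zero_eq_add hi hr.le, two_mul]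
  refine add_le_add ?_ ?_
  · refine setIntegral_mono_on (hi.mono_set fun _ hx => hx.1) hbi measurableSet_Ioc fun t ht => ?_
    exact mul_le_of_le_one_right (hb.nonneg t ht.1)
      (exp_le_one_iff.2 (by have := inv_pos.2 hr; nlinarith [ht.1]))
  · have hbr := hb.nonneg r hr
    have h1 : ∫ t in Ioi r, expWeight b r⁻¹ t ≤ ∫ t in Ioi r, b r * exp (-r⁻¹ * t) := by
      have hsub : Ioi r ⊆ Ioi 0 := Ioi_subset_Ioi hr.le
      refine setIntegral_mono_on (hi.mono_set hsub) ?_ measurableSet_Ioi fun t ht => ?_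
      · exact (by simpa using integrableOn_pow_mul_exp_neg 0 (inv_pos.2 hr) :
          IntegrableOn (fun t => exp (-r⁻¹ * t)) (Ioi 0)).mono_set hsub |>.const_mul _
      · exact mul_le_mul_of_nonneg_right (hb.antitone hr (hsub ht) ht.le) (exp_pos _).le
    refine h1.trans ?_
    have h2 : ∫ t in Ioi r, b r * exp (-r⁻¹ * t) = b r * (r * exp (-1)) := by
      rw [integral_const_mul, integral_exp_mul_Ioi (by simpa using hr)]
      rw [neg_mul, inv_mul_cancel₀ hr.ne']
      field_simp
    rw [h2]
    have h3 : b r * r ≤ mass b r := by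
      have : ∫ _ in Ioc 0 r, b r = b r * r := by simp [hr.le, mul_comm]
      rw [← this, mass]
      refine setIntegral_mono_on (by simp) hbi measurableSet_Ioc fun t ht => ?_
      exact hb.antitone ht.1 hr ht.2
    have h4 : exp (-1) ≤ 1 := exp_le_one_iff.2 (by norm_num)
    nlinarith [mul_nonneg hbr hr.le]

/-- Compare `b̂` at `r⁻¹` and at `R⁻¹` by `rpow_mul_laplace_le`. The restriction `r ≤ R` orders
these two points. -/
theorem IsAdmissibleKernel.exists_mul_rpow_le_mass (hb : IsAdmissibleKernel b) {R : ℝ} (hR : 0 < R) :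
    ∃ c : ℝ, 0 < c ∧ ∀ r, 0 < r → r ≤ R → c * r ^ (rho b - 1) ≤ mass b r := by
  have hp := hb.integral_expWeight_pos (inv_pos.2 hR)
  refine ⟨(R⁻¹ ^ (rho b - 1) * ∫ t in Ioi 0, expWeight b R⁻¹ t) / 2, by positivity,
    fun r hr hrR => ?_⟩
  have h1 := hb.rpow_mul_laplace_le (inv_pos.2 hR) (inv_anti₀ hr hrR)
  have h2 := hb.integral_expWeight_inv_le hr
  have h3 : 0 < r ^ (rho b - 1) := by positivity
  rw [inv_rpow hr.le] at h1
  rw [← le_div_iff₀ h3]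
  have h4 := h1.trans (mul_le_mul_of_nonneg_left h2 (inv_pos.2 h3).le)
  rw [div_eq_inv_mul (mass b r)]
  linarith

end Admissible

end VolterraResolvent

namespace VolterraResolvent

/-! ### Integrals along vertical lines -/

section Lines

open Real

variable {F : ℂ → ℂ} {C R σ : ℝ}

theorem continuous_comp_line (hF : ContinuousOn F {z | 0 < z.re}) (hσ : 0 < σ) :
    Continuous fun ω : ℝ => F (σ + ω * Complex.I) :=
  hF.comp_continuous (by fun_prop) fun ω => by simpa using hσ

theorem integrable_comp_line (hF : ContinuousOn F {z | 0 < z.re}) (hR : 0 < R)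
    (hd : ∀ z : ℂ, 0 < z.re → R ≤ |z.im| → ‖F z‖ ≤ C / z.im ^ 2) (hσ : 0 < σ) :
    Integrable fun ω : ℝ => F (σ + ω * Complex.I) := by
  have hc := continuous_comp_line hF hσ
  obtain ⟨M, hM⟩ := isCompact_Icc.exists_bound_of_continuousOn (s := Icc (-R) R) hc.continuousOn
  have hM0 : 0 ≤ M := (norm_nonneg _).trans (hM 0 ⟨by linarith, hR.le⟩)
  have hCR : 0 ≤ C / R ^ 2 := by
    have := hd (1 + R * Complex.I) (by simp) (by simp [abs_of_pos hR])
    refine (norm_nonneg _).trans (this.trans_eq ?_)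
    simp
  have hC : 0 ≤ C := by
    have := mul_nonneg hCR (sq_nonneg R)
    rwa [div_mul_cancel₀ _ (by positivity)] at this
  refine Integrable.mono' (integrable_inv_one_add_sq.const_mul (M * (1 + R ^ 2) + (C + C / R ^ 2)))
    hc.aestronglyMeasurable (ae_of_all _ fun ω => ?_)
  rw [← div_eq_mul_inv, le_div_iff₀ (by positivity)]
  rcases le_total |ω| R with h | h
  · have h1 := hM ω (abs_le.1 h)
    have h2 : ω ^ 2 ≤ R ^ 2 := sq_le_sq' (abs_le.1 h).1 (abs_le.1 h).2
    calc _ ≤ M * (1 + R ^ 2) := mul_le_mul h1 (by linarith) (by positivity) hM0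
      _ ≤ _ := by linarith
  · have h1 := hd (σ + ω * Complex.I) (by simpa using hσ) (by simpa using h)
    simp only [Complex.add_im, Complex.ofReal_im, Complex.mul_im, Complex.ofReal_re,
      Complex.I_im, mul_one, Complex.I_re, mul_zero, add_zero, zero_add] at h1
    have h2 : R ^ 2 ≤ ω ^ 2 := by rw [← sq_abs ω]; exact pow_le_pow_left₀ hR.le h 2
    have h3 : 0 < ω ^ 2 := by nlinarith
    calc _ ≤ C / ω ^ 2 * (1 + ω ^ 2) := mul_le_mul_of_nonneg_right h1 (by positivity)
      _ = C / ω ^ 2 + C := by rw [mul_add, mul_one, div_mul_cancel₀ _ h3.ne']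
      _ ≤ C / R ^ 2 + C := by gcongr
      _ ≤ _ := by nlinarith [mul_nonneg hM0 (by positivity : 0 ≤ 1 + R ^ 2)]

theorem norm_comp_line_abs (hF : ∀ z, F (starRingEnd ℂ z) = starRingEnd ℂ (F z)) (σ ω : ℝ) :
    ‖F (σ + ω * Complex.I)‖ = ‖F (σ + |ω| * Complex.I)‖ := by
  rcases abs_choice ω with h | h
  · rw [h]
  · rw [h, ← Complex.norm_conj, ← hF]
    congr 2
    apply Complex.ext <;> simp

/-- Conjugation symmetry gives the factor `2`, and the quadratic decay gives the tail `C / R`. The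
low part is a limit `ε → 0` because the estimates for it are available only off the real axis. -/
theorem integral_norm_line_le (hF : ContinuousOn F {z | 0 < z.re})
    (hF' : ∀ z, F (starRingEnd ℂ z) = starRingEnd ℂ (F z)) (hR : 0 < R)
    (hd : ∀ z : ℂ, 0 < z.re → R ≤ |z.im| → ‖F z‖ ≤ C / z.im ^ 2) (hσ : 0 < σ) {M : ℝ}
    (hM : ∀ ε, 0 < ε → ε ≤ R → ∫ ω in ε..R, ‖F (σ + ω * Complex.I)‖ ≤ M) :
    ∫ ω : ℝ, ‖F (σ + ω * Complex.I)‖ ≤ 2 * (M + C / R) := by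
  have hc := (continuous_comp_line hF hσ).norm
  have hi := (integrable_comp_line hF hR hd hσ).norm
  have e : ∀ ω : ℝ, ‖F (σ + ω * Complex.I)‖ =
      (fun x : ℝ => ‖F (σ + x * Complex.I)‖) |ω| := fun ω => norm_comp_line_abs hF' σ ω
  rw [integral_congr_ae (ae_of_all _ e),
    integral_comp_abs (f := fun x : ℝ => ‖F (σ + x * Complex.I)‖),
    setIntegral_Ioi_zero_eq_add hi.integrableOn hR.le]
  refine mul_le_mul_of_nonneg_left (add_le_add ?_ ?_) zero_le_two
  · rw [← intervalIntegral.integral_of_le hR.le]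
    have hlim : Tendsto (fun ε => ∫ ω in ε..R, ‖F (σ + ω * Complex.I)‖) (𝓝[>] 0)
        (𝓝 (∫ ω in (0 : ℝ)..R, ‖F (σ + ω * Complex.I)‖)) := by
      have h1 : Continuous fun ε : ℝ => ∫ ω in R..ε, ‖F (σ + ω * Complex.I)‖ :=
        intervalIntegral.continuous_primitive (fun a b => hc.intervalIntegrable a b) R
      have h2 := (h1.neg.tendsto 0).mono_left (nhdsWithin_le_nhds (s := Ioi 0))
      simpa only [Pi.neg_def, ← intervalIntegral.integral_symm] using h2
    refine le_of_tendsto hlim ?_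
    filter_upwards [Ioc_mem_nhdsGT hR] with ε hε using hM ε hε.1 hε.2
  · have h1 : IntegrableOn (fun ω : ℝ => C * ω ^ (-2 : ℝ)) (Ioi R) :=
      (integrableOn_Ioi_rpow_of_lt (by norm_num) hR).const_mul C
    have h2 : ∫ ω in Ioi R, C * ω ^ (-2 : ℝ) = C / R := by
      rw [integral_const_mul, integral_Ioi_rpow_of_lt (by norm_num) hR,
        show (-2 : ℝ) + 1 = -1 by norm_num, rpow_neg_one]
      ring
    rw [← h2]
    refine setIntegral_mono_on hi.integrableOn h1 measurableSet_Ioi fun ω hω => ?_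
    have hω : R < ω := hω
    have h3 := hd (σ + ω * Complex.I) (by simpa using hσ)
      (by simpa using hω.le.trans (le_abs_self ω))
    simp only [Complex.add_im, Complex.ofReal_im, Complex.mul_im, Complex.ofReal_re,
      Complex.I_im, mul_one, Complex.I_re, mul_zero, add_zero, zero_add] at h3
    rw [rpow_neg (by linarith), ← div_eq_mul_inv]
    exact_mod_cast h3

end Lines

/-! ### The frequency integral of moment / mass² -/

section MassDerivative

open Real

variable {g : ℝ → ℝ}

theorem hasDerivAt_setIntegral_Ioc (hc : ContinuousOn g (Ioi 0)) (hi : IntegrableOn g (Ioi 0))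
    {r : ℝ} (hr : 0 < r) : HasDerivAt (fun r => ∫ t in Ioc 0 r, g t) (g r) r := by
  have h1 : IntervalIntegrable g volume 0 r :=
    (intervalIntegrable_iff_integrableOn_Ioc_of_le hr.le).2 (hi.mono_set fun _ hx => hx.1)
  have h2 := intervalIntegral.integral_hasDerivAt_right h1
    (hc.stronglyMeasurableAtFilter isOpen_Ioi r hr) (hc.continuousAt (Ioi_mem_nhds hr))
  refine h2.congr_of_eventuallyEq ?_
  filter_upwards [Ioi_mem_nhds hr] with x hx
  rw [intervalIntegral.integral_of_le (le_of_lt hx)]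

/-- With `B` and `D` the mass and the moment at `1 / ω`, put `G = ω D / B² + 1 / B`. The derivatives
of the second `D` and of `1 / B` cancel, leaving `G' = D / B² + 2 D g(1/ω) / (ω B³) ≥ D / B²`.
Moreover `G(ε) ≥ 0`, and `R D ≤ B` at `ω = R` bounds `G(R)`, so the estimate does not depend on `ε`.
-/
theorem integral_moment_div_mass_sq_le (h0 : ∀ t, 0 < t → 0 ≤ g t) (hc : ContinuousOn g (Ioi 0))
    (hi : IntegrableOn g (Ioi 0)) (hi1 : IntegrableOn (fun t => t * g t) (Ioi 0))
    (hm : ∀ r, 0 < r → 0 < mass g r) {ε R : ℝ} (hε : 0 < ε) (hεR : ε ≤ R) :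
    IntervalIntegrable (fun ω => moment g ω⁻¹ / mass g ω⁻¹ ^ 2) volume ε R ∧
      ∫ ω in ε..R, moment g ω⁻¹ / mass g ω⁻¹ ^ 2 ≤ 2 / mass g R⁻¹ := by
  have hB : ∀ r, 0 < r → HasDerivAt (mass g) (g r) r := fun r hr =>
    hasDerivAt_setIntegral_Ioc hc hi hr
  have hD : ∀ r, 0 < r → HasDerivAt (moment g) (r * g r) r := fun r hr =>
    hasDerivAt_setIntegral_Ioc (continuousOn_id.mul hc) hi1 hr
  have hinv : ∀ ω : ℝ, 0 < ω → HasDerivAt (fun ω : ℝ => ω⁻¹) (-(ω ^ 2)⁻¹) ω := fun ω hω =>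
    hasDerivAt_inv hω.ne'
  have hB' : ∀ ω, 0 < ω → HasDerivAt (fun ω => mass g ω⁻¹) (g ω⁻¹ * -(ω ^ 2)⁻¹) ω :=
    fun ω hω => (hB _ (inv_pos.2 hω)).comp ω (hinv ω hω)
  have hD' : ∀ ω, 0 < ω → HasDerivAt (fun ω => moment g ω⁻¹) (ω⁻¹ * g ω⁻¹ * -(ω ^ 2)⁻¹) ω :=
    fun ω hω => (hD _ (inv_pos.2 hω)).comp ω (hinv ω hω)
  have hpos : ∀ ω ∈ Icc ε R, 0 < ω := fun ω hω => hε.trans_le hω.1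
  have cB : ContinuousOn (fun ω => mass g ω⁻¹) (Icc ε R) := fun ω hω =>
    (hB' ω (hpos ω hω)).continuousAt.continuousWithinAt
  have cD : ContinuousOn (fun ω => moment g ω⁻¹) (Icc ε R) := fun ω hω =>
    (hD' ω (hpos ω hω)).continuousAt.continuousWithinAt
  have cinv : ContinuousOn (fun ω : ℝ => ω⁻¹) (Icc ε R) := fun ω hω =>
    (hinv ω (hpos ω hω)).continuousAt.continuousWithinAt
  have cg : ContinuousOn (fun ω => g ω⁻¹) (Icc ε R) :=
    hc.comp cinv fun ω hω => inv_pos.2 (hpos ω hω)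
  have hBpos : ∀ ω ∈ Icc ε R, 0 < mass g ω⁻¹ := fun ω hω => hm _ (inv_pos.2 (hpos ω hω))
  set G : ℝ → ℝ := fun ω => ω * moment g ω⁻¹ / mass g ω⁻¹ ^ 2 + 1 / mass g ω⁻¹ with hG
  set G' : ℝ → ℝ := fun ω => moment g ω⁻¹ / mass g ω⁻¹ ^ 2 +
    2 * moment g ω⁻¹ * g ω⁻¹ * ω⁻¹ / mass g ω⁻¹ ^ 3 with hG'
  have hGd : ∀ ω ∈ Icc ε R, HasDerivAt G (G' ω) ω := fun ω hω => by
    have h1 := hpos ω hω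
    have h2 := hBpos ω hω
    have h3 := (((hasDerivAt_id' ω).mul (hD' ω h1)).div ((hB' ω h1).pow 2)
      (pow_pos h2 2).ne').add ((hasDerivAt_const ω (1 : ℝ)).div (hB' ω h1) h2.ne')
    refine h3.congr_deriv ?_
    simp only [hG', Pi.mul_apply, Pi.pow_apply]
    generalize mass g ω⁻¹ = B at h2
    generalize moment g ω⁻¹ = D
    generalize g ω⁻¹ = x
    field_simp
    ring
  have c1 : ContinuousOn (fun ω => moment g ω⁻¹ / mass g ω⁻¹ ^ 2) (Icc ε R) :=
    cD.div (cB.pow 2) fun ω hω => by have := hBpos ω hω; positivity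
  have c2 : ContinuousOn G' (Icc ε R) :=
    c1.add ((((continuousOn_const.mul cD).mul cg).mul cinv).div (cB.pow 3)
      fun ω hω => by have := hBpos ω hω; positivity)
  have i1 : IntervalIntegrable (fun ω => moment g ω⁻¹ / mass g ω⁻¹ ^ 2) volume ε R :=
    ContinuousOn.intervalIntegrable_of_Icc hεR c1
  have i2 : IntervalIntegrable G' volume ε R := ContinuousOn.intervalIntegrable_of_Icc hεR c2
  refine ⟨i1, ?_⟩
  have hint : ∫ ω in ε..R, G' ω = G R - G ε :=
    intervalIntegral.integral_eq_sub_of_hasDerivAt (fun ω hω => by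
      rw [uIcc_of_le hεR] at hω; exact hGd ω hω) i2
  have hmono : ∫ ω in ε..R, moment g ω⁻¹ / mass g ω⁻¹ ^ 2 ≤ ∫ ω in ε..R, G' ω := by
    refine intervalIntegral.integral_mono_on hεR i1 i2 fun ω hω => ?_
    have h1 := hpos ω hω
    have h2 := hBpos ω hω
    have h3 := moment_nonneg h0 ω⁻¹
    have h4 := h0 _ (inv_pos.2 h1)
    have : 0 ≤ 2 * moment g ω⁻¹ * g ω⁻¹ * ω⁻¹ / mass g ω⁻¹ ^ 3 := by positivity
    simp only [hG']; linarith
  have hGε : 0 ≤ G ε := by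
    have h2 := hBpos ε (left_mem_Icc.2 hεR)
    have h3 := moment_nonneg h0 ε⁻¹
    simp only [hG]; positivity
  have hR0 : 0 < R := hε.trans_le hεR
  have hGR : G R ≤ 2 / mass g R⁻¹ := by
    have h2 := hBpos R (right_mem_Icc.2 hεR)
    have h3 := moment_le_mul_mass h0 hi hi1 R⁻¹
    have h4 : R * moment g R⁻¹ ≤ mass g R⁻¹ := by
      rwa [← div_eq_inv_mul, le_div_iff₀ hR0, mul_comm] at h3
    have h5 : R * moment g R⁻¹ / mass g R⁻¹ ^ 2 ≤ 1 / mass g R⁻¹ := by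
      rw [div_le_div_iff₀ (by positivity) h2]
      nlinarith
    simp only [hG]
    rw [show 2 / mass g R⁻¹ = 1 / mass g R⁻¹ + 1 / mass g R⁻¹ by ring]
    linarith
  linarith

end MassDerivative

/-! ### Bounds for the resolvent symbol -/

section Symbols

open Real

variable {b : ℝ → ℝ} {μ : ℝ}

/-- The symbol `z + μ b̂(z)`. -/
noncomputable def symbol (b : ℝ → ℝ) (μ : ℝ) (z : ℂ) : ℂ := z + μ * laplaceTransform b z

/-- The transform of `t φ(t)`, where `φ` is the scalar resolvent. -/
noncomputable def symbolDeriv (b : ℝ → ℝ) (μ : ℝ) (z : ℂ) : ℂ :=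
  (1 - μ * laplaceTransform (fun t => t * b t) z) / symbol b μ z ^ 2

/-- The transform of `-t φ'(t)`, where `φ` is the scalar resolvent. -/
noncomputable def symbolDeriv₂ (b : ℝ → ℝ) (μ : ℝ) (z : ℂ) : ℂ :=
  μ * (laplaceTransform b z + z * laplaceTransform (fun t => t * b t) z) / symbol b μ z ^ 2

theorem symbolDeriv_conj (z : ℂ) :
    symbolDeriv b μ (starRingEnd ℂ z) = starRingEnd ℂ (symbolDeriv b μ z) := by
  simp only [symbolDeriv, symbol, laplaceTransform_conj, map_div₀, map_sub, map_mul, map_add,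
    map_pow, map_one, Complex.conj_ofReal]

theorem symbolDeriv₂_conj (z : ℂ) :
    symbolDeriv₂ b μ (starRingEnd ℂ z) = starRingEnd ℂ (symbolDeriv₂ b μ z) := by
  simp only [symbolDeriv₂, symbol, laplaceTransform_conj, map_div₀, map_mul, map_add,
    map_pow, Complex.conj_ofReal]

/-- Multiplication by `μ > 0` preserves the sector of `b̂`, so the constant is uniform in `μ`. -/
theorem IsAdmissibleKernel.exists_le_norm_symbol (hb : IsAdmissibleKernel b) :
    ∃ c : ℝ, 0 < c ∧ ∀ μ : ℝ, 0 < μ → ∀ z : ℂ, 0 < z.re →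
      c * (‖z‖ + μ * ‖laplaceTransform b z‖) ≤ ‖symbol b μ z‖ := by
  obtain ⟨c, h0, h1, h⟩ := hb.exists_sector
  refine ⟨c / 5, by positivity, fun μ hμ z hz => ?_⟩
  have hn : ‖(μ : ℂ) * laplaceTransform b z‖ = μ * ‖laplaceTransform b z‖ := by
    rw [norm_mul, Complex.norm_real, norm_of_nonneg hμ.le]
  rw [← hn]
  refine mul_norm_add_norm_le_norm_add h0 h1 hz.le ?_
  rw [hn, Complex.re_ofReal_mul]
  nlinarith [h z hz]

theorem IsAdmissibleKernel.symbol_ne_zero (hb : IsAdmissibleKernel b) (hμ : 0 < μ) {z : ℂ}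
    (hz : 0 < z.re) : symbol b μ z ≠ 0 := by
  obtain ⟨c, hc, h⟩ := hb.exists_le_norm_symbol
  have h1 := h μ hμ z hz
  have h2 : 0 < ‖z‖ := norm_pos_iff.2 fun h => by simp [h] at hz
  have h3 : 0 < c * (‖z‖ + μ * ‖laplaceTransform b z‖) := by positivity
  exact norm_pos_iff.1 (h3.trans_le h1)

theorem IsAdmissibleKernel.hasDerivAt_symbol (hb : IsAdmissibleKernel b) {z : ℂ}
    (hz : 0 < z.re) :
    HasDerivAt (symbol b μ) (1 - μ * laplaceTransform (fun t => t * b t) z) z := by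
  refine ((hasDerivAt_id z).add ((hb.hasDerivAt_laplaceTransform hz).const_mul (μ : ℂ))).congr_deriv
    (by ring)

theorem IsAdmissibleKernel.differentiableOn_laplaceTransform_id_mul (hb : IsAdmissibleKernel b) :
    DifferentiableOn ℂ (laplaceTransform fun t => t * b t) {z | 0 < z.re} := fun _ hz =>
  (VolterraResolvent.hasDerivAt_laplaceTransform (K := 0)
    (fun _ h => integrableOn_expWeight_id_mul (fun _ h => hb.integrableOn_expWeight h) h)
    hz).differentiableAt.differentiableWithinAt

theorem IsAdmissibleKernel.differentiableOn_laplaceTransform (hb : IsAdmissibleKernel b) :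
    DifferentiableOn ℂ (laplaceTransform b) {z | 0 < z.re} := fun _ hz =>
  (hb.hasDerivAt_laplaceTransform hz).differentiableAt.differentiableWithinAt

theorem IsAdmissibleKernel.differentiableOn_symbolDeriv (hb : IsAdmissibleKernel b) (hμ : 0 < μ) :
    DifferentiableOn ℂ (symbolDeriv b μ) {z | 0 < z.re} :=
  (hb.differentiableOn_laplaceTransform_id_mul.const_mul (μ : ℂ) |>.const_sub 1).div
    ((differentiableOn_id.add (hb.differentiableOn_laplaceTransform.const_mul (μ : ℂ))).pow 2)
    fun _ hz => pow_ne_zero 2 (hb.symbol_ne_zero hμ hz)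

theorem IsAdmissibleKernel.differentiableOn_symbolDeriv₂ (hb : IsAdmissibleKernel b)
    (hμ : 0 < μ) : DifferentiableOn ℂ (symbolDeriv₂ b μ) {z | 0 < z.re} :=
  ((hb.differentiableOn_laplaceTransform.add
    (differentiableOn_id.mul hb.differentiableOn_laplaceTransform_id_mul)).const_mul (μ : ℂ)).div
    ((differentiableOn_id.add (hb.differentiableOn_laplaceTransform.const_mul (μ : ℂ))).pow 2)
    fun _ hz => pow_ne_zero 2 (hb.symbol_ne_zero hμ hz)

theorem IsAdmissibleKernel.mass_expWeight_le (hb : IsAdmissibleKernel b) {σ : ℝ} (hσ : 0 < σ)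
    (r : ℝ) : mass (expWeight b σ) r ≤ mass b r := by
  refine setIntegral_mono_on ((hb.integrableOn_expWeight hσ).mono_set fun _ hx => hx.1)
    (integrableOn_Ioc_of_locallyIntegrableOn hb.locallyIntegrable r) measurableSet_Ioc
    fun t ht => ?_
  exact mul_le_of_le_one_right (hb.nonneg t ht.1) (exp_le_one_iff.2 (by nlinarith [ht.1]))

theorem IsAdmissibleKernel.mass_le_mul_mass_expWeight (hb : IsAdmissibleKernel b) {σ r : ℝ}
    (hσ : 0 < σ) (hσr : σ * r ≤ 1) : mass b r ≤ 3 * mass (expWeight b σ) r := by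
  rw [mass, mass, ← integral_const_mul]
  refine setIntegral_mono_on (integrableOn_Ioc_of_locallyIntegrableOn hb.locallyIntegrable r)
    (((hb.integrableOn_expWeight hσ).mono_set fun _ hx => hx.1).const_mul 3) measurableSet_Ioc
    fun t ht => ?_
  have h1 := hb.nonneg t ht.1
  have h2 : exp (-1) ≤ exp (-σ * t) := exp_le_exp.2 (by nlinarith [ht.2])
  have h3 : 1 ≤ 3 * exp (-1) := by
    rw [exp_neg, ← div_eq_mul_inv, le_div_iff₀ (exp_pos _)]
    linarith [exp_one_lt_d9]
  simp only [expWeight]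
  nlinarith

theorem IsAdmissibleKernel.mass_mono (hb : IsAdmissibleKernel b) {r r' : ℝ} (h : r ≤ r') :
    mass b r ≤ mass b r' :=
  setIntegral_mono_set (integrableOn_Ioc_of_locallyIntegrableOn hb.locallyIntegrable r')
    ((ae_restrict_iff' measurableSet_Ioc).2 (ae_of_all _ fun t ht => hb.nonneg t ht.1))
    (Ioc_subset_Ioc_right h).eventuallyLE

/-- The constant is `4 + 64 + 64`. In `‖z‖ ≤ Re z + |Im z|` the real part times the moment is
bounded by `mul_moment_expWeight_le`, the imaginary part by `t ≤ 1 / |Im z|`. -/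
theorem IsAdmissibleKernel.norm_laplaceTransform_add_le (hb : IsAdmissibleKernel b) {z : ℂ}
    (hz : 0 < z.re) (hz' : z.im ≠ 0) :
    ‖laplaceTransform b z + z * laplaceTransform (fun t => t * b t) z‖ ≤
      132 * mass (expWeight b z.re) |z.im|⁻¹ := by
  have h1 := norm_laplaceTransform_le hb.isConvexKernel hb.locallyIntegrable hz hz'
  have h2 := norm_laplaceTransform_id_mul_le hb.isConvexKernel hb.locallyIntegrable hz hz'
  have hω : 0 < |z.im| := abs_pos.2 hz'
  have h3 := mul_moment_expWeight_le hb.isConvexKernel hb.locallyIntegrable hz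
    (inv_pos.2 hω).le
  have h4 := moment_le_mul_mass (hb.isConvexKernel.expWeight hz.le).nonneg
    (hb.integrableOn_expWeight hz)
    (integrableOn_mul_expWeight hb.isConvexKernel hb.locallyIntegrable hz) |z.im|⁻¹
  rw [← div_eq_inv_mul, le_div_iff₀ hω] at h4
  have h5 := Complex.norm_le_abs_re_add_abs_im z
  rw [abs_of_pos hz] at h5
  have h6 := moment_nonneg (hb.isConvexKernel.expWeight hz.le).nonneg |z.im|⁻¹
  refine (norm_add_le _ _).trans ?_
  rw [norm_mul]
  have h7 : ‖z‖ * ‖laplaceTransform (fun t => t * b t) z‖ ≤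
      (z.re + |z.im|) * (64 * moment (expWeight b z.re) |z.im|⁻¹) :=
    mul_le_mul h5 h2 (norm_nonneg _) (by positivity)
  nlinarith

variable {c r₀ : ℝ}

theorem norm_div_sq_le {N Q : ℂ} {n q : ℝ} (hN : ‖N‖ ≤ n) (hq : 0 < q) (hQ : q ≤ ‖Q‖) :
    ‖N / Q ^ 2‖ ≤ n / q ^ 2 := by
  rw [norm_div, norm_pow]
  have := (norm_nonneg N).trans hN
  gcongr

/-- Above `1 / r₀` the term `z` controls the symbol from below, and the normalisation of `r₀` bounds
the numerators: `33 = 1 + 64 / 2` and `66 = 132 / 2`. -/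
theorem IsAdmissibleKernel.norm_symbolDeriv_le_of_high (hb : IsAdmissibleKernel b) (hμ : 0 < μ)
    (hc : 0 < c) (hr : 0 < r₀)
    (hsym : ∀ z : ℂ, 0 < z.re → c * (‖z‖ + μ * ‖laplaceTransform b z‖) ≤ ‖symbol b μ z‖)
    (hr₀ : μ * r₀ * mass b r₀ = 1 / 2) {z : ℂ} (hz : 0 < z.re) (hz' : r₀⁻¹ ≤ |z.im|) :
    ‖symbolDeriv b μ z‖ ≤ 33 / c ^ 2 / z.im ^ 2 ∧
      ‖symbolDeriv₂ b μ z‖ ≤ 66 * r₀⁻¹ / c ^ 2 / z.im ^ 2 := by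
  have hω : 0 < |z.im| := (inv_pos.2 hr).trans_le hz'
  have him : z.im ≠ 0 := abs_pos.1 hω
  have hinv : |z.im|⁻¹ ≤ r₀ := inv_le_of_inv_le₀ hr hz'
  have h1 := norm_laplaceTransform_id_mul_le hb.isConvexKernel hb.locallyIntegrable hz him
  have h2 := hb.norm_laplaceTransform_add_le hz him
  have h3 := moment_le_mul_mass (hb.isConvexKernel.expWeight hz.le).nonneg
    (hb.integrableOn_expWeight hz)
    (integrableOn_mul_expWeight hb.isConvexKernel hb.locallyIntegrable hz) |z.im|⁻¹
  have h4 : mass (expWeight b z.re) |z.im|⁻¹ ≤ mass b r₀ :=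
    (hb.mass_expWeight_le hz _).trans (hb.mass_mono hinv)
  have h5 := mass_nonneg (hb.isConvexKernel.expWeight hz.le).nonneg |z.im|⁻¹
  have hQ : c * |z.im| ≤ ‖symbol b μ z‖ := by
    refine le_trans ?_ (hsym z hz)
    refine mul_le_mul_of_nonneg_left ((Complex.abs_im_le_norm z).trans ?_) hc.le
    have := mul_nonneg hμ.le (norm_nonneg (laplaceTransform b z))
    linarith
  have hq : 0 < c * |z.im| := by positivity
  have esq : (c * |z.im|) ^ 2 = c ^ 2 * z.im ^ 2 := by rw [mul_pow, sq_abs]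
  constructor
  · have h6 : ‖1 - μ * laplaceTransform (fun t => t * b t) z‖ ≤ 33 := by
      refine (norm_sub_le _ _).trans ?_
      rw [norm_mul, Complex.norm_real, norm_of_nonneg hμ.le, norm_one]
      have h7 : moment (expWeight b z.re) |z.im|⁻¹ ≤ r₀ * mass b r₀ :=
        h3.trans (mul_le_mul hinv h4 h5 hr.le)
      have h8 : μ * ‖laplaceTransform (fun t => t * b t) z‖ ≤ μ * (64 * (r₀ * mass b r₀)) :=
        mul_le_mul_of_nonneg_left (by linarith) hμ.le
      have h9 : μ * (64 * (r₀ * mass b r₀)) = 64 * (μ * r₀ * mass b r₀) := by ring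
      rw [h9, hr₀] at h8
      linarith
    have := norm_div_sq_le h6 hq hQ
    rw [esq, ← div_div] at this
    exact this
  · have h6 : ‖μ * (laplaceTransform b z + z * laplaceTransform (fun t => t * b t) z)‖ ≤
        66 * r₀⁻¹ := by
      rw [norm_mul, Complex.norm_real, norm_of_nonneg hμ.le]
      have h7 : μ * mass b r₀ = 1 / 2 * r₀⁻¹ := by
        rw [← hr₀]; field_simp
      calc _ ≤ μ * (132 * mass b r₀) := mul_le_mul_of_nonneg_left (by linarith) hμ.le
        _ = 132 * (μ * mass b r₀) := by ring
        _ = 66 * r₀⁻¹ := by rw [h7]; ring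
    have := norm_div_sq_le h6 hq hQ
    rw [esq, ← div_div] at this
    exact this

/-- Here `μ b̂` serves as the lower bound of the symbol, through `‖b̂‖ ≥ B / 4`; squaring gives
`16`, and `2112 = 16 * 132`. -/
theorem IsAdmissibleKernel.norm_symbolDeriv_le_of_low (hb : IsAdmissibleKernel b) (hμ : 0 < μ)
    (hc : 0 < c)
    (hsym : ∀ z : ℂ, 0 < z.re → c * (‖z‖ + μ * ‖laplaceTransform b z‖) ≤ ‖symbol b μ z‖)
    {z : ℂ} (hz : 0 < z.re) (him : z.im ≠ 0) :
    ‖symbolDeriv b μ z‖ ≤ 16 / (c ^ 2 * μ ^ 2) * (1 / mass (expWeight b z.re) |z.im|⁻¹ ^ 2 +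
        64 * μ * (moment (expWeight b z.re) |z.im|⁻¹ / mass (expWeight b z.re) |z.im|⁻¹ ^ 2)) ∧
      ‖symbolDeriv₂ b μ z‖ ≤ 2112 / (c ^ 2 * μ * mass (expWeight b z.re) |z.im|⁻¹) := by
  have hω : 0 < |z.im| := abs_pos.2 him
  have h1 := norm_laplaceTransform_id_mul_le hb.isConvexKernel hb.locallyIntegrable hz him
  have h2 := hb.norm_laplaceTransform_add_le hz him
  have h4 := mass_le_four_mul_norm_laplaceTransform hb.isConvexKernel hb.locallyIntegrable hz him
  have hB := hb.mass_expWeight_pos (σ := z.re) (inv_pos.2 hω)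
  set B := mass (expWeight b z.re) |z.im|⁻¹
  set D := moment (expWeight b z.re) |z.im|⁻¹
  have hQ : c * (μ * (B / 4)) ≤ ‖symbol b μ z‖ := by
    refine le_trans ?_ (hsym z hz)
    refine mul_le_mul_of_nonneg_left ?_ hc.le
    have : μ * (B / 4) ≤ μ * ‖laplaceTransform b z‖ :=
      mul_le_mul_of_nonneg_left (by linarith) hμ.le
    linarith [norm_nonneg z]
  have hq : 0 < c * (μ * (B / 4)) := by positivity
  constructor
  · have h6 : ‖1 - μ * laplaceTransform (fun t => t * b t) z‖ ≤ 1 + 64 * μ * D := by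
      refine (norm_sub_le _ _).trans ?_
      rw [norm_mul, Complex.norm_real, norm_of_nonneg hμ.le, norm_one]
      nlinarith
    refine (norm_div_sq_le h6 hq hQ).trans_eq ?_
    field_simp
    norm_num
  · have h6 : ‖μ * (laplaceTransform b z + z * laplaceTransform (fun t => t * b t) z)‖ ≤
        132 * μ * B := by
      rw [norm_mul, Complex.norm_real, norm_of_nonneg hμ.le]
      nlinarith
    refine (norm_div_sq_le h6 hq hQ).trans_eq ?_
    field_simp
    norm_num

theorem IsAdmissibleKernel.continuousOn (hb : IsAdmissibleKernel b) : ContinuousOn b (Ioi 0) :=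
  hb.differentiable.continuousOn

theorem IsAdmissibleKernel.integral_norm_symbolDeriv_le (hb : IsAdmissibleKernel b) (hμ : 0 < μ)
    (hc : 0 < c) (hr : 0 < r₀)
    (hsym : ∀ z : ℂ, 0 < z.re → c * (‖z‖ + μ * ‖laplaceTransform b z‖) ≤ ‖symbol b μ z‖)
    (hr₀ : μ * r₀ * mass b r₀ = 1 / 2) {σ : ℝ} (hσ : 0 < σ) (hσr : σ * r₀ ≤ 1) :
    ∫ ω : ℝ, ‖symbolDeriv b μ (σ + ω * Complex.I)‖ ≤ 25794 / c ^ 2 * r₀ ∧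
      ∫ ω : ℝ, ‖symbolDeriv₂ b μ (σ + ω * Complex.I)‖ ≤ 25476 / c ^ 2 := by
  set g := expWeight b σ with hg
  have hk := hb.isConvexKernel.expWeight hσ.le
  have hgi := hb.integrableOn_expWeight hσ
  have hgi1 := integrableOn_mul_expWeight hb.isConvexKernel hb.locallyIntegrable hσ
  -- The normalisation says that `b` has mass `1 / (2 μ r₀)` on `(0, r₀)`; for `σ r₀ ≤ 1` the weight
  -- costs at most the factor `3`.
  have hBr : 1 / (6 * μ * r₀) ≤ mass g r₀ := by
    have h1 := hb.mass_le_mul_mass_expWeight hσ hσr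
    have h2 : mass b r₀ = 1 / (2 * μ * r₀) := by
      field_simp; linarith
    rw [h2] at h1
    calc 1 / (6 * μ * r₀) = 1 / (2 * μ * r₀) / 3 := by field_simp; norm_num
      _ ≤ _ := by linarith
  have hB0 : 0 < mass g r₀ := hb.mass_expWeight_pos hr
  have hBinv : 1 / mass g r₀ ≤ 6 * μ * r₀ := by
    rw [div_le_iff₀ (by positivity)] at hBr ⊢
    linarith
  have hRinv : (0 : ℝ) < r₀⁻¹ := inv_pos.2 hr
  have hlow : ∀ ω : ℝ, 0 < ω → ω ≤ r₀⁻¹ →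
      0 < mass g ω⁻¹ ∧ 1 / mass g ω⁻¹ ≤ 6 * μ * r₀ := fun ω hω hωr => by
    have h1 : r₀ ≤ ω⁻¹ := by rwa [le_inv_comm₀ hr hω]
    have h2 : mass g r₀ ≤ mass g ω⁻¹ := VolterraResolvent.mass_mono hk.nonneg hgi h1
    exact ⟨hB0.trans_le h2, (one_div_le_one_div_of_le hB0 h2).trans hBinv⟩
  have hre : ∀ ω : ℝ, ((σ : ℂ) + ω * Complex.I).re = σ := fun ω => by simp
  have him : ∀ ω : ℝ, ((σ : ℂ) + ω * Complex.I).im = ω := fun ω => by simp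
  constructor
  · have hcont := (hb.differentiableOn_symbolDeriv hμ).continuousOn
    -- `12864 = 16 * (36 + 64 * 12)`. Adding the tail `33` and doubling gives `25794`; below, `12672
    -- = 2112 * 6`, and `2 * (12672 + 66) = 25476`.
    refine (integral_norm_line_le (M := 12864 / c ^ 2 * r₀) hcont
      symbolDeriv_conj hRinv (fun z hz hz' =>
        (hb.norm_symbolDeriv_le_of_high hμ hc hr hsym hr₀ hz hz').1) hσ ?_).trans_eq ?_
    · intro ε hε hεR
      obtain ⟨j1, j2⟩ := integral_moment_div_mass_sq_le hk.nonneg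
        (hb.continuousOn.mul (Continuous.continuousOn (by fun_prop))) hgi hgi1
        (fun r hr => hb.mass_expWeight_pos hr) hε hεR
      rw [inv_inv] at j2
      have hmono : ∫ ω in ε..r₀⁻¹, ‖symbolDeriv b μ (σ + ω * Complex.I)‖ ≤
          ∫ ω in ε..r₀⁻¹, 16 / (c ^ 2 * μ ^ 2) * ((6 * μ * r₀) ^ 2 +
            64 * μ * (moment g ω⁻¹ / mass g ω⁻¹ ^ 2)) := by
        refine intervalIntegral.integral_mono_on hεR
          ((continuous_comp_line hcont hσ).norm.intervalIntegrable _ _)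
          ((intervalIntegrable_const.add (j1.const_mul _)).const_mul _) fun ω hω => ?_
        have hω0 : 0 < ω := hε.trans_le hω.1
        have h1 := (hb.norm_symbolDeriv_le_of_low hμ hc hsym (z := σ + ω * Complex.I)
          (by rw [hre]; exact hσ) (by rw [him]; exact hω0.ne')).1
        rw [hre, him, abs_of_pos hω0] at h1
        refine h1.trans ?_
        obtain ⟨k1, k2⟩ := hlow ω hω0 hω.2
        have k3 : 1 / mass g ω⁻¹ ^ 2 ≤ (6 * μ * r₀) ^ 2 := by
          rw [← one_div_pow]
          exact pow_le_pow_left₀ (by positivity) k2 2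
        gcongr
      refine hmono.trans ?_
      rw [intervalIntegral.integral_const_mul, intervalIntegral.integral_add
        intervalIntegrable_const (j1.const_mul _), intervalIntegral.integral_const,
        intervalIntegral.integral_const_mul, smul_eq_mul]
      have k1 : (r₀⁻¹ - ε) * (6 * μ * r₀) ^ 2 ≤ r₀⁻¹ * (6 * μ * r₀) ^ 2 :=
        mul_le_mul_of_nonneg_right (by linarith) (by positivity)
      have k2 : 64 * μ * ∫ ω in ε..r₀⁻¹, moment g ω⁻¹ / mass g ω⁻¹ ^ 2 ≤
          64 * μ * (2 * (6 * μ * r₀)) := by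
        refine mul_le_mul_of_nonneg_left (j2.trans ?_) (by positivity)
        calc 2 / mass g r₀ = 2 * (1 / mass g r₀) := by ring
          _ ≤ _ := by linarith
      calc _ ≤ 16 / (c ^ 2 * μ ^ 2) * (r₀⁻¹ * (6 * μ * r₀) ^ 2 + 64 * μ * (2 * (6 * μ * r₀))) :=
            mul_le_mul_of_nonneg_left (add_le_add k1 k2) (by positivity)
        _ = 12864 / c ^ 2 * r₀ := by field_simp; norm_num
    · field_simp; norm_num
  · have hcont := (hb.differentiableOn_symbolDeriv₂ hμ).continuousOn
    refine (integral_norm_line_le (M := 12672 / c ^ 2) hcont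
      symbolDeriv₂_conj hRinv (fun z hz hz' =>
        (hb.norm_symbolDeriv_le_of_high hμ hc hr hsym hr₀ hz hz').2) hσ ?_).trans_eq ?_
    · intro ε hε hεR
      have hmono : ∫ ω in ε..r₀⁻¹, ‖symbolDeriv₂ b μ (σ + ω * Complex.I)‖ ≤
          ∫ _ in ε..r₀⁻¹, 12672 / c ^ 2 * r₀ := by
        refine intervalIntegral.integral_mono_on hεR
          ((continuous_comp_line hcont hσ).norm.intervalIntegrable _ _)
          intervalIntegrable_const fun ω hω => ?_
        have hω0 : 0 < ω := hε.trans_le hω.1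
        have h1 := (hb.norm_symbolDeriv_le_of_low hμ hc hsym (z := σ + ω * Complex.I)
          (by rw [hre]; exact hσ) (by rw [him]; exact hω0.ne')).2
        rw [hre, him, abs_of_pos hω0] at h1
        refine h1.trans ?_
        obtain ⟨k1, k2⟩ := hlow ω hω0 hω.2
        calc _ = 2112 / (c ^ 2 * μ) * (1 / mass g ω⁻¹) := by
              simp only [hg]; field_simp
          _ ≤ 2112 / (c ^ 2 * μ) * (6 * μ * r₀) := mul_le_mul_of_nonneg_left k2 (by positivity)
          _ = _ := by field_simp; norm_num
      refine hmono.trans ?_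
      rw [intervalIntegral.integral_const, smul_eq_mul]
      calc _ ≤ r₀⁻¹ * (12672 / c ^ 2 * r₀) :=
            mul_le_mul_of_nonneg_right (by linarith) (by positivity)
        _ = _ := by field_simp
    · field_simp; norm_num

end Symbols

end VolterraResolvent

namespace VolterraResolvent

/-! ### Laplace inversion and contour shift -/

section Inversion

open Real

/-- Moving a vertical line of integration. -/
theorem integral_line_eq_integral_line {G : ℂ → ℂ} {σ₁ σ₂ C R : ℝ}
    (hG : DifferentiableOn ℂ G {z | 0 < z.re}) (h1 : 0 < σ₁) (h12 : σ₁ ≤ σ₂)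
    (hd : ∀ z : ℂ, σ₁ ≤ z.re → z.re ≤ σ₂ → R ≤ |z.im| → ‖G z‖ ≤ C / z.im ^ 2)
    (hi1 : Integrable fun ω : ℝ => G (σ₁ + ω * Complex.I))
    (hi2 : Integrable fun ω : ℝ => G (σ₂ + ω * Complex.I)) :
    ∫ ω : ℝ, G (σ₁ + ω * Complex.I) = ∫ ω : ℝ, G (σ₂ + ω * Complex.I) := by
  -- Cauchy's theorem on a rectangle of height `2T`; the horizontal sides are `O(T⁻²)`.
  have hrect : ∀ T : ℝ, (∫ ω in (-T)..T, G (σ₂ + ω * Complex.I)) -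
      (∫ ω in (-T)..T, G (σ₁ + ω * Complex.I)) =
      Complex.I * ((∫ x in σ₁..σ₂, G (x + (-T : ℝ) * Complex.I)) -
        ∫ x in σ₁..σ₂, G (x + T * Complex.I)) := fun T => by
    have := Complex.integral_boundary_rect_eq_zero_of_differentiableOn G
      (σ₁ + (-T : ℝ) * Complex.I) (σ₂ + T * Complex.I) (hG.mono ?_)
    · simp only [Complex.add_re, Complex.add_im, Complex.ofReal_re, Complex.ofReal_im,
        Complex.mul_re, Complex.mul_im, Complex.I_re, Complex.I_im, mul_zero, mul_one, sub_zero,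
        add_zero, zero_add, smul_eq_mul] at this
      linear_combination (-Complex.I) * this +
        ((∫ ω in (-T)..T, G (σ₂ + ω * Complex.I)) -
          (∫ ω in (-T)..T, G (σ₁ + ω * Complex.I))) * Complex.I_sq
    · intro z hz
      rw [Complex.mem_reProdIm] at hz
      have := hz.1
      simp only [Complex.add_re, Complex.ofReal_re, Complex.mul_re, Complex.I_re, mul_zero,
        Complex.ofReal_im, Complex.I_im, mul_one, sub_zero, add_zero, uIcc_of_le h12] at this
      exact h1.trans_le this.1
  have hv : Tendsto (fun T : ℝ => (∫ ω in (-T)..T, G (σ₂ + ω * Complex.I)) -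
      (∫ ω in (-T)..T, G (σ₁ + ω * Complex.I))) atTop
      (𝓝 ((∫ ω : ℝ, G (σ₂ + ω * Complex.I)) - ∫ ω : ℝ, G (σ₁ + ω * Complex.I))) :=
    (intervalIntegral_tendsto_integral hi2 tendsto_neg_atTop_atBot tendsto_id).sub
      (intervalIntegral_tendsto_integral hi1 tendsto_neg_atTop_atBot tendsto_id)
  have hh : Tendsto (fun T : ℝ => (∫ ω in (-T)..T, G (σ₂ + ω * Complex.I)) -
      (∫ ω in (-T)..T, G (σ₁ + ω * Complex.I))) atTop (𝓝 0) := by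
    refine squeeze_zero_norm' (a := fun T : ℝ => 2 * C * (σ₂ - σ₁) / T ^ 2) ?_ ?_
    · filter_upwards [eventually_ge_atTop (max R 1)] with T hT
      have hT1 : 1 ≤ T := (le_max_right _ _).trans hT
      have hTR : R ≤ T := (le_max_left _ _).trans hT
      have hb : ∀ S : ℝ, |S| = T → ‖∫ x in σ₁..σ₂, G (x + S * Complex.I)‖ ≤
          C / T ^ 2 * (σ₂ - σ₁) := fun S hS => by
        have := intervalIntegral.norm_integral_le_of_norm_le_const (a := σ₁) (b := σ₂)
          (f := fun x : ℝ => G (x + S * Complex.I)) (C := C / T ^ 2) fun x hx => by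
            rw [uIoc_of_le h12] at hx
            have := hd (x + S * Complex.I) (by simpa using hx.1.le) (by simpa using hx.2)
              (by simpa [hS] using hTR)
            rw [← hS, sq_abs]
            simpa using this
        rwa [abs_of_nonneg (by linarith)] at this
      rw [hrect T, norm_mul, Complex.norm_I, one_mul]
      refine (norm_sub_le _ _).trans ((add_le_add (hb (-T) ?_) (hb T ?_)).trans_eq ?_)
      · rw [abs_neg, abs_of_pos (by linarith)]
      · rw [abs_of_pos (by linarith)]
      · ring
    · exact tendsto_const_nhds.div_atTop (tendsto_pow_atTop two_ne_zero)
  exact (sub_eq_zero.1 (tendsto_nhds_unique hv hh)).symm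

/-- Fourier inversion for `f(t) e^{-σt}` extended by zero to the left, with the frequency rescaled
by `2 π`. -/
theorem eq_integral_line_of_laplaceTransform {f : ℝ → ℝ} {F : ℂ → ℂ} {σ t : ℝ}
    (hfi : IntegrableOn (expWeight f σ) (Ioi 0))
    (hL : ∀ ω : ℝ, laplaceTransform f (σ + ω * Complex.I) = F (σ + ω * Complex.I))
    (hi : Integrable fun ω : ℝ => F (σ + ω * Complex.I)) (ht : 0 < t) (hct : ContinuousAt f t) :
    2 * π * (f t : ℂ) =
      ∫ ω : ℝ, Complex.exp ((σ + ω * Complex.I) * t) * F (σ + ω * Complex.I) := by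
  have hpi := two_pi_pos
  set h : ℝ → ℂ := (Ioi 0).indicator fun t => ((expWeight f σ t : ℝ) : ℂ) with hh
  have hhi : Integrable h := (integrable_indicator_iff measurableSet_Ioi).2
    (Integrable.ofReal (𝕜 := ℂ) hfi)
  have hfour : ∀ ξ : ℝ, FourierTransform.fourier h ξ = F (σ + (ξ * (2 * π) : ℝ) * Complex.I) := fun ξ => by
    rw [Real.fourier_real_eq_integral_exp_smul, ← hL, laplaceTransform,
      ← integral_indicator measurableSet_Ioi]
    congr 1 with s
    by_cases hs : s ∈ Ioi (0 : ℝ)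
    · simp only [hh, indicator_of_mem hs, expWeight, smul_eq_mul]
      push_cast
      rw [mul_comm, mul_assoc, ← Complex.exp_add]
      congr 2; ring
    · simp [hh, indicator_of_notMem hs]
  have hfi' : Integrable (FourierTransform.fourier h) := by
    have : FourierTransform.fourier h =
        fun ξ : ℝ => (fun ω : ℝ => F (σ + ω * Complex.I)) (ξ * (2 * π)) := funext hfour
    rw [this]
    exact hi.comp_mul_right' hpi.ne'
  have hcont : ContinuousAt h t := by
    have h1 : ContinuousAt (fun t => ((expWeight f σ t : ℝ) : ℂ)) t :=
      Complex.continuous_ofReal.continuousAt.comp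
        (hct.mul (Continuous.continuousAt (by fun_prop)))
    refine h1.congr ?_
    filter_upwards [Ioi_mem_nhds ht] with s hs
    simp only [hh, indicator_of_mem hs]
  have hinv := hhi.fourierInv_fourier_eq hfi' hcont
  rw [Real.fourierInv_eq'] at hinv
  have e1 : (∫ ξ : ℝ, Complex.exp (2 * π * (ξ * t : ℝ) * Complex.I) *
      F (σ + (ξ * (2 * π) : ℝ) * Complex.I)) = f t * Complex.exp (-σ * t) := by
    have : h t = f t * Complex.exp (-σ * t) := by
      simp only [hh, indicator_of_mem (show t ∈ Ioi (0 : ℝ) from ht), expWeight]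
      push_cast; rfl
    rw [← this, ← hinv]
    congr 1 with ξ
    rw [hfour, smul_eq_mul]
    congr 2
    simp
    ring
  have e2 := Measure.integral_comp_mul_right
    (fun ω : ℝ => Complex.exp (ω * t * Complex.I) * F (σ + ω * Complex.I)) (2 * π)
  have e3 : ∀ ξ : ℝ, (fun ω : ℝ => Complex.exp (ω * t * Complex.I) * F (σ + ω * Complex.I))
      (ξ * (2 * π)) = Complex.exp (2 * π * (ξ * t : ℝ) * Complex.I) *
      F (σ + (ξ * (2 * π) : ℝ) * Complex.I) := fun ξ => by
    simp only
    congr 2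
    push_cast; ring
  simp_rw [e3] at e2
  rw [e1, abs_of_pos (inv_pos.2 hpi), Complex.real_smul] at e2
  have e4 : ∫ ω : ℝ, Complex.exp ((σ + ω * Complex.I) * t) * F (σ + ω * Complex.I) =
      Complex.exp (σ * t) * ∫ ω : ℝ, Complex.exp (ω * t * Complex.I) * F (σ + ω * Complex.I) := by
    rw [← integral_const_mul]
    congr 1 with ω
    rw [← mul_assoc, ← Complex.exp_add]
    congr 2; ring
  have e5 : Complex.exp (σ * t) * Complex.exp (-σ * t) = 1 := by
    rw [← Complex.exp_add]; simp
  have hpi' : (2 * π : ℂ) ≠ 0 := by exact_mod_cast hpi.ne'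
  rw [e4]
  push_cast at e2
  rw [eq_inv_mul_iff_mul_eq₀ hpi'] at e2
  rw [← e2]
  linear_combination (-(2 * π * (f t : ℂ))) * e5

/-- The transform of `f` is known only for `Re z > K`, so inversion happens far to the right. The
line is then moved to any `σ > 0`, where only holomorphy and decay of `F` are needed. -/
theorem abs_le_of_laplaceTransform {f : ℝ → ℝ} {F : ℂ → ℂ} {C R K : ℝ}
    (hF : DifferentiableOn ℂ F {z | 0 < z.re}) (hR : 0 < R)
    (hd : ∀ z : ℂ, 0 < z.re → R ≤ |z.im| → ‖F z‖ ≤ C / z.im ^ 2)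
    (hfi : ∀ σ, K < σ → IntegrableOn (expWeight f σ) (Ioi 0))
    (hL : ∀ z : ℂ, 0 < z.re → K < z.re → laplaceTransform f z = F z) {t : ℝ} (ht : 0 < t)
    (hct : ContinuousAt f t) {σ : ℝ} (hσ : 0 < σ) :
    |f t| ≤ exp (σ * t) * ∫ ω : ℝ, ‖F (σ + ω * Complex.I)‖ := by
  set σ₂ := max K σ + 1
  have h2 : σ ≤ σ₂ := (le_max_right K σ).trans (by simp [σ₂])
  have h3 : K < σ₂ := (le_max_left K σ).trans_lt (by simp [σ₂])
  have hσ₂ : 0 < σ₂ := by linarith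
  set G : ℂ → ℂ := fun z => Complex.exp (z * t) * F z with hG
  have hGd : DifferentiableOn ℂ G {z | 0 < z.re} :=
    (DifferentiableOn.cexp (differentiableOn_id.mul_const _)).mul hF
  have hnorm : ∀ z : ℂ, ‖G z‖ = exp (z.re * t) * ‖F z‖ := fun z => by
    rw [hG, norm_mul, Complex.norm_exp]; simp
  have hnormline : ∀ s ω : ℝ, ‖G (s + ω * Complex.I)‖ = exp (s * t) * ‖F (s + ω * Complex.I)‖ :=
    fun s ω => by rw [hnorm]; simp
  have hint : ∀ s : ℝ, 0 < s → Integrable fun ω : ℝ => G (s + ω * Complex.I) := fun s hs => by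
    have h4 := (integrable_comp_line hF.continuousOn hR hd hs).norm.const_mul (exp (s * t))
    refine h4.mono' (continuous_comp_line hGd.continuousOn hs).aestronglyMeasurable
      (ae_of_all _ fun ω => (hnormline s ω).le)
  have hshift := integral_line_eq_integral_line (C := exp (σ₂ * t) * C) (R := R) hGd hσ h2
    (fun z hz1 hz2 hz3 => ?_) (hint σ hσ) (hint σ₂ hσ₂)
  · have key := eq_integral_line_of_laplaceTransform (hfi σ₂ h3)
      (fun ω => hL _ (by simpa using hσ₂) (by simpa using h3))
      (integrable_comp_line hF.continuousOn hR hd hσ₂) ht hct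
    rw [← hshift] at key
    have h5 := norm_integral_le_integral_norm (μ := volume) fun ω : ℝ => G (σ + ω * Complex.I)
    rw [← key] at h5
    simp_rw [hnormline] at h5
    rw [integral_const_mul] at h5
    have h6 : ‖(2 * π * (f t : ℂ))‖ = 2 * π * |f t| := by
      rw [norm_mul, Complex.norm_real, norm_eq_abs]
      simp [abs_of_pos pi_pos]
    rw [h6] at h5
    nlinarith [pi_gt_three, abs_nonneg (f t)]
  · rw [hnorm, mul_div_assoc]
    exact mul_le_mul (exp_le_exp.2 (mul_le_mul_of_nonneg_right hz2 ht.le))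
      (hd z (hσ.trans_le hz1) hz3) (norm_nonneg _) (exp_pos _).le

end Inversion

end VolterraResolvent

namespace VolterraResolvent

/-! ### The scalar Volterra equation -/

section Scalar

open Real

variable {b φ : ℝ → ℝ} {μ a : ℝ}

/-- The convolution `∫₀ᵗ b(t - s) φ(s) ds`. -/
noncomputable def volterra (b φ : ℝ → ℝ) (t : ℝ) : ℝ := ∫ s in (0 : ℝ)..t, b (t - s) * φ s

/-- `φ' + μ b * φ = 0` on `(0, ∞)` and `φ(0) = a`. -/
structure IsScalarSolution (b : ℝ → ℝ) (μ a : ℝ) (φ : ℝ → ℝ) : Prop where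
  continuousOn : ContinuousOn φ (Ici 0)
  zero : φ 0 = a
  hasDerivAt : ∀ t, 0 < t → HasDerivAt φ (-μ * volterra b φ t) t

theorem volterra_eq (b φ : ℝ → ℝ) (t : ℝ) :
    volterra b φ t = ∫ s in (0 : ℝ)..t, b s * φ (t - s) := by
  have := intervalIntegral.integral_comp_sub_left (a := 0) (b := t) (fun s => b s * φ (t - s)) t
  simp only [sub_sub_cancel, sub_self, sub_zero] at this
  exact this

theorem IsAdmissibleKernel.abs_volterra_le (hb : IsAdmissibleKernel b) {M t : ℝ} (ht : 0 ≤ t)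
    (hM : ∀ s ∈ Icc 0 t, |φ s| ≤ M) : |volterra b φ t| ≤ M * mass b t := by
  have hbi := integrableOn_Ioc_of_locallyIntegrableOn hb.locallyIntegrable t
  rw [volterra_eq, mass, ← intervalIntegral.integral_of_le ht,
    ← intervalIntegral.integral_const_mul, ← norm_eq_abs]
  refine intervalIntegral.norm_integral_le_of_norm_le ht (ae_of_all _ fun s hs => ?_)
    (((intervalIntegrable_iff_integrableOn_Ioc_of_le ht).2 hbi).const_mul M)
  rw [norm_mul, norm_of_nonneg (hb.nonneg s hs.1), mul_comm]
  exact mul_le_mul_of_nonneg_right (hM _ ⟨by linarith [hs.2], by linarith [hs.1]⟩)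
    (hb.nonneg s hs.1)

/-- At a maximum point `t₁` of `|φ|` on `[0, r]`, the mean value theorem gives `|φ(t₁) - a| ≤ μ r
(∫₀ʳ b) |φ(t₁)| ≤ |φ(t₁)| / 2`. -/
theorem IsScalarSolution.abs_le_two_mul (hφ : IsScalarSolution b μ a φ)
    (hb : IsAdmissibleKernel b) (hμ : 0 < μ) {r t : ℝ} (hr : μ * r * mass b r ≤ 1 / 2)
    (ht : 0 ≤ t) (htr : t ≤ r) : |φ t| ≤ 2 * |a| := by
  have hr0 : 0 ≤ r := ht.trans htr
  obtain ⟨t₁, ht₁, hmax⟩ := isCompact_Icc.exists_isMaxOn (nonempty_Icc.2 hr0)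
    (hφ.continuousOn.mono (fun _ hx => hx.1 : Icc 0 r ⊆ Ici 0)).abs
  refine (hmax ⟨ht, htr⟩).trans ?_
  rcases ht₁.1.eq_or_lt with h | h
  · rw [← h]
    change |φ 0| ≤ _
    rw [hφ.zero]; linarith [abs_nonneg a]
  · obtain ⟨c, hc, hslope⟩ := exists_hasDerivAt_eq_slope φ _ h
      (hφ.continuousOn.mono fun _ hx => hx.1) fun x hx => hφ.hasDerivAt x hx.1
    rw [eq_div_iff (by linarith), hφ.zero, sub_zero] at hslope
    have h1 : |volterra b φ c| ≤ |φ t₁| * mass b r := by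
      refine (hb.abs_volterra_le hc.1.le fun s hs => hmax ⟨hs.1, by linarith [hs.2, hc.2, ht₁.2]⟩).trans ?_
      exact mul_le_mul_of_nonneg_left (hb.mass_mono (by linarith [hc.2, ht₁.2])) (abs_nonneg _)
    have h2 : |φ t₁ - a| ≤ 1 / 2 * |φ t₁| := by
      rw [← hslope, abs_mul, abs_mul, abs_neg, abs_of_pos hμ, abs_of_pos h]
      have h3 : 0 ≤ μ * |φ t₁| * mass b r :=
        mul_nonneg (by positivity) (mass_nonneg hb.nonneg r)
      calc μ * |volterra b φ c| * t₁ ≤ μ * (|φ t₁| * mass b r) * t₁ := by gcongr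
        _ = μ * |φ t₁| * mass b r * t₁ := by ring
        _ ≤ μ * |φ t₁| * mass b r * r := mul_le_mul_of_nonneg_left ht₁.2 h3
        _ = μ * r * mass b r * |φ t₁| := by ring
        _ ≤ _ := mul_le_mul_of_nonneg_right hr (abs_nonneg _)
    have h3 := abs_sub_abs_le_abs_sub (φ t₁) a
    linarith

theorem IsAdmissibleKernel.exists_rate (hb : IsAdmissibleKernel b) (hμ : 0 < μ) :
    ∃ K : ℝ, 0 < K ∧ μ * (∫ t in Ioi 0, expWeight b K t) ≤ K / 2 := by
  set K := max 1 (2 * μ * ∫ t in Ioi 0, expWeight b 1 t)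
  have h1 : 1 ≤ K := le_max_left _ _
  have h2 : 2 * μ * (∫ t in Ioi 0, expWeight b 1 t) ≤ K := le_max_right _ _
  refine ⟨K, by linarith, ?_⟩
  have h3 : ∫ t in Ioi 0, expWeight b K t ≤ ∫ t in Ioi 0, expWeight b 1 t := by
    refine setIntegral_mono_on (hb.integrableOn_expWeight (by linarith))
      (hb.integrableOn_expWeight one_pos) measurableSet_Ioi fun t ht => ?_
    have ht : 0 < t := ht
    exact mul_le_mul_of_nonneg_left (exp_le_exp.2 (by nlinarith)) (hb.nonneg t ht)
  nlinarith

/-- The same maximum argument for `|φ| e^{-Kt}`, with Cauchy's mean value theorem against `e^{Kt}`.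
This crude growth bound serves only to make the Laplace transforms converge. -/
theorem IsScalarSolution.abs_le_exp (hφ : IsScalarSolution b μ a φ)
    (hb : IsAdmissibleKernel b) (hμ : 0 < μ) {K : ℝ} (hK : 0 < K)
    (hKb : μ * (∫ t in Ioi 0, expWeight b K t) ≤ K / 2) {t : ℝ} (ht : 0 ≤ t) :
    |φ t| ≤ 2 * |a| * exp (K * t) := by
  obtain ⟨t₁, ht₁, hmax⟩ := isCompact_Icc.exists_isMaxOn (nonempty_Icc.2 ht)
    ((hφ.continuousOn.mono (fun _ hx => hx.1 : Icc 0 t ⊆ Ici 0)).abs.mul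
      (Continuous.continuousOn (by fun_prop : Continuous fun t => exp (-K * t))))
  set M := |φ t₁| * exp (-K * t₁) with hM
  have hM0 : 0 ≤ M := by positivity
  have hexp : ∀ s, exp (-K * s) * exp (K * s) = 1 := fun s => by rw [← exp_add]; simp
  have hle : ∀ s ∈ Icc 0 t, |φ s| ≤ M * exp (K * s) := fun s hs => by
    have : |φ s| * exp (-K * s) ≤ M := hmax hs
    calc |φ s| = |φ s| * exp (-K * s) * exp (K * s) := by rw [mul_assoc, hexp, mul_one]
      _ ≤ _ := mul_le_mul_of_nonneg_right this (exp_pos _).le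
  suffices M ≤ 2 * |a| from
    (hle t ⟨ht, le_rfl⟩).trans (mul_le_mul_of_nonneg_right this (exp_pos _).le)
  rcases ht₁.1.eq_or_lt with h | h
  · rw [hM, ← h, hφ.zero]; simp only [mul_zero, exp_zero, mul_one]; linarith [abs_nonneg a]
  · have hE : ∀ s : ℝ, HasDerivAt (fun s => exp (K * s)) (exp (K * s) * K) s := fun s => by
      simpa using ((hasDerivAt_id s).const_mul K).exp
    obtain ⟨c, hc, hslope⟩ := exists_ratio_hasDerivAt_eq_ratio_slope φ _ h
      (hφ.continuousOn.mono fun _ hx => hx.1) (fun x hx => hφ.hasDerivAt x hx.1)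
      (fun s => exp (K * s)) _ (Continuous.continuousOn (by fun_prop)) (fun s _ => hE s)
    rw [mul_zero, exp_zero, hφ.zero] at hslope
    have hct : c ≤ t := hc.2.le.trans ht₁.2
    have h1 : |volterra b φ c| ≤ M * exp (K * c) * ∫ t in Ioi 0, expWeight b K t := by
      rw [volterra_eq]
      have hbi := hb.integrableOn_expWeight hK
      have hbc : IntervalIntegrable (expWeight b K) volume 0 c :=
        (intervalIntegrable_iff_integrableOn_Ioc_of_le hc.1.le).2 (hbi.mono_set fun _ hx => hx.1)
      have h2 := intervalIntegral.norm_integral_le_of_norm_le hc.1.le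
        (f := fun s => b s * φ (c - s))
        (ae_of_all _ fun s hs => ?_) (hbc.const_mul (M * exp (K * c)))
      · refine h2.trans ?_
        rw [intervalIntegral.integral_const_mul, intervalIntegral.integral_of_le hc.1.le]
        refine mul_le_mul_of_nonneg_left ?_ (by positivity)
        exact setIntegral_mono_set hbi ((ae_restrict_iff' measurableSet_Ioi).2
          (ae_of_all _ fun t ht => mul_nonneg (hb.nonneg t ht) (exp_pos _).le))
          (LE.le.eventuallyLE fun t ht => ht.1)
      · have h3 := hle (c - s) ⟨by linarith [hs.2], by linarith [hs.1]⟩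
        have h4 := hb.nonneg s hs.1
        rw [norm_mul, norm_of_nonneg h4, norm_eq_abs, expWeight]
        calc b s * |φ (c - s)| ≤ b s * (M * exp (K * (c - s))) := mul_le_mul_of_nonneg_left h3 h4
          _ = _ := by
            rw [show K * (c - s) = K * c + -K * s by ring, exp_add]; ring
    have hEt : 0 ≤ exp (K * t₁) - 1 := sub_nonneg.2 (one_le_exp (by positivity))
    have h5 : |φ t₁ - a| * (exp (K * c) * K) ≤
        (exp (K * t₁) - 1) * (M * exp (K * c) * (K / 2)) := by
      have e1 : |φ t₁ - a| * (exp (K * c) * K) = |(φ t₁ - a) * (exp (K * c) * K)| := by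
        rw [abs_mul, abs_of_pos (by positivity : 0 < exp (K * c) * K)]
      rw [e1, ← hslope, abs_mul, abs_of_nonneg hEt, abs_mul, abs_neg, abs_of_pos hμ]
      refine mul_le_mul_of_nonneg_left ?_ hEt
      calc μ * |volterra b φ c| ≤ μ * (M * exp (K * c) * ∫ t in Ioi 0, expWeight b K t) := by
            gcongr
        _ = M * exp (K * c) * (μ * ∫ t in Ioi 0, expWeight b K t) := by ring
        _ ≤ _ := mul_le_mul_of_nonneg_left hKb (by positivity)
    have h6 : |φ t₁ - a| ≤ (exp (K * t₁) - 1) * M / 2 := by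
      have hp : 0 < exp (K * c) * K := by positivity
      refine le_of_mul_le_mul_right (h5.trans_eq ?_) hp
      ring
    have h7 : |φ t₁| = M * exp (K * t₁) := by rw [hM, mul_assoc, hexp, mul_one]
    have h8 := abs_sub_abs_le_abs_sub (φ t₁) a
    have h9 : 1 ≤ exp (K * t₁) := by linarith
    have h10 : M * exp (K * t₁) ≤ 2 * |a| := by nlinarith
    nlinarith

/-- Dominated convergence with the moving endpoint written as an indicator on a fixed interval. The
indicator is continuous in `t` except at `s = t₀`, a null set. -/
theorem IsScalarSolution.continuousAt_volterra (hφ : IsScalarSolution b μ a φ)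
    (hb : IsAdmissibleKernel b) {t₀ : ℝ} (ht₀ : 0 < t₀) : ContinuousAt (volterra b φ) t₀ := by
  set ψ : ℝ → ℝ := fun t => φ (max t 0) with hψ
  have hψc : Continuous ψ := hφ.continuousOn.comp_continuous (by fun_prop) fun t => le_max_right t 0
  obtain ⟨M, hM⟩ := isCompact_Icc.exists_bound_of_continuousOn (s := Icc (-2) (t₀ + 1))
    hψc.continuousOn
  have hbi := integrableOn_Ioc_of_locallyIntegrableOn hb.locallyIntegrable (t₀ + 1)
  have hcont : ContinuousAt (fun t => ∫ s in Ioc 0 (t₀ + 1),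
      (Iio t).indicator (fun s => b s * ψ (t - s)) s) t₀ := by
    refine continuousAt_of_dominated (bound := fun s => |b s| * M) ?_ ?_
      (hbi.abs.mul_const M) ?_
    · refine Eventually.of_forall fun t => AEStronglyMeasurable.indicator ?_ measurableSet_Iio
      exact hbi.aestronglyMeasurable.mul (Continuous.aestronglyMeasurable (by fun_prop))
    · filter_upwards [Metric.ball_mem_nhds t₀ one_pos] with t ht
      rw [ball_eq_Ioo] at ht
      refine (ae_restrict_iff' measurableSet_Ioc).2 (ae_of_all _ fun s hs => ?_)
      refine (norm_indicator_le_norm_self _ _).trans ?_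
      rw [norm_mul]
      refine mul_le_mul_of_nonneg_left (hM _ ⟨?_, ?_⟩) (abs_nonneg _)
      · linarith [hs.2, ht.1]
      · linarith [hs.1, ht.2]
    · have : ∀ᵐ s ∂(volume.restrict (Ioc 0 (t₀ + 1))), s ≠ t₀ :=
        ae_restrict_of_ae (Measure.ae_ne volume t₀)
      filter_upwards [this] with s hs
      rcases lt_or_gt_of_ne hs with h | h
      · have h1 : ContinuousAt (fun t => b s * ψ (t - s)) t₀ :=
          Continuous.continuousAt (by fun_prop)
        refine h1.congr ?_
        filter_upwards [Ioi_mem_nhds h] with t ht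
        rw [indicator_of_mem (show s ∈ Iio t from ht)]
      · refine (continuousAt_const (y := (0 : ℝ))).congr ?_
        filter_upwards [Iio_mem_nhds h] with t ht
        have h' : s ∉ Iio t := fun h' => lt_asymm (show s < t from h') ht
        rw [indicator_of_notMem h']
  refine hcont.congr ?_
  filter_upwards [Ioo_mem_nhds ht₀ (lt_add_one t₀)] with t ht
  rw [volterra_eq, intervalIntegral.integral_of_le ht.1.le, setIntegral_indicator measurableSet_Iio]
  have : Ioc 0 (t₀ + 1) ∩ Iio t = Ioo 0 t := by
    ext s; simp only [mem_inter_iff, mem_Ioc, mem_Iio, mem_Ioo]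
    exact ⟨fun h => ⟨h.1.1, h.2⟩, fun h => ⟨⟨h.1, by linarith [h.2, ht.2]⟩, h.2⟩⟩
  rw [this, integral_Ioc_eq_integral_Ioo]
  refine setIntegral_congr_fun measurableSet_Ioo fun s hs => ?_
  simp only [hψ, max_eq_left (sub_nonneg.2 hs.2.le)]

theorem integrableOn_expWeight_of_abs_le_exp {f : ℝ → ℝ} {A K σ : ℝ}
    (hm : AEStronglyMeasurable f (volume.restrict (Ioi 0)))
    (hf : ∀ t, 0 < t → |f t| ≤ A * exp (K * t)) (hσ : K < σ) :
    IntegrableOn (expWeight f σ) (Ioi 0) := by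
  have h1 := (integrableOn_pow_mul_exp_neg 0 (sub_pos.2 hσ)).const_mul A
  refine h1.mono' (hm.mul (Continuous.aestronglyMeasurable (by fun_prop)))
    ((ae_restrict_iff' measurableSet_Ioi).2 (ae_of_all _ fun t ht => ?_))
  rw [expWeight, norm_mul, norm_eq_abs, norm_of_nonneg (exp_pos _).le, pow_zero, one_mul,
    show -(σ - K) * t = K * t + -σ * t by ring, exp_add, ← mul_assoc]
  exact mul_le_mul_of_nonneg_right (hf t ht) (exp_pos _).le

theorem expWeight_volterra (b φ : ℝ → ℝ) (σ t : ℝ) :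
    expWeight (volterra b φ) σ t =
      ∫ s in (0 : ℝ)..t, expWeight b σ s * expWeight φ σ (t - s) := by
  rw [expWeight, volterra_eq, ← intervalIntegral.integral_mul_const]
  congr 1 with s
  simp only [expWeight]
  rw [show -σ * t = -σ * s + -σ * (t - s) by ring, exp_add]
  ring

theorem integrableOn_expWeight_volterra {σ : ℝ} (hb : IntegrableOn (expWeight b σ) (Ioi 0))
    (hφ : IntegrableOn (expWeight φ σ) (Ioi 0)) :
    IntegrableOn (expWeight (volterra b φ) σ) (Ioi 0) := by
  have h := integrable_posConvolution hb hφ (ContinuousLinearMap.mul ℝ ℝ)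
  refine (h.integrableOn (s := Ioi 0)).congr_fun (fun t ht => ?_) measurableSet_Ioi
  rw [posConvolution, indicator_of_mem ht, expWeight_volterra]
  rfl

theorem laplaceTransform_volterra {z : ℂ} (hb : IntegrableOn (expWeight b z.re) (Ioi 0))
    (hφ : IntegrableOn (expWeight φ z.re) (Ioi 0)) :
    laplaceTransform (volterra b φ) z = laplaceTransform b z * laplaceTransform φ z := by
  have h := integral_posConvolution (integrableOn_mul_exp_neg_mul hb)
    (integrableOn_mul_exp_neg_mul hφ) (ContinuousLinearMap.mul ℝ ℂ)
  rw [laplaceTransform, laplaceTransform, laplaceTransform]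
  refine Eq.trans ?_ h
  congr 1 with t
  rw [volterra_eq, ← intervalIntegral.integral_ofReal, ← intervalIntegral.integral_mul_const]
  congr 1 with s
  rw [ContinuousLinearMap.mul_apply', show -z * (t : ℂ) = -z * s + -z * ((t - s : ℝ) : ℂ) by
    push_cast; ring, Complex.exp_add]
  push_cast
  ring

section Transforms

variable {K : ℝ}

theorem IsScalarSolution.aestronglyMeasurable (hφ : IsScalarSolution b μ a φ) :
    AEStronglyMeasurable φ (volume.restrict (Ioi 0)) :=
  (hφ.continuousOn.mono Ioi_subset_Ici_self).aestronglyMeasurable measurableSet_Ioi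

theorem IsScalarSolution.integrableOn_expWeight (hφ : IsScalarSolution b μ a φ)
    (hb : IsAdmissibleKernel b) (hμ : 0 < μ) (hK : 0 < K)
    (hKb : μ * (∫ t in Ioi 0, expWeight b K t) ≤ K / 2) {σ : ℝ} (hσ : K < σ) :
    IntegrableOn (expWeight φ σ) (Ioi 0) :=
  integrableOn_expWeight_of_abs_le_exp hφ.aestronglyMeasurable
    (fun _ ht => hφ.abs_le_exp hb hμ hK hKb (le_of_lt ht)) hσ

/-- Integrate the derivative of `φ(t) e^{-zt}` over the half-line: the boundary value at `0` is `a`,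
and the one at infinity vanishes by the growth bound. -/
theorem IsScalarSolution.laplaceTransform_mul_symbol (hφ : IsScalarSolution b μ a φ)
    (hb : IsAdmissibleKernel b) (hμ : 0 < μ) (hK : 0 < K)
    (hKb : μ * (∫ t in Ioi 0, expWeight b K t) ≤ K / 2) {z : ℂ} (hz : K < z.re) :
    laplaceTransform φ z * symbol b μ z = a := by
  have hbi := hb.integrableOn_expWeight (hK.trans hz)
  have hφi := hφ.integrableOn_expWeight hb hμ hK hKb hz
  have hv := integrableOn_expWeight_volterra hbi hφi
  have i1 := (integrableOn_mul_exp_neg_mul hv).const_mul (-(μ : ℂ))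
  have i2 := (integrableOn_mul_exp_neg_mul hφi).const_mul (-z)
  have hd : ∀ t ∈ Ioi (0 : ℝ), HasDerivAt (fun t : ℝ => (φ t : ℂ) * Complex.exp (-z * t))
      (-(μ : ℂ) * ((volterra b φ t : ℂ) * Complex.exp (-z * t)) +
        -z * ((φ t : ℂ) * Complex.exp (-z * t))) t := fun t ht => by
    have h1 := (hφ.hasDerivAt t ht).ofReal_comp
    have h2 : HasDerivAt (fun t : ℝ => Complex.exp (-z * t)) (Complex.exp (-z * t) * -z) t := by
      have : HasDerivAt (fun t : ℝ => -z * (t : ℂ)) (-z) t := by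
        simpa using (Complex.ofRealCLM.hasDerivAt (x := t)).const_mul (-z)
      exact this.cexp
    refine (h1.mul h2).congr_deriv ?_
    push_cast; ring
  have hc : ContinuousWithinAt (fun t : ℝ => (φ t : ℂ) * Complex.exp (-z * t)) (Ici 0) 0 :=
    (Complex.continuous_ofReal.continuousAt.comp_continuousWithinAt
      (hφ.continuousOn 0 self_mem_Ici)).mul (Continuous.continuousWithinAt (by fun_prop))
  have hlim : Tendsto (fun t : ℝ => (φ t : ℂ) * Complex.exp (-z * t)) atTop (𝓝 0) := by
    refine squeeze_zero_norm' (a := fun t => 2 * |a| * exp (-((z.re - K) * t))) ?_ ?_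
    · filter_upwards [eventually_ge_atTop 0] with t ht
      rw [norm_mul_exp_neg_mul, expWeight, abs_mul, abs_exp]
      calc |φ t| * exp (-z.re * t) ≤ 2 * |a| * exp (K * t) * exp (-z.re * t) :=
            mul_le_mul_of_nonneg_right (hφ.abs_le_exp hb hμ hK hKb ht) (exp_pos _).le
        _ = _ := by rw [mul_assoc, ← exp_add]; congr 2; ring
    · rw [← mul_zero (2 * |a|)]
      refine Tendsto.const_mul _ ?_
      exact tendsto_exp_neg_atTop_nhds_zero.comp
        (tendsto_id.const_mul_atTop (sub_pos.2 hz))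
  have key := integral_Ioi_of_hasDerivAt_of_tendsto hc hd (i1.add i2) hlim
  have e : ∫ t in Ioi (0 : ℝ), (-(μ : ℂ) * ((volterra b φ t : ℂ) * Complex.exp (-z * t)) +
        -z * ((φ t : ℂ) * Complex.exp (-z * t))) =
      -(μ : ℂ) * laplaceTransform (volterra b φ) z + -z * laplaceTransform φ z := by
    rw [laplaceTransform, laplaceTransform, ← integral_const_mul, ← integral_const_mul]
    exact integral_add i1 i2
  rw [e, laplaceTransform_volterra hbi hφi, hφ.zero] at key
  simp only [Complex.ofReal_zero, mul_zero, Complex.exp_zero, mul_one] at key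
  rw [symbol]
  linear_combination -key

theorem IsScalarSolution.laplaceTransform_eq (hφ : IsScalarSolution b μ a φ)
    (hb : IsAdmissibleKernel b) (hμ : 0 < μ) (hK : 0 < K)
    (hKb : μ * (∫ t in Ioi 0, expWeight b K t) ≤ K / 2) {z : ℂ} (hz : K < z.re) :
    laplaceTransform φ z = a / symbol b μ z := by
  rw [eq_div_iff (hb.symbol_ne_zero hμ (hK.trans hz))]
  exact hφ.laplaceTransform_mul_symbol hb hμ hK hKb hz

theorem eventually_lt_re {z : ℂ} (hz : K < z.re) : ∀ᶠ w in 𝓝 z, K < w.re :=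
  (isOpen_lt continuous_const Complex.continuous_re).mem_nhds hz

/-- Multiplication by `t` is `-d/dz`. It improves the decay of the transform on vertical lines from
`|Im z|⁻¹` to `|Im z|⁻²`, making it absolutely integrable. -/
theorem IsScalarSolution.laplaceTransform_id_mul (hφ : IsScalarSolution b μ a φ)
    (hb : IsAdmissibleKernel b) (hμ : 0 < μ) (hK : 0 < K)
    (hKb : μ * (∫ t in Ioi 0, expWeight b K t) ≤ K / 2) {z : ℂ} (hz : K < z.re) :
    laplaceTransform (fun t => t * φ t) z = a * symbolDeriv b μ z := by
  have hne := hb.symbol_ne_zero hμ (hK.trans hz)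
  have h1 := hasDerivAt_laplaceTransform
    (fun _ h => hφ.integrableOn_expWeight hb hμ hK hKb h) hz
  have h2 := ((hasDerivAt_const z (a : ℂ)).div (hb.hasDerivAt_symbol (μ := μ) (hK.trans hz)) hne)
  have h3 := h1.unique (h2.congr_of_eventuallyEq
    ((eventually_lt_re hz).mono fun w hw => hφ.laplaceTransform_eq hb hμ hK hKb hw))
  rw [symbolDeriv]
  linear_combination -h3

theorem IsScalarSolution.laplaceTransform_id_mul_volterra (hφ : IsScalarSolution b μ a φ)
    (hb : IsAdmissibleKernel b) (hμ : 0 < μ) (hK : 0 < K)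
    (hKb : μ * (∫ t in Ioi 0, expWeight b K t) ≤ K / 2) {z : ℂ} (hz : K < z.re) :
    laplaceTransform (fun t => t * (μ * volterra b φ t)) z = a * symbolDeriv₂ b μ z := by
  have hz0 := hK.trans hz
  have hne := hb.symbol_ne_zero hμ hz0
  have hvi : ∀ σ, K < σ → IntegrableOn (expWeight (volterra b φ) σ) (Ioi 0) := fun σ hσ =>
    integrableOn_expWeight_volterra (hb.integrableOn_expWeight (hK.trans hσ))
      (hφ.integrableOn_expWeight hb hμ hK hKb hσ)
  have h1 := hasDerivAt_laplaceTransform hvi hz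
  have h2 := (((hb.hasDerivAt_laplaceTransform hz0).const_mul (a : ℂ)).div
    (hb.hasDerivAt_symbol (μ := μ) hz0) hne)
  have h3 := h1.unique (h2.congr_of_eventuallyEq
    ((eventually_lt_re hz).mono fun w hw => by
      rw [laplaceTransform_volterra (hb.integrableOn_expWeight (hK.trans hw))
        (hφ.integrableOn_expWeight hb hμ hK hKb hw), hφ.laplaceTransform_eq hb hμ hK hKb hw,
        ← mul_div_assoc, mul_comm (laplaceTransform b w)]
      rfl))
  have h4 : laplaceTransform (fun t => t * (μ * volterra b φ t)) z =
      μ * laplaceTransform (fun t => t * volterra b φ t) z := by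
    rw [laplaceTransform, laplaceTransform, ← integral_const_mul]
    congr 1 with t
    push_cast; ring
  rw [h4, symbolDeriv₂]
  have h5 : laplaceTransform (fun t => t * volterra b φ t) z =
      a * (laplaceTransform b z + z * laplaceTransform (fun t => t * b t) z) / symbol b μ z ^ 2 := by
    rw [eq_div_iff (pow_ne_zero 2 hne)]
    rw [eq_div_iff (pow_ne_zero 2 hne)] at h3
    -- In the quotient rule the products of `μ b̂` with the transform of `t b` cancel, leaving `z`
    -- times the latter.
    have h6 : symbol b μ z = z + μ * laplaceTransform b z := rfl
    linear_combination -h3 + (a : ℂ) * laplaceTransform (fun t => t * b t) z * h6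
  rw [h5]; ring

end Transforms

theorem abs_le_of_laplaceTransform_eq_mul {f : ℝ → ℝ} {F : ℂ → ℂ} {C R K : ℝ}
    (hF : DifferentiableOn ℂ F {z | 0 < z.re}) (hR : 0 < R)
    (hd : ∀ z : ℂ, 0 < z.re → R ≤ |z.im| → ‖F z‖ ≤ C / z.im ^ 2)
    (hfi : ∀ σ, K < σ → IntegrableOn (expWeight f σ) (Ioi 0))
    (hL : ∀ z : ℂ, 0 < z.re → K < z.re → laplaceTransform f z = a * F z) {t : ℝ} (ht : 0 < t)
    (hct : ContinuousAt f t) :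
    |f t| ≤ 3 * |a| * ∫ ω : ℝ, ‖F ((t⁻¹ : ℝ) + ω * Complex.I)‖ := by
  have h := abs_le_of_laplaceTransform (F := fun z => a * F z) (C := |a| * C)
    (hF.const_mul (a : ℂ)) hR (fun z hz hz' => ?_) hfi hL ht hct (inv_pos.2 ht)
  · rw [inv_mul_cancel₀ ht.ne'] at h
    simp_rw [norm_mul, Complex.norm_real, norm_eq_abs] at h
    rw [integral_const_mul] at h
    refine h.trans ?_
    rw [mul_assoc]
    have h0 : 0 ≤ ∫ ω : ℝ, ‖F ((t⁻¹ : ℝ) + ω * Complex.I)‖ := integral_nonneg fun _ => norm_nonneg _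
    exact mul_le_mul_of_nonneg_right (by linarith [exp_one_lt_d9])
      (mul_nonneg (abs_nonneg a) h0)
  · rw [norm_mul, Complex.norm_real, norm_eq_abs, mul_div_assoc]
    exact mul_le_mul_of_nonneg_left (hd z hz hz') (abs_nonneg a)

/-- Decay of the scalar resolvent and of its derivative, uniformly in `μ`; `r₀` is the time scale
of the equation. -/
theorem IsAdmissibleKernel.exists_scalar_bound (hb : IsAdmissibleKernel b) :
    ∃ C : ℝ, 2 ≤ C ∧ ∀ μ r₀ a : ℝ, ∀ φ : ℝ → ℝ, 0 < μ → 0 < r₀ → μ * r₀ * mass b r₀ = 1 / 2 →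
      IsScalarSolution b μ a φ → ∀ t, 0 < t → |φ t| ≤ C * |a| ∧ t * |φ t| ≤ C * |a| * r₀ ∧
        t * |μ * volterra b φ t| ≤ C * |a| ∧ |volterra b φ t| ≤ C * |a| * mass b t := by
  obtain ⟨c, hc, hsym⟩ := hb.exists_le_norm_symbol
  set C := max 2 (3 * (25794 / c ^ 2)) with hC
  have hC2 : 2 ≤ C := le_max_left _ _
  have hC3 : 3 * (25794 / c ^ 2) ≤ C := le_max_right _ _
  refine ⟨C, hC2, fun μ r₀ a φ hμ hr hr₀ hφ => ?_⟩
  have ha := abs_nonneg a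
  obtain ⟨K, hK, hKb⟩ := hb.exists_rate hμ
  have hsmall : ∀ t, 0 ≤ t → t ≤ r₀ → |φ t| ≤ 2 * |a| := fun t ht htr =>
    hφ.abs_le_two_mul hb hμ hr₀.le ht htr
  have hφi := fun σ (hσ : K < σ) => hφ.integrableOn_expWeight hb hμ hK hKb hσ
  -- For `t ≥ r₀` the line `Re z = 1 / t` satisfies the condition `σ r₀ ≤ 1` of the line-integral
  -- bounds.
  have hlarge : ∀ t, r₀ ≤ t → t * |φ t| ≤ C * |a| * r₀ ∧ t * |μ * volterra b φ t| ≤ C * |a| := by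
    intro t htr
    have ht : 0 < t := hr.trans_le htr
    have hσr : t⁻¹ * r₀ ≤ 1 := by rwa [← div_eq_inv_mul, div_le_one ht]
    obtain ⟨I1, I2⟩ := hb.integral_norm_symbolDeriv_le hμ hc hr (hsym μ hμ) hr₀ (inv_pos.2 ht) hσr
    have hhigh := fun (z : ℂ) (hz : 0 < z.re) (hz' : r₀⁻¹ ≤ |z.im|) =>
      hb.norm_symbolDeriv_le_of_high hμ hc hr (hsym μ hμ) hr₀ hz hz'
    constructor
    · have h1 := abs_le_of_laplaceTransform_eq_mul (a := a) (K := K)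
        (hb.differentiableOn_symbolDeriv hμ)
        (inv_pos.2 hr) (fun z hz hz' => (hhigh z hz hz').1)
        (fun σ hσ => integrableOn_expWeight_id_mul hφi hσ)
        (fun z _ hz => hφ.laplaceTransform_id_mul hb hμ hK hKb hz) ht
        (continuousAt_id.mul (hφ.hasDerivAt t ht).continuousAt)
      rw [abs_mul, abs_of_pos ht] at h1
      refine h1.trans ?_
      calc _ ≤ 3 * |a| * (25794 / c ^ 2 * r₀) := mul_le_mul_of_nonneg_left I1 (by positivity)
        _ = 3 * (25794 / c ^ 2) * (|a| * r₀) := by ring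
        _ ≤ C * (|a| * r₀) := mul_le_mul_of_nonneg_right hC3 (by positivity)
        _ = _ := by ring
    · have hvi : ∀ σ, K < σ → IntegrableOn (expWeight (fun t => μ * volterra b φ t) σ) (Ioi 0) :=
        fun σ hσ => by
          refine ((integrableOn_expWeight_volterra (hb.integrableOn_expWeight (hK.trans hσ))
            (hφi σ hσ)).const_mul μ).congr (ae_of_all _ fun t => ?_)
          simp only [expWeight]; ring
      have h1 := abs_le_of_laplaceTransform_eq_mul (a := a) (K := K)
        (hb.differentiableOn_symbolDeriv₂ hμ)
        (inv_pos.2 hr) (fun z hz hz' => (hhigh z hz hz').2)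
        (fun σ hσ => integrableOn_expWeight_id_mul hvi hσ)
        (fun z _ hz => hφ.laplaceTransform_id_mul_volterra hb hμ hK hKb hz) ht
        (continuousAt_id.mul (continuousAt_const.mul (hφ.continuousAt_volterra hb ht)))
      rw [abs_mul, abs_of_pos ht] at h1
      refine h1.trans ?_
      have h2 : 25476 / c ^ 2 ≤ 25794 / c ^ 2 := by gcongr; norm_num
      calc _ ≤ 3 * |a| * (25476 / c ^ 2) := mul_le_mul_of_nonneg_left I2 (by positivity)
        _ = 3 * (25476 / c ^ 2) * |a| := by ring
        _ ≤ C * |a| := mul_le_mul_of_nonneg_right (by linarith) ha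
  have hbound : ∀ t, 0 ≤ t → |φ t| ≤ C * |a| := fun t ht => by
    rcases le_total t r₀ with h | h
    · exact (hsmall t ht h).trans (mul_le_mul_of_nonneg_right hC2 ha)
    · have h1 := (hlarge t h).1
      have h2 : r₀ * |φ t| ≤ r₀ * (C * |a|) := by
        nlinarith [mul_le_mul_of_nonneg_right h (abs_nonneg (φ t))]
      exact le_of_mul_le_mul_left h2 hr
  intro t ht
  have hv : |volterra b φ t| ≤ C * |a| * mass b t :=
    hb.abs_volterra_le ht.le fun s hs => hbound s hs.1
  refine ⟨hbound t ht.le, ?_, ?_, hv⟩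
  · rcases le_total t r₀ with h | h
    · have := hbound t ht.le
      have h2 : 0 ≤ C * |a| := by positivity
      calc t * |φ t| ≤ t * (C * |a|) := mul_le_mul_of_nonneg_left this ht.le
        _ ≤ r₀ * (C * |a|) := mul_le_mul_of_nonneg_right h h2
        _ = _ := by ring
    · exact (hlarge t h).1
  · rcases le_total t r₀ with h | h
    · have h1 : |volterra b φ t| ≤ 2 * |a| * mass b r₀ :=
        (hb.abs_volterra_le ht.le fun s hs => hsmall s hs.1 (hs.2.trans h)).trans
          (mul_le_mul_of_nonneg_left (hb.mass_mono h) (by positivity))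
      rw [abs_mul, abs_of_pos hμ]
      have hm := mass_nonneg hb.nonneg r₀
      calc t * (μ * |volterra b φ t|) ≤ r₀ * (μ * (2 * |a| * mass b r₀)) := by gcongr
        _ = 2 * |a| * (μ * r₀ * mass b r₀) := by ring
        _ = |a| := by rw [hr₀]; ring
        _ ≤ C * |a| := by nlinarith
    · exact (hlarge t h).2

theorem IsAdmissibleKernel.exists_time_scale (hb : IsAdmissibleKernel b) (hμ : 0 < μ) :
    ∃ r₀, 0 < r₀ ∧ μ * r₀ * mass b r₀ = 1 / 2 := by
  have hm1 : 0 < mass b 1 := by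
    have := hb.mass_expWeight_pos (σ := 0) one_pos
    simpa [mass, expWeight] using this
  set T := max 1 (1 / (μ * mass b 1)) with hT
  have hT1 : 1 ≤ T := le_max_left _ _
  have hT2 : 1 / (μ * mass b 1) ≤ T := le_max_right _ _
  have hcont : ContinuousOn (fun r => μ * r * mass b r) (Icc 0 T) := by
    refine ContinuousOn.mul (by fun_prop) ?_
    have h1 : ContinuousOn (fun r => ∫ t in (0 : ℝ)..r, b t) (Icc 0 T) := by
      have := intervalIntegral.continuousOn_primitive_interval (f := b) (μ := volume) (a := 0)
        (b := T) (by
          rw [uIcc_of_le (by linarith)]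
          exact (integrableOn_Icc_iff_integrableOn_Ioc).2
            (integrableOn_Ioc_of_locallyIntegrableOn hb.locallyIntegrable T))
      rwa [uIcc_of_le (by linarith)] at this
    exact h1.congr fun r hr => (intervalIntegral.integral_of_le hr.1).symm
  have h1 : 1 / 2 ≤ μ * T * mass b T := by
    have h2 := hb.mass_mono hT1
    rw [div_le_iff₀ (by positivity)] at hT2
    have h3 : μ * T * mass b 1 ≤ μ * T * mass b T :=
      mul_le_mul_of_nonneg_left h2 (by positivity)
    nlinarith
  obtain ⟨r, hr, hre⟩ := intermediate_value_Icc (by linarith : (0 : ℝ) ≤ T) hcont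
    (show (1 / 2 : ℝ) ∈ Icc _ _ from ⟨by simp, h1⟩)
  refine ⟨r, lt_of_le_of_ne hr.1 fun h => ?_, hre⟩
  rw [← h] at hre
  norm_num at hre

/-- Since `r ∫₀ʳ b` is nondecreasing, `μ ≥ μ₀` forces `r₀ ≤ R`, the time scale of `μ₀`. The lower
bound `c r ^ (ρ - 1)` for the mass is thus available at `r₀`. -/
theorem IsAdmissibleKernel.exists_time_scale_le (hb : IsAdmissibleKernel b) {μ₀ : ℝ}
    (hμ₀ : 0 < μ₀) : ∃ C : ℝ, 0 < C ∧ ∀ μ r₀ : ℝ, μ₀ ≤ μ → 0 < r₀ → μ * r₀ * mass b r₀ = 1 / 2 →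
      μ * r₀ ^ rho b ≤ C := by
  obtain ⟨R, hR, hRe⟩ := hb.exists_time_scale hμ₀
  obtain ⟨c, hc, h⟩ := hb.exists_mul_rpow_le_mass hR
  refine ⟨1 / (2 * c), by positivity, fun μ r₀ hμ hr hr₀ => ?_⟩
  have hμ0 : 0 < μ := hμ₀.trans_le hμ
  have hrR : r₀ ≤ R := by
    by_contra! hlt
    have h1 := hb.mass_mono hlt.le
    have hm : 0 < mass b R := by
      by_contra! hm
      have := mul_nonpos_of_nonneg_of_nonpos (by positivity : 0 ≤ μ₀ * R) hm
      linarith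
    have h2 : μ₀ * R < μ * r₀ := mul_lt_mul' hμ hlt hR.le hμ0
    have h3 := mul_lt_mul h2 h1 hm (by positivity)
    linarith
  have h1 := h r₀ hr hrR
  have h2 : μ * r₀ * (c * r₀ ^ (rho b - 1)) ≤ 1 / 2 := by
    rw [← hr₀]; exact mul_le_mul_of_nonneg_left h1 (by positivity)
  have h3 : r₀ ^ rho b = r₀ * r₀ ^ (rho b - 1) := by
    rw [rpow_sub_one hr.ne']; field_simp
  rw [h3, le_div_iff₀ (by positivity)]
  linarith

end Scalar

end VolterraResolvent

namespace VolterraResolvent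

/-! ### Spectral decomposition through the compact inverse -/

section Spectral

variable {H : Type*} [NormedAddCommGroup H] [InnerProductSpace ℝ H]
  {A : H →ₗ.[ℝ] H} {μ ν : ℝ} {x y : H}

theorem mem_eigenspace_iff :
    x ∈ eigenspace A μ ↔ ∃ h : x ∈ A.domain, A ⟨x, h⟩ = μ • x := by
  simp only [eigenspace, Submodule.mem_comap, LinearMap.prod_apply, Function.prod_apply,
    LinearMap.id_coe, id_eq, LinearMap.smul_apply, LinearPMap.mem_graph_iff]
  constructor
  · rintro ⟨z, h1, h2⟩
    refine ⟨h1 ▸ z.2, ?_⟩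
    rw [← h2]
    congr 1
    exact Subtype.ext h1.symm
  · rintro ⟨h, h2⟩
    exact ⟨⟨x, h⟩, rfl, h2⟩

variable [CompleteSpace H]

theorem IsAdmissibleOperator.symmetric (hA : IsAdmissibleOperator A) (x y : A.domain) :
    inner ℝ (A x) (y : H) = inner ℝ (x : H) (A y) := by
  have h := LinearPMap.adjoint_isFormalAdjoint hA.dense_domain (T := A)
  rw [LinearPMap.isSelfAdjoint_def.1 hA.selfAdjoint] at h
  exact h x y

/-- The compact inverse of `A`. -/
structure IsCompactInverse (A : H →ₗ.[ℝ] H) (K : H →L[ℝ] H) : Prop where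
  compact : IsCompactOperator K
  right_inv : ∀ y : H, ∃ h : K y ∈ A.domain, A ⟨K y, h⟩ = y
  left_inv : ∀ x : A.domain, K (A x) = x

theorem IsAdmissibleOperator.exists_inverse (hA : IsAdmissibleOperator A) :
    ∃ K : H →L[ℝ] H, IsCompactInverse A K := by
  obtain ⟨K, h1, h2, h3⟩ := hA.compact_inverse
  exact ⟨K, h1, h2, h3⟩

variable {K : H →L[ℝ] H}

theorem IsCompactInverse.isSymmetric (hK : IsCompactInverse A K) (hA : IsAdmissibleOperator A) :
    (K : H →ₗ[ℝ] H).IsSymmetric := by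
  intro x y
  obtain ⟨hx, hx'⟩ := hK.right_inv x
  obtain ⟨hy, hy'⟩ := hK.right_inv y
  have := hA.symmetric ⟨K x, hx⟩ ⟨K y, hy⟩
  rw [hx', hy'] at this
  exact this.symm

/-- This removes the domain of `A` from the eigenvalue equation and makes it a closed condition,
stable under limits and derivatives. -/
theorem IsCompactInverse.mem_eigenspace_iff (hK : IsCompactInverse A K) :
    x ∈ eigenspace A μ ↔ x = μ • K x := by
  rw [VolterraResolvent.mem_eigenspace_iff]
  constructor
  · rintro ⟨h, h2⟩
    have := hK.left_inv ⟨x, h⟩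
    rw [h2, map_smul] at this
    exact this.symm
  · intro h
    obtain ⟨hx, hx'⟩ := hK.right_inv x
    have hd : x ∈ A.domain := by
      rw [h]
      exact A.domain.smul_mem _ hx
    refine ⟨hd, ?_⟩
    have : (⟨x, hd⟩ : A.domain) = μ • ⟨K x, hx⟩ := Subtype.ext h
    rw [this, LinearPMap.map_smul, hx']

theorem IsCompactInverse.isClosed_eigenspace (hK : IsCompactInverse A K) (μ : ℝ) :
    IsClosed (eigenspace A μ : Set H) := by
  have : (eigenspace A μ : Set H) = {x | x = μ • K x} := by
    ext x
    exact hK.mem_eigenspace_iff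
  rw [this]
  exact isClosed_eq continuous_id (by fun_prop)

theorem IsAdmissibleOperator.topologicalClosure_eigenspace (hA : IsAdmissibleOperator A) (μ : ℝ) :
    (eigenspace A μ).topologicalClosure = eigenspace A μ := by
  obtain ⟨K, hK⟩ := hA.exists_inverse
  exact (hK.isClosed_eigenspace μ).submodule_topologicalClosure_eq

theorem IsAdmissibleOperator.completeSpace_eigenspace (hA : IsAdmissibleOperator A) (μ : ℝ) :
    CompleteSpace (eigenspace A μ) := by
  obtain ⟨K, hK⟩ := hA.exists_inverse
  exact (hK.isClosed_eigenspace μ).completeSpace_coe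

theorem IsAdmissibleOperator.inner_eq_zero (hA : IsAdmissibleOperator A) (hμν : μ ≠ ν)
    (hx : x ∈ eigenspace A μ) (hy : y ∈ eigenspace A ν) : inner ℝ x y = 0 := by
  obtain ⟨hx, hx'⟩ := mem_eigenspace_iff.1 hx
  obtain ⟨hy, hy'⟩ := mem_eigenspace_iff.1 hy
  have := hA.symmetric ⟨x, hx⟩ ⟨y, hy⟩
  rw [hx', hy', inner_smul_left, inner_smul_right] at this
  simp only [conj_trivial] at this
  have h : (μ - ν) * inner ℝ x y = 0 := by linarith
  exact (mul_eq_zero.1 h).resolve_left (sub_ne_zero.2 hμν)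

theorem IsAdmissibleOperator.orthogonalFamily (hA : IsAdmissibleOperator A) :
    OrthogonalFamily ℝ (fun μ => eigenspace A μ) fun μ => (eigenspace A μ).subtypeₗᵢ :=
  fun _ _ h x y => hA.inner_eq_zero h x.2 y.2

/-- The spectral theorem for compact self-adjoint `K`: an eigenvalue `ν` of `K` gives `ν⁻¹` for `A`,
and `ν = 0` contributes nothing since `K` is injective. -/
theorem IsAdmissibleOperator.orthogonal_iSup_eigenspace (hA : IsAdmissibleOperator A) :
    (⨆ μ, eigenspace A μ)ᗮ = ⊥ := by
  obtain ⟨K, hK⟩ := hA.exists_inverse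
  have h := ContinuousLinearMap.orthogonalComplement_iSup_eigenspaces_eq_bot hK.compact
    (hK.isSymmetric hA)
  refine le_bot_iff.1 (h ▸ Submodule.orthogonal_le ?_)
  refine iSup_le fun ν x hx => ?_
  rw [Module.End.mem_eigenspace_iff] at hx
  replace hx : K x = ν • x := hx
  refine Submodule.mem_iSup_of_mem ν⁻¹ (hK.mem_eigenspace_iff.2 ?_)
  rcases eq_or_ne ν 0 with rfl | hν
  · obtain ⟨h1, h2⟩ := hK.right_inv x
    have : (⟨K x, h1⟩ : A.domain) = 0 := Subtype.ext (by simpa using hx)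
    rw [this, LinearPMap.map_zero] at h2
    simp [← h2]
  · rw [hx, smul_smul, inv_mul_cancel₀ hν, one_smul]

theorem IsAdmissibleOperator.exists_eigenvalue_lower_bound (hA : IsAdmissibleOperator A) :
    ∃ μ₀ : ℝ, 0 < μ₀ ∧ ∀ μ, ∀ x ∈ eigenspace A μ, x ≠ 0 → μ₀ ≤ μ := by
  obtain ⟨K, hK⟩ := hA.exists_inverse
  refine ⟨(‖K‖ + 1)⁻¹, by positivity, fun μ x hx h0 => ?_⟩
  have hpos : 0 < ‖x‖ := norm_pos_iff.2 h0
  have hμ : 0 ≤ μ := by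
    obtain ⟨h, h'⟩ := mem_eigenspace_iff.1 hx
    have := hA.nonneg ⟨x, h⟩
    rw [h', inner_smul_left, real_inner_self_eq_norm_sq] at this
    exact nonneg_of_mul_nonneg_left this (by positivity)
  have h1 : ‖x‖ ≤ μ * ((‖K‖ + 1) * ‖x‖) := by
    calc ‖x‖ = ‖μ • K x‖ := by rw [← hK.mem_eigenspace_iff.1 hx]
      _ = μ * ‖K x‖ := by rw [norm_smul, Real.norm_of_nonneg hμ]
      _ ≤ μ * ((‖K‖ + 1) * ‖x‖) := by
        gcongr
        exact (K.le_opNorm x).trans (by nlinarith)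
  rw [inv_le_iff_one_le_mul₀ (by positivity)]
  rw [← mul_assoc] at h1
  exact le_of_mul_le_mul_right (by linarith) hpos

theorem IsAdmissibleOperator.eigenProj_mem (hA : IsAdmissibleOperator A) (μ : ℝ) (x : H) :
    eigenProj A μ x ∈ eigenspace A μ :=
  (hA.topologicalClosure_eigenspace μ).le (Submodule.starProjection_apply_mem _ x)

theorem eigenProj_of_mem (hx : x ∈ eigenspace A μ) : eigenProj A μ x = x :=
  Submodule.starProjection_eq_self_iff.2 (Submodule.le_topologicalClosure _ hx)

theorem IsAdmissibleOperator.eigenProj_of_mem_of_ne (hA : IsAdmissibleOperator A)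
    (hμν : μ ≠ ν) (hx : x ∈ eigenspace A ν) : eigenProj A μ x = 0 := by
  refine (Submodule.starProjection_apply_eq_zero_iff _).2 ?_
  rw [hA.topologicalClosure_eigenspace, Submodule.mem_orthogonal]
  exact fun u hu => hA.inner_eq_zero hμν hu hx

theorem IsAdmissibleOperator.hasSum_eigenProj (hA : IsAdmissibleOperator A) (x : H) :
    HasSum (fun μ => eigenProj A μ x) x := by
  have := hA.completeSpace_eigenspace
  have hs : IsHilbertSum ℝ (fun μ => eigenspace A μ) fun μ => (eigenspace A μ).subtypeₗᵢ := by
    refine IsHilbertSum.mkInternal _ hA.orthogonalFamily ?_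
    rw [← Submodule.orthogonal_orthogonal_eq_closure, hA.orthogonal_iSup_eigenspace,
      Submodule.bot_orthogonal_eq_top]
  have h := hs.hasSum_linearIsometryEquiv_symm (hs.linearIsometryEquiv x)
  rw [LinearIsometryEquiv.symm_apply_apply] at h
  set w := hs.linearIsometryEquiv x
  refine h.congr_fun fun μ => ?_
  have h1 : HasSum (fun ν => eigenProj A μ (w ν : H)) (eigenProj A μ x) := by
    simpa using (eigenProj A μ).hasSum h
  have h2 : HasSum (fun ν => eigenProj A μ (w ν : H)) (eigenProj A μ (w μ : H)) :=
    hasSum_single μ fun ν hν => hA.eigenProj_of_mem_of_ne hν.symm (w ν).2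
  rw [eigenProj_of_mem (w μ).2] at h2
  exact h1.unique h2

theorem IsAdmissibleOperator.hasSum_norm_sq (hA : IsAdmissibleOperator A) {f : ℝ → H}
    (hf : ∀ μ, f μ ∈ eigenspace A μ) (h : HasSum f y) :
    HasSum (fun μ => ‖f μ‖ ^ 2) (‖y‖ ^ 2) := by
  have h1 : HasSum (fun μ => inner ℝ y (f μ)) (inner ℝ y y) := by
    simpa using (innerSL ℝ y).hasSum h
  rw [real_inner_self_eq_norm_sq] at h1
  refine h1.congr_fun fun μ => ?_
  have h2 : HasSum (fun ν => inner ℝ (f μ) (f ν)) (inner ℝ (f μ) y) := by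
    simpa using (innerSL ℝ (f μ)).hasSum h
  have h3 : HasSum (fun ν => inner ℝ (f μ) (f ν)) (inner ℝ (f μ) (f μ)) :=
    hasSum_single μ fun ν hν => hA.inner_eq_zero hν.symm (hf μ) (hf ν)
  rw [real_inner_comm, h2.unique h3, real_inner_self_eq_norm_sq]

/-- By orthogonality, termwise domination by the components of `x` becomes a bound for the sum. The
operator estimates reduce to eigenvectors by this. -/
theorem IsAdmissibleOperator.summable_and_norm_tsum_le (hA : IsAdmissibleOperator A) {f : ℝ → H}
    (hf : ∀ μ, f μ ∈ eigenspace A μ) {M : ℝ} (hM : 0 ≤ M)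
    (h : ∀ μ, ‖f μ‖ ≤ M * ‖eigenProj A μ x‖) : Summable f ∧ ‖∑' μ, f μ‖ ≤ M * ‖x‖ := by
  have hx := (hA.hasSum_norm_sq (hA.eigenProj_mem · x) (hA.hasSum_eigenProj x)).mul_left (M ^ 2)
  have hle : ∀ μ, ‖f μ‖ ^ 2 ≤ M ^ 2 * ‖eigenProj A μ x‖ ^ 2 := fun μ => by
    rw [← mul_pow]
    exact pow_le_pow_left₀ (norm_nonneg _) (h μ) 2
  have hs : Summable f := by
    refine (hA.orthogonalFamily.summable_iff_norm_sq_summable fun μ => ⟨f μ, hf μ⟩).2 ?_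
    exact Summable.of_nonneg_of_le (fun _ => by positivity) hle hx.summable
  refine ⟨hs, ?_⟩
  have := hasSum_le hle (hA.hasSum_norm_sq hf hs.hasSum) hx
  rw [← mul_pow] at this
  exact le_of_sq_le_sq this (by positivity)

theorem IsAdmissibleOperator.eigenProj_comm (hA : IsAdmissibleOperator A) {L : H →L[ℝ] H}
    (hL : ∀ μ, ∀ x ∈ eigenspace A μ, L x ∈ eigenspace A μ) (μ : ℝ) (x : H) :
    eigenProj A μ (L x) = L (eigenProj A μ x) := by
  have h1 : HasSum (fun ν => eigenProj A μ (L (eigenProj A ν x))) (eigenProj A μ (L x)) := by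
    simpa using ((eigenProj A μ).comp L).hasSum (hA.hasSum_eigenProj x)
  have h2 : HasSum (fun ν => eigenProj A μ (L (eigenProj A ν x)))
      (eigenProj A μ (L (eigenProj A μ x))) :=
    hasSum_single μ fun ν hν =>
      hA.eigenProj_of_mem_of_ne hν.symm (hL ν _ (hA.eigenProj_mem ν x))
  rw [h1.unique h2, eigenProj_of_mem (hL μ _ (hA.eigenProj_mem μ x))]

theorem IsAdmissibleOperator.norm_apply_le (hA : IsAdmissibleOperator A) {L : H →L[ℝ] H}
    (hL : ∀ μ, ∀ x ∈ eigenspace A μ, L x ∈ eigenspace A μ) {M : ℝ} (hM : 0 ≤ M)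
    (h : ∀ μ, ∀ x ∈ eigenspace A μ, ‖L x‖ ≤ M * ‖x‖) (x : H) : ‖L x‖ ≤ M * ‖x‖ := by
  have := (hA.summable_and_norm_tsum_le (x := x) (fun μ => hL μ _ (hA.eigenProj_mem μ x)) hM
    fun μ => h μ _ (hA.eigenProj_mem μ x)).2
  have h2 : HasSum (fun ν => L (eigenProj A ν x)) (L x) := by
    simpa using L.hasSum (hA.hasSum_eigenProj x)
  rwa [h2.tsum_eq] at this

theorem IsAdmissibleOperator.compNormLE_fracPow (hA : IsAdmissibleOperator A) {L : H →L[ℝ] H}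
    (hL : ∀ μ, ∀ x ∈ eigenspace A μ, L x ∈ eigenspace A μ) {M r : ℝ} (hM : 0 ≤ M)
    (h : ∀ μ, ∀ x ∈ eigenspace A μ, x ≠ 0 → μ ^ r * ‖L x‖ ≤ M * ‖x‖) :
    CompNormLE (fracPow A r) L M := by
  obtain ⟨μ₀, hμ₀, hlow⟩ := hA.exists_eigenvalue_lower_bound
  intro x
  suffices h : ∀ μ, ‖μ ^ r • eigenProj A μ (L x)‖ ≤ M * ‖eigenProj A μ x‖ from
    have h' := hA.summable_and_norm_tsum_le
      (fun μ => Submodule.smul_mem _ _ (hA.eigenProj_mem _ _)) hM h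
    ⟨h'.1, h'.2⟩
  intro μ
  rw [hA.eigenProj_comm hL, norm_smul]
  rcases eq_or_ne (eigenProj A μ x) 0 with h0 | h0
  · simp [h0]
  · have hμ := hμ₀.trans_le (hlow μ _ (hA.eigenProj_mem μ x) h0)
    rw [Real.norm_of_nonneg (by positivity)]
    exact h μ _ (hA.eigenProj_mem μ x) h0

end Spectral

end VolterraResolvent

namespace VolterraResolvent

/-! ### From scalar bounds to the resolvent family -/

section Resolvent

variable {H : Type*} [NormedAddCommGroup H] [InnerProductSpace ℝ H] [CompleteSpace H]
  {A : H →ₗ.[ℝ] H} {b : ℝ → ℝ} {S : ℝ → H →L[ℝ] H} {μ t : ℝ} {x : H}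

theorem IsResolventFamily.apply_mem_eigenspace (hS : IsResolventFamily A b S) (ht : 0 ≤ t)
    (hx : x ∈ eigenspace A μ) : S t x ∈ eigenspace A μ := by
  obtain ⟨h, h'⟩ := mem_eigenspace_iff.1 hx
  obtain ⟨h2, h2'⟩ := hS.commute t ht ⟨x, h⟩
  exact mem_eigenspace_iff.2 ⟨h2, by rw [h2', h', map_smul]⟩

theorem IsResolventFamily.isScalarSolution (hS : IsResolventFamily A b S)
    (hl : LocallyIntegrableOn b (Ici 0)) (hx : x ∈ eigenspace A μ) (f : H) :
    IsScalarSolution b μ (inner ℝ f x) fun t => inner ℝ f (S t x) where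
  continuousOn := continuousOn_const.inner (hS.continuous x)
  zero := by simp [hS.zero]
  hasDerivAt t ht := by
    obtain ⟨h, h'⟩ := mem_eigenspace_iff.1 hx
    have hd := (innerSL ℝ f).hasFDerivAt.comp_hasDerivAt t (hS.equation ⟨x, h⟩ t ht)
    have hi : IntervalIntegrable (fun s => b (t - s)) volume 0 t := by
      have h1 : IntervalIntegrable b volume t 0 :=
        ((intervalIntegrable_iff_integrableOn_Ioc_of_le ht.le).2
          (integrableOn_Ioc_of_locallyIntegrableOn hl t)).symm
      simpa using h1.comp_sub_left t
    have hi2 : IntervalIntegrable (fun s => b (t - s) • S s (A ⟨x, h⟩)) volume 0 t := by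
      refine hi.smul_continuousOn ((hS.continuous _).mono fun s hs => ?_)
      rw [uIcc_of_le ht.le] at hs
      exact hs.1
    have he : (innerSL ℝ f) (-∫ s in (0 : ℝ)..t, b (t - s) • S s (A ⟨x, h⟩)) =
        -μ * volterra b (fun t => inner ℝ f (S t x)) t := by
      rw [map_neg, ← ContinuousLinearMap.intervalIntegral_comp_comm _ hi2, volterra, neg_mul,
        ← intervalIntegral.integral_const_mul]
      congr 1
      refine intervalIntegral.integral_congr fun s _ => ?_
      simp only [h', map_smul, innerSL_apply_apply, smul_eq_mul]
      ring
    rw [he] at hd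
    exact hd

/-- Pairing `S τ x` with the fixed vector `S t x`, or with the derivative `d` at `t`, gives a scalar
solution whose value, or derivative, at `t` is the squared norm sought. One factor of the norm then
cancels. -/
theorem IsAdmissibleKernel.exists_eigenspace_bound (hb : IsAdmissibleKernel b)
    (hS : IsResolventFamily A b S) :
    ∃ C, 2 ≤ C ∧ ∀ μ r₀ t : ℝ, ∀ x ∈ eigenspace A μ, 0 < μ → 0 < r₀ →
      μ * r₀ * mass b r₀ = 1 / 2 → 0 < t →
      ‖S t x‖ ≤ C * ‖x‖ ∧ t * ‖S t x‖ ≤ C * ‖x‖ * r₀ ∧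
      ∀ d, HasDerivAt (fun τ => S τ x) d t →
        t * ‖d‖ ≤ C * ‖x‖ ∧ ‖d‖ ≤ μ * (C * ‖x‖ * mass b t) := by
  obtain ⟨C, hC, h⟩ := hb.exists_scalar_bound
  refine ⟨C, hC, fun μ r₀ t x hx hμ hr₀ hr ht => ?_⟩
  have hm : 0 ≤ mass b t := mass_nonneg hb.nonneg t
  have cancel : ∀ {y B c : ℝ}, 0 ≤ y → 0 ≤ B → c * (y * y) ≤ y * B → c * y ≤ B := by
    intro y B c hy hB hyB
    rcases hy.eq_or_lt with rfl | hy
    · simpa using hB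
    · refine le_of_mul_le_mul_left ?_ hy
      linarith
  have hsol := fun f => h μ r₀ _ _ hμ hr₀ hr (hS.isScalarSolution hb.locallyIntegrable hx f) t ht
  have key : ∀ f : H, C * |inner ℝ f x| ≤ ‖f‖ * (C * ‖x‖) := fun f => by
    have := abs_real_inner_le_norm f x
    nlinarith
  refine ⟨?_, ?_, fun d hd => ?_⟩
  · obtain ⟨h1, -, -, -⟩ := hsol (S t x)
    rw [real_inner_self_eq_norm_mul_norm, abs_of_nonneg (by positivity)] at h1
    have := cancel (c := 1) (norm_nonneg (S t x)) (B := C * ‖x‖) (by positivity)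
      (by linarith [key (S t x)])
    linarith
  · obtain ⟨-, h1, -, -⟩ := hsol (S t x)
    rw [real_inner_self_eq_norm_mul_norm, abs_of_nonneg (by positivity)] at h1
    refine cancel (norm_nonneg (S t x)) (by positivity) (h1.trans ?_)
    rw [← mul_assoc]
    exact mul_le_mul_of_nonneg_right (key _) hr₀.le
  · have hd' : -μ * volterra b (fun t => inner ℝ d (S t x)) t = ‖d‖ * ‖d‖ := by
      rw [← real_inner_self_eq_norm_mul_norm]
      have h2 : HasDerivAt (fun τ => inner ℝ d (S τ x)) (inner ℝ d d) t :=
        (innerSL ℝ d).hasFDerivAt.comp_hasDerivAt t hd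
      exact ((hS.isScalarSolution hb.locallyIntegrable hx d).hasDerivAt t ht).unique h2
    obtain ⟨-, -, h1, h2⟩ := hsol d
    constructor
    · have h3 : |μ * volterra b (fun t => inner ℝ d (S t x)) t| = ‖d‖ * ‖d‖ := by
        rw [← abs_neg, ← neg_mul, hd', abs_of_nonneg (by positivity)]
      rw [h3] at h1
      exact cancel (norm_nonneg d) (by positivity) (h1.trans (key d))
    · have h3 : ‖d‖ * ‖d‖ ≤ μ * |volterra b (fun t => inner ℝ d (S t x)) t| := by
        rw [← hd', neg_mul, ← mul_neg]
        exact mul_le_mul_of_nonneg_left (neg_le_abs _) hμ.le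
      have h4 := cancel (c := 1) (norm_nonneg d) (B := μ * (C * ‖x‖ * mass b t)) (by positivity) (by
        have h5 := mul_le_mul_of_nonneg_right (key d) hm
        have h6 := mul_le_mul_of_nonneg_left (h2.trans h5) hμ.le
        linarith)
      linarith

/-- A strongly Lipschitz family of operators that is strongly differentiable on a dense subspace
is strongly differentiable. -/
theorem exists_hasDerivAt_of_dense {D : Submodule ℝ H} (hD : Dense (D : Set H)) {M : ℝ}
    (hM : 0 ≤ M) (hlip : ∀ᶠ r in 𝓝 t, ∀ x, ‖S r x - S t x‖ ≤ M * ‖x‖ * ‖r - t‖)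
    (hd : ∀ x ∈ D, DifferentiableAt ℝ (fun τ => S τ x) t) :
    ∃ L : H →L[ℝ] H, ∀ x, HasDerivAt (fun τ => S τ x) (L x) t := by
  let T : D →ₗ[ℝ] H :=
    { toFun := fun x => deriv (fun τ => S τ x) t
      map_add' := fun x y => by
        have := ((hd x x.2).hasDerivAt.add (hd y y.2).hasDerivAt).deriv
        rw [← this]
        congr 1
        ext τ
        simp
      map_smul' := fun c x => by
        have := ((hd x x.2).hasDerivAt.const_smul c).deriv
        rw [RingHom.id_apply, ← this]
        congr 1
        ext τ
        simp }
  have hT : ∀ x : D, ‖T x‖ ≤ M * ‖D.subtype x‖ := fun x =>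
    (hd x x.2).hasDerivAt.le_of_lip' (by positivity) (hlip.mono fun r hr => hr x)
  have hD' : DenseRange D.subtype := by
    simpa [DenseRange] using hD
  refine ⟨T.extendOfNorm D.subtype, fun x => ?_⟩
  set L := T.extendOfNorm D.subtype
  have hL : ∀ z ∈ D, HasDerivAt (fun τ => S τ z) (L z) t := fun z hz => by
    have : L z = T ⟨z, hz⟩ := LinearMap.extendOfNorm_eq hD' ⟨M, hT⟩ ⟨z, hz⟩
    rw [this]
    exact (hd z hz).hasDerivAt
  have hLM : ∀ z, ‖L z‖ ≤ M * ‖z‖ := LinearMap.norm_extendOfNorm_apply_le hD' M hT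
  rw [hasDerivAt_iff_isLittleO, Asymptotics.isLittleO_iff]
  intro ε hε
  -- The radius makes `M ‖x - z‖ ≤ ε / 4`. This error occurs twice, once in the increment and once
  -- in `L`; the remaining `ε / 2` is for differentiability at `z`.
  obtain ⟨z, hz, hzx⟩ := Metric.dense_iff.1 hD x (ε / (4 * (M + 1))) (by positivity)
  have hxz : M * ‖x - z‖ ≤ ε / 4 := by
    rw [Metric.mem_ball, dist_comm, dist_eq_norm, lt_div_iff₀ (by positivity)] at hz
    nlinarith [norm_nonneg (x - z)]
  have hz' := (hasDerivAt_iff_isLittleO.1 (hL z hzx)).def (half_pos hε)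
  filter_upwards [hlip, hz'] with r h1 h2
  have e : S r x - S t x - (r - t) • L x =
      (S r (x - z) - S t (x - z)) - (r - t) • L (x - z) + (S r z - S t z - (r - t) • L z) := by
    simp only [map_sub, smul_sub]
    abel
  rw [e]
  have h3 : ‖(r - t) • L (x - z)‖ ≤ ‖r - t‖ * (M * ‖x - z‖) := by
    rw [norm_smul]
    exact mul_le_mul_of_nonneg_left (hLM _) (norm_nonneg _)
  have h4 := norm_add_le ((S r (x - z) - S t (x - z)) - (r - t) • L (x - z))
    (S r z - S t z - (r - t) • L z)
  have h5 := norm_sub_le (S r (x - z) - S t (x - z)) ((r - t) • L (x - z))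
  have h6 := h1 (x - z)
  nlinarith [norm_nonneg (r - t)]

theorem IsResolventFamily.hasDerivAt_mem_eigenspace (hS : IsResolventFamily A b S)
    (hA : IsAdmissibleOperator A) (ht : 0 < t) (hx : x ∈ eigenspace A μ) {d : H}
    (hd : HasDerivAt (fun τ => S τ x) d t) : d ∈ eigenspace A μ := by
  obtain ⟨K, hK⟩ := hA.exists_inverse
  rw [hK.mem_eigenspace_iff]
  have h1 : HasDerivAt (fun τ => μ • K (S τ x)) (μ • K d) t :=
    (K.hasFDerivAt.comp_hasDerivAt t hd).const_smul μ
  refine (hd.congr_of_eventuallyEq ?_).unique h1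
  filter_upwards [lt_mem_nhds ht] with τ hτ
  exact (hK.mem_eigenspace_iff.1 (hS.apply_mem_eigenspace hτ.le hx)).symm

/-- On eigenvectors the derivative at `τ ≥ t / 2` is at most `2 C / t`, whatever `μ` is. So `S` is
Lipschitz near `t` in operator norm, and differentiability extends from the dense domain of `A`. -/
theorem IsResolventFamily.exists_strongDeriv (hS : IsResolventFamily A b S)
    (hA : IsAdmissibleOperator A) (hb : IsAdmissibleKernel b) (ht : 0 < t) :
    ∃ L : H →L[ℝ] H, ∀ x, HasDerivAt (fun τ => S τ x) (L x) t := by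
  obtain ⟨C, hC, h⟩ := hb.exists_eigenspace_bound hS
  obtain ⟨μ₀, hμ₀, hlow⟩ := hA.exists_eigenvalue_lower_bound
  refine exists_hasDerivAt_of_dense (D := A.domain) (M := 2 * C / t) hA.dense_domain
    (by positivity) ?_ fun x hx => (hS.equation ⟨x, hx⟩ t ht).differentiableAt
  filter_upwards [lt_mem_nhds (half_lt_self ht)] with r hr x
  have := hA.norm_apply_le (L := S r - S t) (M := 2 * C / t * ‖r - t‖)
    (fun μ x hx => Submodule.sub_mem _ (hS.apply_mem_eigenspace ((half_pos ht).trans hr).le hx)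
      (hS.apply_mem_eigenspace ht.le hx)) (by positivity) ?_ x
  · rw [_root_.sub_apply] at this
    linarith
  intro μ x hx
  rcases eq_or_ne x 0 with rfl | h0
  · simp
  have hμ := hμ₀.trans_le (hlow μ x hx h0)
  obtain ⟨r₀, hr₀, hr₀'⟩ := hb.exists_time_scale hμ
  obtain ⟨hxA, -⟩ := mem_eigenspace_iff.1 hx
  have := (convex_Ici (t / 2)).norm_image_sub_le_of_norm_hasDerivWithin_le
    (f := fun τ => S τ x) (C := 2 * C / t * ‖x‖) (x := t) (y := r)
    (fun τ hτ => (hS.equation ⟨x, hxA⟩ τ ((half_pos ht).trans_le hτ)).hasDerivWithinAt)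
    (fun τ hτ => ?_) (half_lt_self ht).le hr.le
  · rw [_root_.sub_apply]
    linarith
  · have hτ0 := (half_pos ht).trans_le hτ
    have h1 := ((h μ r₀ τ x hx hμ hr₀ hr₀' hτ0).2.2 _ (hS.equation ⟨x, hxA⟩ τ hτ0)).1
    rw [div_mul_eq_mul_div, le_div_iff₀ ht]
    have h2 := mul_le_mul_of_nonneg_right (mem_Ici.1 hτ)
      (norm_nonneg (-∫ s in (0 : ℝ)..τ, b (τ - s) • S s (A ⟨x, hxA⟩)))
    linarith

/-- The interpolation step: a quantity bounded by both `1` and `z` is bounded by every intermediate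
power of `z`. -/
theorem le_rpow_of_le_one_of_le {y θ : ℝ} (hθ : 0 ≤ θ) (hθ1 : θ ≤ 1) (h0 : 0 ≤ y) (h1 : y ≤ 1)
    {z : ℝ} (hyz : y ≤ z) : y ≤ z ^ θ :=
  (Real.self_le_rpow_of_le_one h0 h1 hθ1).trans (Real.rpow_le_rpow h0 hyz hθ)

/-- Interpolation between `1` and `r₀ / t` with exponent `s ρ / 2`, which is at most `1` precisely
when `s ≤ 2 / ρ`. The factor `μ ^ (s/2)` is then absorbed by `(μ r₀ ^ ρ) ^ (s/2)`, bounded uniformly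
in `μ`. -/
theorem IsResolventFamily.exists_fracPow_bound (hS : IsResolventFamily A b S)
    (hA : IsAdmissibleOperator A) (hb : IsAdmissibleKernel b) :
    ∃ C₀, 0 < C₀ ∧ ∀ t : ℝ, 0 < t → ∀ s : ℝ, 0 ≤ s → s ≤ 2 / rho b →
      CompNormLE (fracPow A (s / 2)) (S t) (C₀ * t ^ (-(s * rho b / 2))) := by
  obtain ⟨C, hC, h⟩ := hb.exists_eigenspace_bound hS
  obtain ⟨μ₀, hμ₀, hlow⟩ := hA.exists_eigenvalue_lower_bound
  obtain ⟨C₂, hC₂, h₂⟩ := hb.exists_time_scale_le hμ₀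
  have hρ := hb.one_lt_rho
  refine ⟨C * max 1 C₂, by positivity, fun t ht s hs hs' => ?_⟩
  rw [le_div_iff₀ (by linarith)] at hs'
  refine hA.compNormLE_fracPow (fun μ x hx => hS.apply_mem_eigenspace ht.le hx) (by positivity)
    fun μ x hx h0 => ?_
  have hμ := hμ₀.trans_le (hlow μ x hx h0)
  obtain ⟨r₀, hr₀, hr₀'⟩ := hb.exists_time_scale hμ
  obtain ⟨h1, h3, -⟩ := h μ r₀ t x hx hμ hr₀ hr₀' ht
  have hx0 : 0 < ‖x‖ := norm_pos_iff.2 h0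
  have hCx : 0 < C * ‖x‖ := by positivity
  have hy : ‖S t x‖ / (C * ‖x‖) ≤ (r₀ / t) ^ (s * rho b / 2) := by
    refine le_rpow_of_le_one_of_le (by positivity) (by linarith) (by positivity)
      ((div_le_one hCx).2 h1) ?_
    rw [div_le_div_iff₀ hCx ht]
    linarith
  rw [div_le_iff₀ hCx, Real.div_rpow hr₀.le ht.le] at hy
  have hμr : μ ^ (s / 2) * r₀ ^ (s * rho b / 2) ≤ max 1 C₂ := by
    have e : μ ^ (s / 2) * r₀ ^ (s * rho b / 2) = (μ * r₀ ^ rho b) ^ (s / 2) := by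
      rw [Real.mul_rpow hμ.le (by positivity), ← Real.rpow_mul hr₀.le]
      congr 2
      ring
    rw [e]
    calc (μ * r₀ ^ rho b) ^ (s / 2) ≤ (max 1 C₂) ^ (s / 2) :=
          Real.rpow_le_rpow (by positivity)
            ((h₂ μ r₀ (hlow μ x hx h0) hr₀ hr₀').trans (le_max_right _ _)) (by positivity)
      _ ≤ (max 1 C₂) ^ (1 : ℝ) :=
          Real.rpow_le_rpow_of_exponent_le (le_max_left _ _) (by nlinarith)
      _ = max 1 C₂ := Real.rpow_one _
  calc μ ^ (s / 2) * ‖S t x‖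
      ≤ μ ^ (s / 2) * (r₀ ^ (s * rho b / 2) / t ^ (s * rho b / 2) * (C * ‖x‖)) := by gcongr
    _ = μ ^ (s / 2) * r₀ ^ (s * rho b / 2) * (t ^ (-(s * rho b / 2)) * (C * ‖x‖)) := by
        rw [Real.rpow_neg ht.le]
        ring
    _ ≤ max 1 C₂ * (t ^ (-(s * rho b / 2)) * (C * ‖x‖)) := by gcongr
    _ = C * max 1 C₂ * t ^ (-(s * rho b / 2)) * ‖x‖ := by ring

/-- Interpolation of `t ‖L x‖ / (C ‖x‖)` between `1` and `μ t ∫₀ᵗ b` with exponent `s / 2`; the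
power of `μ` produced is exactly the one removed by `A ^ (-s/2)`. -/
theorem IsResolventFamily.exists_fracPow_deriv_bound (hS : IsResolventFamily A b S)
    (hA : IsAdmissibleOperator A) (hb : IsAdmissibleKernel b) :
    ∃ C₁, 0 < C₁ ∧ ∀ t : ℝ, 0 < t → ∀ L : H →L[ℝ] H,
      (∀ x, HasDerivAt (fun τ => S τ x) (L x) t) → ∀ s : ℝ, 0 ≤ s → s ≤ 2 →
      CompNormLE (fracPow A (-(s / 2))) L (C₁ * mass b t ^ (s / 2) * t ^ (s / 2 - 1)) := by
  obtain ⟨C, hC, h⟩ := hb.exists_eigenspace_bound hS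
  obtain ⟨μ₀, hμ₀, hlow⟩ := hA.exists_eigenvalue_lower_bound
  refine ⟨C, by positivity, fun t ht L hL s hs hs' => ?_⟩
  have hm : 0 ≤ mass b t := mass_nonneg hb.nonneg t
  refine hA.compNormLE_fracPow (fun μ x hx => hS.hasDerivAt_mem_eigenspace hA ht hx (hL x))
    (by positivity) fun μ x hx h0 => ?_
  have hμ := hμ₀.trans_le (hlow μ x hx h0)
  obtain ⟨r₀, hr₀, hr₀'⟩ := hb.exists_time_scale hμ
  obtain ⟨h1, h3⟩ := (h μ r₀ t x hx hμ hr₀ hr₀' ht).2.2 _ (hL x)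
  have hx0 : 0 < ‖x‖ := norm_pos_iff.2 h0
  have hCx : 0 < C * ‖x‖ := by positivity
  have hy : t * ‖L x‖ / (C * ‖x‖) ≤ (μ * (t * mass b t)) ^ (s / 2) := by
    refine le_rpow_of_le_one_of_le (by positivity) (by linarith) (by positivity)
      ((div_le_one hCx).2 h1) ?_
    rw [div_le_iff₀ hCx]
    have := mul_le_mul_of_nonneg_left h3 ht.le
    linarith
  rw [div_le_iff₀ hCx, Real.mul_rpow hμ.le (by positivity), Real.mul_rpow ht.le hm] at hy
  have hy' : ‖L x‖ ≤ t⁻¹ * (μ ^ (s / 2) * (t ^ (s / 2) * mass b t ^ (s / 2)) * (C * ‖x‖)) := by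
    rw [inv_mul_eq_div, le_div_iff₀ ht]
    linarith
  calc μ ^ (-(s / 2)) * ‖L x‖
      ≤ μ ^ (-(s / 2)) *
        (t⁻¹ * (μ ^ (s / 2) * (t ^ (s / 2) * mass b t ^ (s / 2)) * (C * ‖x‖))) := by gcongr
    _ = C * mass b t ^ (s / 2) * t ^ (s / 2 - 1) * ‖x‖ := by
        rw [Real.rpow_neg hμ.le, Real.rpow_sub_one ht.ne']
        have : μ ^ (s / 2) ≠ 0 := (Real.rpow_pos_of_pos hμ _).ne'
        field_simp

end Resolvent

end VolterraResolvent

theorem proposition2p3 {H : Type*} [NormedAddCommGroup H] [InnerProductSpace ℝ H]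
    [CompleteSpace H] [TopologicalSpace.SeparableSpace H]
    (A : H →ₗ.[ℝ] H) (hA : VolterraResolvent.IsAdmissibleOperator A)
    (b : ℝ → ℝ) (hb : VolterraResolvent.IsAdmissibleKernel b)
    (S : ℝ → H →L[ℝ] H) (hS : VolterraResolvent.IsResolventFamily A b S) :
    ∃ (S' : ℝ → H →L[ℝ] H) (C₀ C₁ : ℝ), 0 < C₀ ∧ 0 < C₁ ∧
      (∀ t : ℝ, 0 < t → ∀ x : H, HasDerivAt (fun τ => S τ x) (S' t x) t) ∧
      (∀ t : ℝ, 0 < t → ∀ s : ℝ, 0 ≤ s → s ≤ 2 / VolterraResolvent.rho b →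
        VolterraResolvent.CompNormLE (VolterraResolvent.fracPow A (s / 2)) (S t)
          (C₀ * t ^ (-(s * VolterraResolvent.rho b / 2)))) ∧
      (∀ t : ℝ, 0 < t → ∀ s' : ℝ, 0 ≤ s' → s' ≤ 2 →
        VolterraResolvent.CompNormLE (VolterraResolvent.fracPow A (-(s' / 2))) (S' t)
          (C₁ * (∫ τ in (0 : ℝ)..t, |b τ|) ^ (s' / 2) * t ^ (s' / 2 - 1))) := by
  choose! S' hS' using fun t (ht : 0 < t) => hS.exists_strongDeriv hA hb ht
  obtain ⟨C₀, hC₀, h₀⟩ := hS.exists_fracPow_bound hA hb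
  obtain ⟨C₁, hC₁, h₁⟩ := hS.exists_fracPow_deriv_bound hA hb
  refine ⟨S', C₀, C₁, hC₀, hC₁, hS', h₀, fun t ht s' hs hs' => ?_⟩
  have e : ∫ τ in (0 : ℝ)..t, |b τ| = VolterraResolvent.mass b t := by
    rw [intervalIntegral.integral_of_le ht.le, VolterraResolvent.mass]
    exact setIntegral_congr_fun measurableSet_Ioc fun τ hτ => abs_of_nonneg (hb.nonneg τ hτ.1)
  rw [e]
  exact h₁ t ht (S' t) (hS' t ht) s' hs hs'
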